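/- Let $n\ge 1$ and let $\mathfrak h_n$ be the $(2n+1)$-dimensional Heisenberg Lie algebra with basis $X_1,\dots,X_n,Y_1,\dots,Y_n,Z$, where $[X_i,Y_i]=Z$ for all $i$ and all other brackets of basis vectors vanish. Let $H_n$ be the Heisenberg group, identified with $\mathfrak h_n$ by the exponential map, so that $U\cdot V=U+V+\tfrac12[U,V]$. Let $\mathfrak v_0=\mathrm{Span}\{X_1,\dots,X_n,Y_1,\dots,Y_n\}$, let $P:\mathfrak h_n\to\mathfrak v_0$ be the projection along $Z$, and let $\omega:\mathfrak h_n\to\mathbb R$ be the linear form with kernel $\mathfrak v_0$ and $\omega(Z)=1$. Let $\boldsymbol r=(r_1,\dots,r_n)$ be positive integers with $r_i\mid r_{i+1}$ for $1\le i<n$, and let $\Gamma_{\boldsymbol r}<H_n$ be the lattice generated by $r_1X_1,\dots,r_nX_n,Y_1,\dots,Y_n,Z$. Let $\mathcal A$ be the set of linear maps $A:\mathfrak h_n\to\mathfrak h_n$, written as matrices in the above basis, whose kernel is spanned by a (possibly empty) subset of the basis and whose image is bracket generating (such maps have corank $0$ or $1$; $\mathcal A=\mathcal A_0\cup\mathcal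 A_1$ with $\mathcal A_k$ the set of those of corank $k$). Each $A\in\mathcal A$ determines the inner product $\langle\cdot,\cdot\rangle_A$ on $\mathrm{Im}\,A$ for which the nonzero images of the basis vectors are orthonormal, with norm $\|\cdot\|_A$; hence it determines a left invariant sub-Riemannian structure on $H_n$, and a sub-Riemannian distance $dist_A$ on $\Gamma_{\boldsymbol r}\backslash H_n$. Every left invariant sub-Riemannian metric on $\Gamma_{\boldsymbol r}\backslash H_n$ arises in this way. The moduli space $\mathcal M(\Gamma_{\boldsymbol r}\backslash H_n)$ is the set of isometry classes $[A]$ of the metric spaces $(\Gamma_{\boldsymbol r}\backslash H_n,dist_A)$, $A\in\mathcal A$, and its canonical topology is the quotient topology induced by $A\mapsto[A]$ from $\mathcal A\subset\mathbb R^{(2n+1)^2}$. A matrix $A\in\mathcal A$ is of weak canonical form if $A=\begin{pmatrix}\tilde A&0\\0&\rho_A\end{pmatrix}$ with $\tilde A$ a $2n\times 2n$ matrix (which is then invertible) and $\rho_A\in\mathbb R$; every class $[A]$ contains such matrices. For such $A$ let $j_A:\mathfrak v_0\to\mathfrak v_0$ be defined by $\langle j_A(U),V\rangle_A=\omega([U,V])$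 for all $U,V\in\mathfrak v_0$; its eigenvalues are $\pm\sqrt{-1}\,d_1(A),\dots,\pm\sqrt{-1}\,d_n(A)$ with $0<d_1(A)\le\dots\le d_n(A)$. **Theorem.** A subset $\mathcal X\subset\mathcal M(\Gamma_{\boldsymbol r}\backslash H_n)$ is precompact (i.e. has compact closure) in the canonical topology if and only if there are constants $C_1,C_2,C_3,C_+>0$ such that every $A\in\mathcal A=\mathcal A_0\cup\mathcal A_1$ of weak canonical form with $[A]\in\mathcal X$ satisfies - (A-1) $\min\{\|X\|_A \mid X\in P(\Gamma_{\boldsymbol r}),\ X\ne 0\}\ge C_1$, - (A-2) $|\det\tilde A|\ge C_2$, - (A-3) $d_n(A)\le C_3$, - (A-4)' $|\rho_A|\le C_+$. -/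

import Mathlib

/-! Coordinates: `inl (inl i)`, `inl (inr i)`, `inr ()` are the indices of the basis vectors
`X_i`, `Y_i`, `Z` of the Heisenberg Lie algebra of dimension `2n+1`; the vectors
`inl (inl i)`, `inl (inr i)` alone index the horizontal subspace spanned by the `X_i`, `Y_i`. -/

/-- Indices of the basis `X_1, …, X_n, Y_1, …, Y_n`. -/
abbrev HIdx (n : ℕ) : Type := Fin n ⊕ Fin n

/-- Indices of the basis `X_1, …, X_n, Y_1, …, Y_n, Z`. -/
abbrev Idx (n : ℕ) : Type := HIdx n ⊕ Unit

/-- The Heisenberg Lie algebra, in coordinates with respect to `X_i, Y_i, Z`. -/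
abbrev HeisLie (n : ℕ) : Type := Idx n → ℝ

/-- The number `ω([u, v])`, i.e. the coefficient of `Z` in the bracket, for `u, v` horizontal. -/
def symp {n : ℕ} (u v : HIdx n → ℝ) : ℝ :=
  ∑ i : Fin n, (u (Sum.inl i) * v (Sum.inr i) - u (Sum.inr i) * v (Sum.inl i))

/-- The Lie bracket: `[X_i, Y_i] = Z`, the other brackets of basis vectors vanish. -/
def heisBracket {n : ℕ} (u v : HeisLie n) : HeisLie n :=
  Pi.single (Sum.inr ()) (symp (fun i => u (Sum.inl i)) (fun i => v (Sum.inl i)))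

/-- The Heisenberg group `H_n`, in exponential coordinates: `⟨u⟩` is `exp u`. -/
@[ext] structure Heis (n : ℕ) where
  log : HeisLie n

/-- `exp u * exp v = exp (u + v + [u, v] / 2)`. -/
noncomputable instance (n : ℕ) : Mul (Heis n) :=
  ⟨fun p q => ⟨p.log + q.log + (1 / 2 : ℝ) • heisBracket p.log q.log⟩⟩

instance (n : ℕ) : One (Heis n) := ⟨⟨0⟩⟩

instance (n : ℕ) : Inv (Heis n) := ⟨fun p => ⟨-p.log⟩⟩

theorem Heis.mul_log {n : ℕ} (p q : Heis n) :
    (p * q).log = p.log + q.log + (1 / 2 : ℝ) • heisBracket p.log q.log := rfl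

theorem Heis.one_log {n : ℕ} : (1 : Heis n).log = 0 := rfl

theorem Heis.inv_log {n : ℕ} (p : Heis n) : (p⁻¹).log = -p.log := rfl

theorem symp_add_left {n : ℕ} (u u' v : HIdx n → ℝ) :
    symp (fun i => u i + u' i) v = symp u v + symp u' v := by
  simp only [symp, ← Finset.sum_add_distrib]
  exact Finset.sum_congr rfl fun i _ => by ring

theorem symp_add_right {n : ℕ} (u v v' : HIdx n → ℝ) :
    symp u (fun i => v i + v' i) = symp u v + symp u v' := by
  simp only [symp, ← Finset.sum_add_distrib]
  exact Finset.sum_congr rfl fun i _ => by ring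

noncomputable instance (n : ℕ) : Group (Heis n) :=
  Group.ofLeftAxioms
    (by
      intro p q s
      ext i
      rcases i with i | i
      · simp [Heis.mul_log, heisBracket, add_assoc]
      · simp [Heis.mul_log, heisBracket, symp_add_left, symp_add_right]
        ring)
    (by
      intro p
      ext i
      rcases i with i | i <;> simp [Heis.mul_log, Heis.one_log, heisBracket, symp])
    (by
      intro p
      ext i
      rcases i with i | i <;>
        simp [Heis.mul_log, Heis.one_log, Heis.inv_log, heisBracket, symp, mul_comm])

/-- The lattice generated by `r_1 X_1, …, r_n X_n, Y_1, …, Y_n, Z`. -/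
noncomputable def heisLattice {n : ℕ} (r : Fin n → ℕ) : Subgroup (Heis n) :=
  Subgroup.closure
    (Set.range (fun i : Fin n =>
        (⟨Pi.single (Sum.inl (Sum.inl i)) (r i : ℝ)⟩ : Heis n)) ∪
      Set.range (fun i : Fin n => (⟨Pi.single (Sum.inl (Sum.inr i)) 1⟩ : Heis n)) ∪
      {⟨Pi.single (Sum.inr ()) 1⟩})

/-- The projection of the lattice to the horizontal subspace. -/
def projLattice {n : ℕ} (r : Fin n → ℕ) : Set (HIdx n → ℝ) :=
  (fun (p : Heis n) (i : HIdx n) => p.log (Sum.inl i)) '' (heisLattice r : Set (Heis n))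

/-- The compact Heisenberg manifold `Γ_r \ H_n`: the set of cosets `Γ_r p`. -/
abbrev HeisManifold {n : ℕ} (r : Fin n → ℕ) : Type :=
  Quotient (QuotientGroup.rightRel (heisLattice r))

/-! ### Left-invariant sub-Riemannian structures -/

/-- `V`, `V + [V, V]`, `V + [V, V] + [V, [V, V]]`, … -/
def bracketFlag {n : ℕ} (V : Submodule ℝ (HeisLie n)) : ℕ → Submodule ℝ (HeisLie n)
  | 0 => V
  | k + 1 => bracketFlag V k ⊔
      Submodule.span ℝ {w | ∃ u ∈ V, ∃ v ∈ bracketFlag V k, w = heisBracket u v}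

def IsBracketGenerating {n : ℕ} (V : Submodule ℝ (HeisLie n)) : Prop :=
  ∃ k, bracketFlag V k = ⊤

/-- The union over all coranks of the sets of linear maps (written as matrices in the basis
`X_i, Y_i, Z`) whose kernel is spanned by basis vectors and whose image is bracket generating. -/
def frames (n : ℕ) : Set (Matrix (Idx n) (Idx n) ℝ) :=
  {A | (∃ S : Set (Idx n), LinearMap.ker A.mulVecLin =
          Submodule.span ℝ ((fun i => (Pi.single i 1 : HeisLie n)) '' S)) ∧
       IsBracketGenerating (LinearMap.range A.mulVecLin)}

/-- The differential at the identity of the left translation by `exp p`, in exponential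
coordinates. -/
noncomputable def leftDiff {n : ℕ} (p U : HeisLie n) : HeisLie n :=
  U + (1 / 2 : ℝ) • heisBracket p U

theorem hasDerivAt_leftDiff {n : ℕ} (p U : HeisLie n) :
    HasDerivAt (fun t : ℝ => ((⟨p⟩ : Heis n) * ⟨t • U⟩).log) (leftDiff p U) 0 := by
  have h : (fun t : ℝ => ((⟨p⟩ : Heis n) * ⟨t • U⟩).log)
      = fun t : ℝ => p + t • leftDiff p U := by
    funext t
    ext i
    rcases i with i | i
    · simp [Heis.mul_log, heisBracket, leftDiff]
    · have : symp (fun i => p (Sum.inl i)) (fun i => t * U (Sum.inl i))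
          = t * symp (fun i => p (Sum.inl i)) (fun i => U (Sum.inl i)) := by
        simp only [symp, Finset.mul_sum]
        exact Finset.sum_congr rfl fun i _ => by ring
      simp [Heis.mul_log, heisBracket, leftDiff, this]
      ring
  rw [h]
  simpa using ((hasDerivAt_id (0 : ℝ)).smul_const (leftDiff p U)).const_add p

/-- The left-invariant distribution with value `Im A` at the identity, at the point `exp p`. -/
def distribution {n : ℕ} (A : Matrix (Idx n) (Idx n) ℝ) (p : HeisLie n) : Set (HeisLie n) :=
  {v | ∃ U : HeisLie n, leftDiff p (A.mulVec U) = v}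

/-- The norm of the tangent vector `v ∈ distribution A p`: the smallest Euclidean length of a
coordinate vector `U` which is mapped to `v` by `A` followed by the left translation. When the
kernel of `A` is spanned by basis vectors, this is the norm of the left-invariant inner product
for which the nonzero columns of `A` are orthonormal. -/
noncomputable def subNorm {n : ℕ} (A : Matrix (Idx n) (Idx n) ℝ) (p v : HeisLie n) : ℝ :=
  sInf {ℓ : ℝ | ∃ U : HeisLie n, leftDiff p (A.mulVec U) = v ∧ ℓ = Real.sqrt (∑ i, U i ^ 2)}

/-- Admissible paths `[0, 1] → H_n`, in exponential coordinates: absolutely continuous and almost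
everywhere tangent to the distribution. -/
structure IsAdmissible {n : ℕ} (A : Matrix (Idx n) (Idx n) ℝ) (c : ℝ → HeisLie n) : Prop where
  absCont : AbsolutelyContinuousOnInterval c 0 1
  tangent : ∀ᵐ t ∂(MeasureTheory.volume.restrict (Set.Icc (0 : ℝ) 1)),
    deriv c t ∈ distribution A (c t)

/-- The length of an admissible path. -/
noncomputable def pathLength {n : ℕ} (A : Matrix (Idx n) (Idx n) ℝ) (c : ℝ → HeisLie n) :
    ENNReal :=
  ∫⁻ t in Set.Icc (0 : ℝ) 1, ENNReal.ofReal (subNorm A (c t) (deriv c t))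

/-- The sub-Riemannian distance on `H_n`. -/
noncomputable def heisDist {n : ℕ} (A : Matrix (Idx n) (Idx n) ℝ) (p q : Heis n) : ENNReal :=
  ⨅ (c : ℝ → HeisLie n) (_ : IsAdmissible A c ∧ c 0 = p.log ∧ c 1 = q.log), pathLength A c

/-- The sub-Riemannian distance on `Γ_r \ H_n`: admissible paths of the quotient are the
projections of admissible paths of `H_n`. -/
noncomputable def manifoldDist {n : ℕ} (r : Fin n → ℕ) (A : Matrix (Idx n) (Idx n) ℝ)
    (a b : HeisManifold r) : ENNReal :=
  ⨅ (p : Heis n) (q : Heis n) (_ : Quotient.mk _ p = a ∧ Quotient.mk _ q = b), heisDist A p q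

/-! ### The moduli space -/

/-- Two left-invariant sub-Riemannian metrics on `Γ_r \ H_n` are equivalent when the metric spaces
are isometric. -/
def isometrySetoid {n : ℕ} (r : Fin n → ℕ) : Setoid (frames n) where
  r A B := ∃ f : HeisManifold r ≃ HeisManifold r,
    ∀ a b, manifoldDist r B.1 (f a) (f b) = manifoldDist r A.1 a b
  iseqv :=
    { refl := fun _ => ⟨Equiv.refl _, fun _ _ => rfl⟩
      symm := by
        rintro A B ⟨f, hf⟩
        exact ⟨f.symm, fun a b => by simpa using (hf (f.symm a) (f.symm b)).symm⟩
      trans := by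
        rintro A B C ⟨f, hf⟩ ⟨g, hg⟩
        exact ⟨f.trans g, fun a b => by simp [hg, hf]⟩ }

/-- The moduli space of isometry classes of left-invariant sub-Riemannian metrics on `Γ_r \ H_n`.
It carries the quotient topology of `frames n`, a subspace of the space of matrices. -/
abbrev Moduli {n : ℕ} (r : Fin n → ℕ) : Type := Quotient (isometrySetoid r)

/-- The isometry class `[A]`. -/
def moduliClass {n : ℕ} (r : Fin n → ℕ) (A : frames n) : Moduli r :=
  Quotient.mk (isometrySetoid r) A

/-! ### Invariants of a matrix of weak canonical form -/

/-- `A` is block diagonal, with a block of size `2n` and a block of size `1`. -/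
def IsWeakCanonical {n : ℕ} (A : Matrix (Idx n) (Idx n) ℝ) : Prop :=
  A.toBlocks₁₂ = 0 ∧ A.toBlocks₂₁ = 0

/-- The block of size `2n`. -/
abbrev tildeBlock {n : ℕ} (A : Matrix (Idx n) (Idx n) ℝ) : Matrix (HIdx n) (HIdx n) ℝ :=
  A.toBlocks₁₁

/-- The block of size `1`. -/
abbrev rhoEntry {n : ℕ} (A : Matrix (Idx n) (Idx n) ℝ) : ℝ := A (Sum.inr ()) (Sum.inr ())

/-- The norm of the horizontal vector `X` at the identity. -/
noncomputable def horNorm {n : ℕ} (A : Matrix (Idx n) (Idx n) ℝ) (X : HIdx n → ℝ) : ℝ :=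
  subNorm A 0 (Sum.elim X 0)

/-- The inner product of horizontal vectors at the identity, for `A` of weak canonical form with
invertible block of size `2n`. -/
noncomputable def horInner {n : ℕ} (A : Matrix (Idx n) (Idx n) ℝ) (U V : HIdx n → ℝ) : ℝ :=
  ((tildeBlock A)⁻¹.mulVec U) ⬝ᵥ ((tildeBlock A)⁻¹.mulVec V)

/-- The matrix of the bilinear form `symp`. -/
def sympMatrix (n : ℕ) : Matrix (HIdx n) (HIdx n) ℝ := Matrix.fromBlocks 0 1 (-1) 0

theorem dotProduct_sympMatrix {n : ℕ} (U V : HIdx n → ℝ) :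
    U ⬝ᵥ ((sympMatrix n).mulVec V) = symp U V := by
  simp [sympMatrix, symp, Matrix.fromBlocks_mulVec, Matrix.neg_mulVec, dotProduct,
    Finset.sum_add_distrib, sub_eq_add_neg, Function.comp_def]

/-- The matrix, in the basis `X_1, …, Y_n`, of the operator `j_A` on the horizontal subspace
which is defined by `⟨j_A U, V⟩_A = ω([U, V])`. -/
def jMatrix {n : ℕ} (A : Matrix (Idx n) (Idx n) ℝ) : Matrix (HIdx n) (HIdx n) ℝ :=
  tildeBlock A * (tildeBlock A).transpose * (sympMatrix n).transpose

theorem horInner_jMatrix {n : ℕ} (A : Matrix (Idx n) (Idx n) ℝ)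
    (hA : IsUnit (tildeBlock A).det) (U V : HIdx n → ℝ) :
    horInner A ((jMatrix A).mulVec U) V = symp U V := by
  have h1 : (tildeBlock A)⁻¹.mulVec ((jMatrix A).mulVec U)
      = (tildeBlock A).transpose.mulVec ((sympMatrix n).transpose.mulVec U) := by
    rw [Matrix.mulVec_mulVec, Matrix.mulVec_mulVec, jMatrix, Matrix.mul_assoc,
      Matrix.nonsing_inv_mul_cancel_left _ _ hA]
  rw [horInner, h1, Matrix.mulVec_transpose, ← Matrix.dotProduct_mulVec, Matrix.mulVec_mulVec,
    Matrix.mul_nonsing_inv _ hA, Matrix.one_mulVec, Matrix.mulVec_transpose,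
    ← Matrix.dotProduct_mulVec, dotProduct_sympMatrix]

/-- The largest of the positive numbers `d_1 ≤ … ≤ d_n` such that `± √-1 d_1, …, ± √-1 d_n` are
the eigenvalues of `j_A`. -/
noncomputable def dMax {n : ℕ} (A : Matrix (Idx n) (Idx n) ℝ) : ℝ :=
  sSup {d : ℝ | Module.End.HasEigenvalue
    (Matrix.toLin' ((jMatrix A).map (fun x : ℝ => (x : ℂ)))) (Complex.I * (d : ℂ))}

/-! Write T for the horizontal block of a weak canonical frame A. In coordinates orthonormal for A
the projected lattice is T⁻¹P(Γ): (A-1) bounds its shortest vector from below, (A-2) bounds its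
covolume from above, (A-3) bounds the symplectic form on unit vectors, and ρ governs direct motion
along Z. Every class has such a representative, because the distance depends only on A Aᵀ
(`heisDist_congr`) and a right translation, which descends to the quotient, makes the Z-row
orthogonal to the other rows (`exists_weakCanonical`).

Bounds imply precompactness (`isCompact_closure_of_bounds`). A Hermite type reduction
(`hasReduction`, `exists_reduced_basis`) gives T⁻¹P(Γ) a basis with bounded entries. In this basis
the symplectic form has an integral matrix, bounded by (A-3) through `two_mul_symp_le`, so only
finitely many such matrices occur. Two bases with the same matrix differ by an integral symplectic
automorphism, which after correction by an inner automorphism preserves Γ and hence the isometry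
class (`moduliClass_sympAut`). Thus all classes of the set come from one compact set of frames. Its
image is closed because the moduli space is Hausdorff: it maps continuously and injectively to the
Gromov-Hausdorff space (`t2Space_moduli`).

Precompactness implies bounds (`exists_bounds_of_isCompact`). By compactness, uniform bounds near
each class [A₀] suffice, and they must hold for every weak canonical representative, so they are
derived from metric invariants alone: an upper bound D of the diameter, and the existence of
k^(2n+1) points at mutual distance at least c/k. Both persist near [A₀], since distances vary
uniformly with the frame, and A₀ has such points for every k with one c (`exists_separated`),
because coordinates are Lipschitz for small sub-Riemannian distances. The diameter alone yields
(A-2), by an integral determinant argument (`exists_le_abs_det`). If (A-1), (A-3) or (A-4)' fails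
badly at scale 1/k, then one of the 2n+1 coordinates becomes negligible: the central fibres are
short, or a short lattice vector eliminates one horizontal coordinate while making the fibres almost
short. Such a space is covered by O(k^(2n)) sets of diameter less than c/k
(`pow_le_pow_of_separated`), which is impossible for one large fixed k
(`exists_bounds_of_separated`). -/

open scoped Matrix

/-! ### Euclidean length -/

/-- The Euclidean length of a coordinate vector. -/
noncomputable def eLen {ι : Type*} [Fintype ι] (U : ι → ℝ) : ℝ := Real.sqrt (∑ i, U i ^ 2)

section eLen

variable {ι : Type*} [Fintype ι]

theorem eLen_nonneg (U : ι → ℝ) : 0 ≤ eLen U := Real.sqrt_nonneg _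

theorem eLen_sq (U : ι → ℝ) : eLen U ^ 2 = ∑ i, U i ^ 2 :=
  Real.sq_sqrt (Finset.sum_nonneg fun _ _ => sq_nonneg _)

theorem eLen_sq_dotProduct (U : ι → ℝ) : eLen U ^ 2 = U ⬝ᵥ U := by
  rw [eLen_sq, dotProduct]; exact Finset.sum_congr rfl fun i _ => by ring

theorem eLen_le_of_sq_le {U : ι → ℝ} {b : ℝ} (hb : 0 ≤ b) (h : ∑ i, U i ^ 2 ≤ b ^ 2) :
    eLen U ≤ b := Real.sqrt_le_iff.2 ⟨hb, h⟩

theorem abs_le_eLen (U : ι → ℝ) (i : ι) : |U i| ≤ eLen U := by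
  apply abs_le_of_sq_le_sq _ (eLen_nonneg U)
  rw [eLen_sq]
  exact Finset.single_le_sum (f := fun i => U i ^ 2) (fun _ _ => sq_nonneg _) (Finset.mem_univ i)

/-- The norm on `ι → ℝ` is the sup norm. Estimates are made in it and compared with Euclidean
lengths at the cost of a factor depending only on the dimension. -/
theorem norm_le_eLen (U : ι → ℝ) : ‖U‖ ≤ eLen U :=
  (pi_norm_le_iff_of_nonneg (eLen_nonneg U)).2 fun i => abs_le_eLen U i

theorem eLen_le_sum_abs (U : ι → ℝ) : eLen U ≤ ∑ i, |U i| := by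
  apply eLen_le_of_sq_le (Finset.sum_nonneg fun _ _ => abs_nonneg _)
  simpa using Finset.sum_sq_le_sq_sum_of_nonneg (s := Finset.univ) (f := fun i => |U i|)
    fun i _ => abs_nonneg _

theorem eLen_le_card_mul_norm (U : ι → ℝ) : eLen U ≤ Fintype.card ι * ‖U‖ := by
  refine (eLen_le_sum_abs U).trans ?_
  refine (Finset.sum_le_card_nsmul Finset.univ _ ‖U‖ fun i _ => norm_le_pi_norm U i).trans ?_
  simp

theorem eLen_smul (s : ℝ) (U : ι → ℝ) : eLen (s • U) = |s| * eLen U := by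
  have : ∑ i, (s • U) i ^ 2 = s ^ 2 * ∑ i, U i ^ 2 := by
    rw [Finset.mul_sum]
    exact Finset.sum_congr rfl fun i _ => by simp; ring
  rw [eLen, this, Real.sqrt_mul (sq_nonneg s), Real.sqrt_sq_eq_abs, eLen]

theorem eLen_neg (U : ι → ℝ) : eLen (-U) = eLen U := by
  simp [eLen]

theorem eLen_zero : eLen (0 : ι → ℝ) = 0 := by simp [eLen]

theorem eLen_pos {U : ι → ℝ} (h : U ≠ 0) : 0 < eLen U :=
  (norm_pos_iff.2 h).trans_le (norm_le_eLen U)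

theorem continuous_eLen : Continuous (eLen : (ι → ℝ) → ℝ) := by
  unfold eLen; fun_prop

theorem eLen_single [DecidableEq ι] (i : ι) (s : ℝ) : eLen (Pi.single i s) = |s| := by
  rw [eLen, Finset.sum_eq_single i, Pi.single_eq_same, Real.sqrt_sq_eq_abs]
  · intro j _ hj; simp [Pi.single_eq_of_ne hj]
  · simp

end eLen

/-! ### Coordinates -/

section Coordinates

variable {n : ℕ}

/-- The horizontal part of a vector. -/
def hor (u : HeisLie n) : HIdx n → ℝ := fun i => u (Sum.inl i)

/-- The coefficient of `Z`. -/
def ver (u : HeisLie n) : ℝ := u (Sum.inr ())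

/-- The multiples of `Z`. -/
def zVec (s : ℝ) : HeisLie n := Pi.single (Sum.inr ()) s

/-- The horizontal vector with given coordinates. -/
def horVec (v : HIdx n → ℝ) : HeisLie n := Sum.elim v 0

theorem lie_ext {u v : HeisLie n} (h : hor u = hor v) (h' : ver u = ver v) : u = v := by
  funext i
  rcases i with i | i
  · exact congrFun h i
  · exact h'

@[simp] theorem hor_add (u v : HeisLie n) : hor (u + v) = hor u + hor v := rfl
@[simp] theorem hor_sub (u v : HeisLie n) : hor (u - v) = hor u - hor v := rfl
@[simp] theorem hor_neg (u : HeisLie n) : hor (-u) = -hor u := rfl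
@[simp] theorem hor_smul (s : ℝ) (u : HeisLie n) : hor (s • u) = s • hor u := rfl
@[simp] theorem hor_zero : hor (0 : HeisLie n) = 0 := rfl
@[simp] theorem ver_add (u v : HeisLie n) : ver (u + v) = ver u + ver v := rfl
@[simp] theorem ver_sub (u v : HeisLie n) : ver (u - v) = ver u - ver v := rfl
@[simp] theorem ver_neg (u : HeisLie n) : ver (-u) = -ver u := rfl
@[simp] theorem ver_smul (s : ℝ) (u : HeisLie n) : ver (s • u) = s * ver u := rfl
@[simp] theorem ver_zero : ver (0 : HeisLie n) = 0 := rfl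
@[simp] theorem hor_zVec (s : ℝ) : hor (zVec s : HeisLie n) = 0 := by
  funext i; simp [hor, zVec]
@[simp] theorem ver_zVec (s : ℝ) : ver (zVec s : HeisLie n) = s := by simp [ver, zVec]
@[simp] theorem hor_horVec (v : HIdx n → ℝ) : hor (horVec v) = v := rfl
@[simp] theorem ver_horVec (v : HIdx n → ℝ) : ver (horVec v) = 0 := rfl

theorem norm_hor_le (u : HeisLie n) : ‖hor u‖ ≤ ‖u‖ :=
  (pi_norm_le_iff_of_nonneg (norm_nonneg u)).2 fun i => norm_le_pi_norm u (Sum.inl i)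

theorem abs_ver_le (u : HeisLie n) : |ver u| ≤ ‖u‖ := norm_le_pi_norm u (Sum.inr ())

theorem lie_norm_le {u : HeisLie n} {b : ℝ} (h : ‖hor u‖ ≤ b) (h' : |ver u| ≤ b) : ‖u‖ ≤ b := by
  refine (pi_norm_le_iff_of_nonneg ((norm_nonneg _).trans h)).2 fun i => ?_
  rcases i with i | i
  · exact (norm_le_pi_norm (hor u) i).trans h
  · exact h'

@[simp] theorem symp_add_left' (u u' v : HIdx n → ℝ) : symp (u + u') v = symp u v + symp u' v :=
  symp_add_left u u' v

@[simp] theorem symp_add_right' (u v v' : HIdx n → ℝ) : symp u (v + v') = symp u v + symp u v' :=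
  symp_add_right u v v'

@[simp] theorem symp_smul_left (s : ℝ) (u v : HIdx n → ℝ) : symp (s • u) v = s * symp u v := by
  simp only [symp, Finset.mul_sum]
  exact Finset.sum_congr rfl fun i _ => by simp; ring

@[simp] theorem symp_smul_right (s : ℝ) (u v : HIdx n → ℝ) : symp u (s • v) = s * symp u v := by
  simp only [symp, Finset.mul_sum]
  exact Finset.sum_congr rfl fun i _ => by simp; ring

@[simp] theorem symp_neg_left (u v : HIdx n → ℝ) : symp (-u) v = -symp u v := by
  simpa using symp_smul_left (-1) u v

@[simp] theorem symp_neg_right (u v : HIdx n → ℝ) : symp u (-v) = -symp u v := by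
  simpa using symp_smul_right (-1) u v

@[simp] theorem symp_sub_left (u u' v : HIdx n → ℝ) : symp (u - u') v = symp u v - symp u' v := by
  simp [sub_eq_add_neg]

@[simp] theorem symp_sub_right (u v v' : HIdx n → ℝ) : symp u (v - v') = symp u v - symp u v' := by
  simp [sub_eq_add_neg]

@[simp] theorem symp_zero_left (v : HIdx n → ℝ) : symp 0 v = 0 := by simp [symp]

@[simp] theorem symp_zero_right (v : HIdx n → ℝ) : symp v 0 = 0 := by simp [symp]

theorem symp_swap (u v : HIdx n → ℝ) : symp u v = -symp v u := by
  simp only [symp, ← Finset.sum_neg_distrib]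
  exact Finset.sum_congr rfl fun i _ => by ring

@[simp] theorem symp_self (u : HIdx n → ℝ) : symp u u = 0 := by
  have := symp_swap u u; linarith

theorem abs_symp_le (u v : HIdx n → ℝ) : |symp u v| ≤ 2 * n * ‖u‖ * ‖v‖ := by
  refine (Finset.abs_sum_le_sum_abs _ _).trans ?_
  refine (Finset.sum_le_card_nsmul Finset.univ _ (2 * ‖u‖ * ‖v‖) fun i _ => ?_).trans ?_
  · refine (abs_sub _ _).trans ?_
    rw [abs_mul, abs_mul]
    have h1 := mul_le_mul (norm_le_pi_norm u (Sum.inl i)) (norm_le_pi_norm v (Sum.inr i))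
      (norm_nonneg _) (norm_nonneg _)
    have h2 := mul_le_mul (norm_le_pi_norm u (Sum.inr i)) (norm_le_pi_norm v (Sum.inl i))
      (norm_nonneg _) (norm_nonneg _)
    simp only [Real.norm_eq_abs] at h1 h2
    linarith
  · simp; apply le_of_eq; ring

theorem heisBracket_eq (u v : HeisLie n) : heisBracket u v = zVec (symp (hor u) (hor v)) := rfl

@[simp] theorem hor_mul (p q : Heis n) : hor (p * q).log = hor p.log + hor q.log := by
  simp [Heis.mul_log, heisBracket_eq]

@[simp] theorem ver_mul (p q : Heis n) :
    ver (p * q).log = ver p.log + ver q.log + 1 / 2 * symp (hor p.log) (hor q.log) := by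
  simp [Heis.mul_log, heisBracket_eq]

@[simp] theorem hor_inv (p : Heis n) : hor (p⁻¹).log = -hor p.log := rfl
@[simp] theorem ver_inv (p : Heis n) : ver (p⁻¹).log = -ver p.log := rfl
@[simp] theorem hor_one : hor (1 : Heis n).log = 0 := rfl
@[simp] theorem ver_one : ver (1 : Heis n).log = 0 := rfl

theorem heis_ext {p q : Heis n} (h : hor p.log = hor q.log) (h' : ver p.log = ver q.log) :
    p = q := Heis.ext (lie_ext h h')

theorem zVec_comm (s : ℝ) (p : Heis n) : (⟨zVec s⟩ : Heis n) * p = p * ⟨zVec s⟩ := by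
  apply heis_ext <;> simp [add_comm]

theorem zVec_mul (s t : ℝ) : (⟨zVec s⟩ : Heis n) * ⟨zVec t⟩ = ⟨zVec (s + t)⟩ := by
  apply heis_ext <;> simp

@[simp] theorem hor_leftDiff (p U : HeisLie n) : hor (leftDiff p U) = hor U := by
  simp [leftDiff, heisBracket_eq]

@[simp] theorem ver_leftDiff (p U : HeisLie n) :
    ver (leftDiff p U) = ver U + 1 / 2 * symp (hor p) (hor U) := by
  simp [leftDiff, heisBracket_eq]

theorem leftDiff_neg_leftDiff (p U : HeisLie n) : leftDiff (-p) (leftDiff p U) = U := by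
  apply lie_ext <;> simp

theorem leftDiff_injective (p : HeisLie n) : Function.Injective (leftDiff p) :=
  Function.LeftInverse.injective (leftDiff_neg_leftDiff p)

end Coordinates

/-! ### Frames -/

section Frames

variable {n : ℕ}

theorem exists_symp_eq_one (hn : 1 ≤ n) : ∃ a b : HIdx n → ℝ, symp a b = 1 := by
  refine ⟨Pi.single (Sum.inl ⟨0, hn⟩) 1, Pi.single (Sum.inr ⟨0, hn⟩) 1, ?_⟩
  rw [symp, Finset.sum_eq_single ⟨0, hn⟩] <;> simp
  intro b hb; left; rw [Pi.single_eq_of_ne]; simpa using hb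

/-- Brackets are central, so iterating them never enlarges the horizontal projection. Hence a
bracket generating image already projects onto the whole horizontal space. -/
theorem bracketFlag_hor (V : Submodule ℝ (HeisLie n)) (k : ℕ) :
    ∀ w ∈ bracketFlag V k, ∃ u ∈ V, hor u = hor w := by
  induction k with
  | zero => exact fun w hw => ⟨w, hw, rfl⟩
  | succ k ih =>
    intro w hw
    obtain ⟨a, ha, b, hb, rfl⟩ := Submodule.mem_sup.1 hw
    obtain ⟨u, hu, hua⟩ := ih a ha
    refine ⟨u, hu, ?_⟩
    have : hor b = 0 := by
      clear hw
      induction hb using Submodule.span_induction with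
      | mem x hx =>
        obtain ⟨u, -, v, -, rfl⟩ := hx
        simp [heisBracket_eq]
      | zero => rfl
      | add x y _ _ hx hy => simp [hx, hy]
      | smul a x _ hx => simp [hx]
    simp [hua, this]

theorem hor_mulVec_surjective {A : Matrix (Idx n) (Idx n) ℝ} (hA : A ∈ frames n)
    (v : HIdx n → ℝ) : ∃ U, hor (A *ᵥ U) = v := by
  obtain ⟨-, k, hk⟩ := hA
  obtain ⟨w, ⟨U, rfl⟩, hw⟩ := bracketFlag_hor _ k (horVec v) (by rw [hk]; trivial)
  exact ⟨U, hw⟩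

/-- Two vectors of the image lying over a symplectic pair have bracket Z, so a single bracket step
fills the algebra. -/
theorem isBracketGenerating_of_hor_surjective (hn : 1 ≤ n) {A : Matrix (Idx n) (Idx n) ℝ}
    (h : ∀ v : HIdx n → ℝ, ∃ U, hor (A *ᵥ U) = v) :
    IsBracketGenerating (LinearMap.range A.mulVecLin) := by
  refine ⟨1, eq_top_iff.2 fun w _ => ?_⟩
  obtain ⟨a, b, hab⟩ := exists_symp_eq_one hn
  obtain ⟨U, hU⟩ := h a
  obtain ⟨V, hV⟩ := h b
  obtain ⟨W, hW⟩ := h (hor w)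
  have hw : w = A *ᵥ W + (ver w - ver (A *ᵥ W)) • heisBracket (A *ᵥ U) (A *ᵥ V) := by
    apply lie_ext <;> simp [heisBracket_eq, hU, hV, hW, hab]
  rw [hw]
  refine Submodule.add_mem_sup ⟨W, rfl⟩ (Submodule.smul_mem _ _ (Submodule.subset_span ?_))
  exact ⟨_, ⟨U, rfl⟩, _, ⟨V, rfl⟩, rfl⟩

/-- A linear lift of horizontal vectors to controls. A bound on its norm is what bounds distances
from above. -/
theorem exists_right_inverse {A : Matrix (Idx n) (Idx n) ℝ} (hA : A ∈ frames n) :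
    ∃ N : Matrix (Idx n) (HIdx n) ℝ, ∀ v, hor (A *ᵥ (N *ᵥ v)) = v := by
  let f : (Idx n → ℝ) →ₗ[ℝ] (HIdx n → ℝ) := LinearMap.funLeft ℝ ℝ Sum.inl ∘ₗ A.mulVecLin
  have hf : LinearMap.range f = ⊤ := by
    rw [LinearMap.range_eq_top]
    intro v
    obtain ⟨U, hU⟩ := hor_mulVec_surjective hA v
    exact ⟨U, hU⟩
  obtain ⟨g, hg⟩ := f.exists_rightInverse_of_surjective hf
  refine ⟨LinearMap.toMatrix' g, fun v => ?_⟩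
  have := LinearMap.congr_fun hg v
  rw [← Matrix.toLin'_apply (LinearMap.toMatrix' g), Matrix.toLin'_toMatrix']
  exact this

theorem hor_mulVec_of_isWeakCanonical {A : Matrix (Idx n) (Idx n) ℝ} (h : IsWeakCanonical A)
    (U : HeisLie n) : hor (A *ᵥ U) = tildeBlock A *ᵥ hor U := by
  have h12 : ∀ i, A (Sum.inl i) (Sum.inr ()) = 0 := fun i => congrFun (congrFun h.1 i) ()
  funext i
  simp [hor, Matrix.mulVec, dotProduct, Fintype.sum_sum_type, h12, Matrix.toBlocks₁₁]

theorem ver_mulVec_of_isWeakCanonical {A : Matrix (Idx n) (Idx n) ℝ} (h : IsWeakCanonical A)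
    (U : HeisLie n) : ver (A *ᵥ U) = rhoEntry A * ver U := by
  have h21 : ∀ i, A (Sum.inr ()) (Sum.inl i) = 0 := fun i => congrFun (congrFun h.2 ()) i
  have h1 : ∀ i, A (Sum.inr ()) (Sum.inl (Sum.inl i)) = 0 := fun i => h21 _
  have h2 : ∀ i, A (Sum.inr ()) (Sum.inl (Sum.inr i)) = 0 := fun i => h21 _
  simp [ver, Matrix.mulVec, dotProduct, Fintype.sum_sum_type, h1, h2]

theorem isUnit_det_of_frames {A : Matrix (Idx n) (Idx n) ℝ} (h : IsWeakCanonical A)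
    (hA : A ∈ frames n) : IsUnit (tildeBlock A).det := by
  rw [← Matrix.isUnit_iff_isUnit_det, ← Matrix.mulVec_surjective_iff_isUnit]
  intro v
  obtain ⟨U, hU⟩ := hor_mulVec_surjective hA v
  exact ⟨hor U, by rw [← hor_mulVec_of_isWeakCanonical h, hU]⟩

/-- Both coranks are covered: the kernel is the Z-axis when ρ = 0 and trivial otherwise. -/
theorem mem_frames_of_isUnit_det (hn : 1 ≤ n) {A : Matrix (Idx n) (Idx n) ℝ}
    (h : IsWeakCanonical A) (hA : IsUnit (tildeBlock A).det) : A ∈ frames n := by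
  refine ⟨?_, isBracketGenerating_of_hor_surjective hn fun v => ?_⟩
  · have key : ∀ U : HeisLie n, A *ᵥ U = 0 ↔ hor U = 0 ∧ rhoEntry A * ver U = 0 := by
      intro U
      rw [← hor_zero (n := n), ← ver_mulVec_of_isWeakCanonical h]
      constructor
      · intro hU
        have h1 : tildeBlock A *ᵥ hor U = 0 := by
          rw [← hor_mulVec_of_isWeakCanonical h, hU]; rfl
        refine ⟨?_, by rw [hU]; rfl⟩
        have := congrArg ((tildeBlock A)⁻¹ *ᵥ ·) h1
        simpa [Matrix.nonsing_inv_mul _ hA] using this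
      · rintro ⟨h1, h2⟩
        refine lie_ext ?_ h2
        rw [hor_mulVec_of_isWeakCanonical h, h1]; simp
    by_cases hρ : rhoEntry A = 0
    · refine ⟨{Sum.inr ()}, ?_⟩
      ext U
      rw [LinearMap.mem_ker, Matrix.mulVecLin_apply, key, Set.image_singleton,
        Submodule.mem_span_singleton]
      constructor
      · rintro ⟨h1, -⟩
        refine ⟨ver U, ?_⟩
        apply lie_ext
        · change ver U • hor (zVec 1) = _
          simp [h1]
        · change ver U * ver (zVec 1 : HeisLie n) = _
          simp
      · rintro ⟨a, rfl⟩
        refine ⟨?_, by simp [hρ]⟩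
        change a • hor (zVec 1) = _
        simp
    · refine ⟨∅, ?_⟩
      ext U
      rw [LinearMap.mem_ker, Matrix.mulVecLin_apply, key, Set.image_empty, Submodule.span_empty,
        Submodule.mem_bot]
      constructor
      · rintro ⟨h1, h2⟩
        exact lie_ext h1 (by simpa [hρ] using h2)
      · rintro rfl; simp
  · refine ⟨horVec ((tildeBlock A)⁻¹ *ᵥ v), ?_⟩
    rw [hor_mulVec_of_isWeakCanonical h, hor_horVec, Matrix.mulVec_mulVec,
      Matrix.mul_nonsing_inv _ hA, Matrix.one_mulVec]

end Frames

/-! ### The sub-Riemannian norm -/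

section SubNorm

variable {n : ℕ}

theorem subNorm_leftDiff_le (A : Matrix (Idx n) (Idx n) ℝ) (p U : HeisLie n) :
    subNorm A p (leftDiff p (A *ᵥ U)) ≤ eLen U := by
  apply csInf_le
  · exact ⟨0, by rintro _ ⟨V, -, rfl⟩; exact Real.sqrt_nonneg _⟩
  · exact ⟨U, rfl, rfl⟩

theorem subNorm_leftDiff_eq_of_forall_le {A : Matrix (Idx n) (Idx n) ℝ} (p U : HeisLie n)
    (h : ∀ V, A *ᵥ V = A *ᵥ U → eLen U ≤ eLen V) :
    subNorm A p (leftDiff p (A *ᵥ U)) = eLen U := by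
  apply le_antisymm (subNorm_leftDiff_le A p U)
  refine le_csInf ⟨eLen U, U, rfl, rfl⟩ ?_
  rintro _ ⟨V, hV, rfl⟩
  exact h V (leftDiff_injective p hV)

/-- A linear choice of shortest preimages. -/
theorem exists_minimal_section {A : Matrix (Idx n) (Idx n) ℝ} (hA : A ∈ frames n) :
    ∃ N : Matrix (Idx n) (Idx n) ℝ, ∀ U p : HeisLie n, A *ᵥ (N *ᵥ (A *ᵥ U)) = A *ᵥ U ∧
      subNorm A p (leftDiff p (A *ᵥ U)) = eLen (N *ᵥ (A *ᵥ U)) := by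
  classical
  obtain ⟨⟨S, hS⟩, -⟩ := hA
  -- The kernel is a coordinate subspace, so the orthogonal projection off it just erases the
  -- coordinates in `S`; it sends each vector to the shortest one with the same image.
  let P : (Idx n → ℝ) →ₗ[ℝ] (Idx n → ℝ) :=
    LinearMap.pi fun i => if i ∈ S then 0 else LinearMap.proj i
  have hP : ∀ U i, P U i = if i ∈ S then 0 else U i := by
    intro U i
    simp only [P, LinearMap.pi_apply]
    split_ifs <;> rfl
  have hkerP : LinearMap.ker A.mulVecLin ≤ LinearMap.ker P := by
    rw [hS, Submodule.span_le]
    rintro _ ⟨i, hi, rfl⟩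
    rw [SetLike.mem_coe, LinearMap.mem_ker]
    funext j
    rw [hP]
    split_ifs with hj
    · rfl
    · refine Pi.single_eq_of_ne ?_ _
      rintro rfl; exact hj hi
  have hAP : ∀ U, A *ᵥ (P U) = A *ᵥ U := by
    intro U
    have : U - P U ∈ LinearMap.ker A.mulVecLin := by
      rw [hS]
      have : U - P U = ∑ i, (if i ∈ S then U i else 0) • (Pi.single i 1 : HeisLie n) := by
        funext j
        rw [Finset.sum_apply, Finset.sum_eq_single j]
        · simp only [Pi.sub_apply, hP, Pi.smul_apply, Pi.single_eq_same, smul_eq_mul, mul_one]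
          split_ifs <;> simp
        · intro b _ hb
          simp [Pi.single_eq_of_ne hb.symm]
        · simp
      rw [this]
      refine Submodule.sum_mem _ fun i _ => ?_
      split_ifs with hi
      · exact Submodule.smul_mem _ _ (Submodule.subset_span ⟨i, hi, rfl⟩)
      · simp
    have h2 : A *ᵥ (U - P U) = 0 := this
    rw [Matrix.mulVec_sub, sub_eq_zero] at h2
    exact h2.symm
  -- `P` depends only on the image under `A`, so it factors through the range; extending from the
  -- range to the whole space gives a matrix.
  let g : LinearMap.range A.mulVecLin →ₗ[ℝ] (Idx n → ℝ) :=
    (LinearMap.ker A.mulVecLin).liftQ P hkerP ∘ₗ A.mulVecLin.quotKerEquivRange.symm.toLinearMap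
  obtain ⟨G, hG⟩ := LinearMap.exists_extend g
  have hGA : ∀ U, G (A *ᵥ U) = P U := by
    intro U
    have h1 : G (A *ᵥ U) = g ⟨A *ᵥ U, U, rfl⟩ := LinearMap.congr_fun hG ⟨A *ᵥ U, U, rfl⟩
    rw [h1]
    have h2 : (⟨A *ᵥ U, U, rfl⟩ : LinearMap.range A.mulVecLin)
        = A.mulVecLin.quotKerEquivRange (Submodule.Quotient.mk U) := by
      ext1; simp
    simp only [g, LinearMap.comp_apply, LinearEquiv.coe_coe, h2, LinearEquiv.symm_apply_apply]
    simp
  refine ⟨LinearMap.toMatrix' G, fun U p => ?_⟩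
  have hN : (LinearMap.toMatrix' G) *ᵥ (A *ᵥ U) = P U := by
    rw [← Matrix.toLin'_apply (LinearMap.toMatrix' G), Matrix.toLin'_toMatrix', hGA]
  rw [hN]
  refine ⟨hAP U, ?_⟩
  rw [← hAP U]
  apply subNorm_leftDiff_eq_of_forall_le
  intro V hV
  have : P U = P V := by rw [← hGA, ← hGA, hV, hAP]
  rw [this]
  apply Real.sqrt_le_sqrt
  refine Finset.sum_le_sum fun i _ => ?_
  rw [hP]
  split_ifs
  · simpa using sq_nonneg _
  · exact le_rfl

theorem dotProduct_mulVec_transpose {m : Type*} [Fintype m] (A : Matrix m m ℝ) (x y : m → ℝ) :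
    (Aᵀ *ᵥ x) ⬝ᵥ y = x ⬝ᵥ (A *ᵥ y) := by
  rw [Matrix.mulVec_transpose, ← Matrix.dotProduct_mulVec]

/-- The image of Aᵀ is orthogonal to the kernel of A, so its vectors are the shortest in their
fibres. -/
theorem eLen_transpose_mulVec_le {m : Type*} [Fintype m] (A : Matrix m m ℝ) (x V : m → ℝ)
    (h : A *ᵥ V = A *ᵥ (Aᵀ *ᵥ x)) : eLen (Aᵀ *ᵥ x) ≤ eLen V := by
  apply eLen_le_of_sq_le (eLen_nonneg V)
  rw [← eLen_sq, eLen_sq_dotProduct, eLen_sq_dotProduct]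
  have h1 : (Aᵀ *ᵥ x) ⬝ᵥ V = (Aᵀ *ᵥ x) ⬝ᵥ (Aᵀ *ᵥ x) := by
    rw [dotProduct_mulVec_transpose, dotProduct_mulVec_transpose, h]
  have h2 : 0 ≤ (V - Aᵀ *ᵥ x) ⬝ᵥ (V - Aᵀ *ᵥ x) := by
    rw [← eLen_sq_dotProduct]; positivity
  rw [sub_dotProduct, dotProduct_sub, dotProduct_sub, h1, dotProduct_comm V (Aᵀ *ᵥ x), h1] at h2
  linarith

/-- A Aᵀ has the same rank, hence the same range, as A; so every fibre of A contains a minimal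
vector of the form Aᵀx. -/
theorem exists_mul_transpose_mulVec {m : Type*} [Fintype m] [DecidableEq m] (A : Matrix m m ℝ)
    (U : m → ℝ) : ∃ x, A *ᵥ (Aᵀ *ᵥ x) = A *ᵥ U := by
  have h : LinearMap.range (A * Aᵀ).mulVecLin = LinearMap.range A.mulVecLin := by
    apply Submodule.eq_of_le_of_finrank_eq
    · rintro _ ⟨x, rfl⟩
      exact ⟨Aᵀ *ᵥ x, Matrix.mulVec_mulVec _ _ _⟩
    · exact Matrix.rank_self_mul_transpose A
  have : A *ᵥ U ∈ LinearMap.range (A * Aᵀ).mulVecLin := by rw [h]; exact ⟨U, rfl⟩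
  obtain ⟨x, hx⟩ := this
  exact ⟨x, (Matrix.mulVec_mulVec _ _ _).trans hx⟩

/-- The sub-Riemannian structure depends on `A * Aᵀ` only. -/
theorem subNorm_congr {A B : Matrix (Idx n) (Idx n) ℝ} (h : A * Aᵀ = B * Bᵀ) (p U : HeisLie n) :
    ∃ V, A *ᵥ U = B *ᵥ V ∧
      subNorm B p (leftDiff p (A *ᵥ U)) = subNorm A p (leftDiff p (A *ᵥ U)) := by
  obtain ⟨x, hx⟩ := exists_mul_transpose_mulVec A U
  have hAB : A *ᵥ (Aᵀ *ᵥ x) = B *ᵥ (Bᵀ *ᵥ x) := by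
    rw [Matrix.mulVec_mulVec, h, Matrix.mulVec_mulVec]
  refine ⟨Bᵀ *ᵥ x, by rw [← hx, hAB], ?_⟩
  rw [← hx, subNorm_leftDiff_eq_of_forall_le p _ fun V hV => eLen_transpose_mulVec_le A x V hV, hAB,
    subNorm_leftDiff_eq_of_forall_le p _ fun V hV => eLen_transpose_mulVec_le B x V hV]
  -- Both squared lengths equal the quadratic form x ↦ x ⬝ A Aᵀ x.
  have : eLen (Bᵀ *ᵥ x) ^ 2 = eLen (Aᵀ *ᵥ x) ^ 2 := by
    rw [eLen_sq_dotProduct, eLen_sq_dotProduct, dotProduct_mulVec_transpose,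
      dotProduct_mulVec_transpose, hAB]
  exact (pow_left_inj₀ (eLen_nonneg _) (eLen_nonneg _) two_ne_zero).1 this

/-- Every preimage of `X` has horizontal part T⁻¹X; a vertical part, possible only for ρ = 0, just
adds length. -/
theorem horNorm_eq {A : Matrix (Idx n) (Idx n) ℝ} (h : IsWeakCanonical A)
    (hA : IsUnit (tildeBlock A).det) (X : HIdx n → ℝ) :
    horNorm A X = eLen ((tildeBlock A)⁻¹ *ᵥ X) := by
  have h0 : leftDiff 0 (A *ᵥ (horVec ((tildeBlock A)⁻¹ *ᵥ X))) = Sum.elim X 0 := by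
    apply lie_ext
    · rw [hor_leftDiff, hor_mulVec_of_isWeakCanonical h, hor_horVec, Matrix.mulVec_mulVec,
        Matrix.mul_nonsing_inv _ hA, Matrix.one_mulVec]; rfl
    · rw [ver_leftDiff, ver_mulVec_of_isWeakCanonical h, ver_horVec]; simp [ver]
  have hlen : ∀ V : HeisLie n, eLen V ^ 2 = eLen (hor V) ^ 2 + ver V ^ 2 := by
    intro V
    simp [eLen_sq, Fintype.sum_sum_type, hor, ver]
  have hlen0 : eLen (horVec ((tildeBlock A)⁻¹ *ᵥ X)) = eLen ((tildeBlock A)⁻¹ *ᵥ X) := by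
    apply (pow_left_inj₀ (eLen_nonneg _) (eLen_nonneg _) two_ne_zero).1
    rw [hlen]; simp
  rw [horNorm, ← h0, subNorm_leftDiff_eq_of_forall_le, hlen0]
  intro V hV
  have h1 : hor V = (tildeBlock A)⁻¹ *ᵥ X := by
    have := congrArg hor hV
    rw [hor_mulVec_of_isWeakCanonical h, hor_mulVec_of_isWeakCanonical h, hor_horVec] at this
    have := congrArg ((tildeBlock A)⁻¹ *ᵥ ·) this
    rwa [Matrix.mulVec_mulVec, Matrix.mulVec_mulVec, Matrix.nonsing_inv_mul _ hA,
      Matrix.one_mulVec, Matrix.one_mulVec] at this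
  rw [hlen0, ← h1]
  apply (pow_le_pow_iff_left₀ (eLen_nonneg _) (eLen_nonneg _) two_ne_zero).1
  rw [hlen V]
  linarith [sq_nonneg (ver V)]

end SubNorm

/-! ### The lattice in coordinates -/

section Lattice

variable {n : ℕ}

/-- The integers, as an additive subgroup of the reals. -/
abbrev intReal : AddSubgroup ℝ := AddSubgroup.zmultiples (1 : ℝ)

/-- The length of the basis vectors of the horizontal lattice. -/
def latScale (r : Fin n → ℕ) : HIdx n → ℝ := Sum.elim (fun i => (r i : ℝ)) 1

/-- The lattice spanned by `r_i X_i, Y_i`. -/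
def horLattice (r : Fin n → ℕ) : AddSubgroup (HIdx n → ℝ) where
  carrier := {v | ∀ i, v i ∈ AddSubgroup.zmultiples (latScale r i)}
  add_mem' hu hv i := add_mem (hu i) (hv i)
  zero_mem' _ := zero_mem _
  neg_mem' hu i := neg_mem (hu i)

theorem mem_horLattice {r : Fin n → ℕ} {v : HIdx n → ℝ} :
    v ∈ horLattice r ↔ ∀ i, v i ∈ AddSubgroup.zmultiples (latScale r i) := Iff.rfl

theorem mem_intReal_iff {x : ℝ} : x ∈ intReal ↔ ∃ k : ℤ, (k : ℝ) = x := by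
  simp [AddSubgroup.mem_zmultiples_iff]

theorem intCast_mem_intReal (k : ℤ) : (k : ℝ) ∈ intReal := mem_intReal_iff.2 ⟨k, rfl⟩

theorem mul_mem_intReal {x y : ℝ} (hx : x ∈ intReal) (hy : y ∈ intReal) : x * y ∈ intReal := by
  obtain ⟨k, rfl⟩ := mem_intReal_iff.1 hx
  obtain ⟨l, rfl⟩ := mem_intReal_iff.1 hy
  exact mem_intReal_iff.2 ⟨k * l, by push_cast; rfl⟩

theorem eq_zero_of_mem_intReal {x : ℝ} (hx : x ∈ intReal) (h : |x| < 1) : x = 0 := by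
  obtain ⟨k, rfl⟩ := mem_intReal_iff.1 hx
  have : |k| < 1 := by exact_mod_cast h
  rw [Int.abs_lt_one_iff.1 this]; simp

theorem latScale_pos {r : Fin n → ℕ} (hr : ∀ i, 0 < r i) (i : HIdx n) : 0 < latScale r i := by
  rcases i with i | i
  · exact Nat.cast_pos.2 (hr i)
  · exact one_pos

theorem latScale_mem_intReal (r : Fin n → ℕ) (i : HIdx n) : latScale r i ∈ intReal := by
  rcases i with i | i
  · exact intCast_mem_intReal (r i : ℤ)
  · exact mem_intReal_iff.2 ⟨1, by simp [latScale]⟩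

theorem mem_horLattice_iff_exists {r : Fin n → ℕ} {v : HIdx n → ℝ} :
    v ∈ horLattice r ↔ ∃ x : HIdx n → ℤ, v = fun i => latScale r i * x i := by
  simp only [mem_horLattice, AddSubgroup.mem_zmultiples_iff, zsmul_eq_mul]
  constructor
  · intro h
    choose x hx using h
    exact ⟨x, funext fun i => by rw [← hx, mul_comm]⟩
  · rintro ⟨x, rfl⟩ i
    exact ⟨x i, mul_comm _ _⟩

theorem coord_mem_intReal {r : Fin n → ℕ} {v : HIdx n → ℝ} (hv : v ∈ horLattice r) (i : HIdx n) :
    v i ∈ intReal := by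
  obtain ⟨x, rfl⟩ := mem_horLattice_iff_exists.1 hv
  exact mul_mem_intReal (latScale_mem_intReal r i) (intCast_mem_intReal _)

theorem symp_mem_intReal {r : Fin n → ℕ} {u v : HIdx n → ℝ} (hu : u ∈ horLattice r)
    (hv : v ∈ horLattice r) : symp u v ∈ intReal :=
  sum_mem fun _ _ => sub_mem (mul_mem_intReal (coord_mem_intReal hu _) (coord_mem_intReal hv _))
    (mul_mem_intReal (coord_mem_intReal hu _) (coord_mem_intReal hv _))

theorem eq_zero_of_mem_horLattice {r : Fin n → ℕ} {v : HIdx n → ℝ} (hv : v ∈ horLattice r)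
    (h : ‖v‖ < 1) : v = 0 :=
  funext fun i => eq_zero_of_mem_intReal (coord_mem_intReal hv i)
    ((norm_le_pi_norm v i).trans_lt h)

/-- The quadratic form which gives the vertical coordinates of lattice points modulo `1`. -/
noncomputable def halfForm (v : HIdx n → ℝ) : ℝ :=
  1 / 2 * ∑ i : Fin n, v (Sum.inl i) * v (Sum.inr i)

/-- Up to the last sum, which is integral on the lattice, `halfForm` has the same cocycle as the
group law. So subtracting it from the vertical coordinate gives a homomorphism modulo integers over
the horizontal lattice. -/
theorem halfForm_add (u v : HIdx n → ℝ) :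
    halfForm (u + v) = halfForm u + halfForm v + 1 / 2 * symp u v
      + ∑ i : Fin n, u (Sum.inr i) * v (Sum.inl i) := by
  have : ∑ i : Fin n, u (Sum.inr i) * v (Sum.inl i)
      = 1 / 2 * ∑ i : Fin n, 2 * (u (Sum.inr i) * v (Sum.inl i)) := by
    rw [← Finset.mul_sum]; ring
  rw [this]
  simp only [halfForm, symp, ← mul_add, ← Finset.sum_add_distrib]
  congr 1
  exact Finset.sum_congr rfl fun i _ => by simp; ring

theorem halfForm_zero : halfForm (0 : HIdx n → ℝ) = 0 := by simp [halfForm]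

theorem halfForm_neg (v : HIdx n → ℝ) : halfForm (-v) = halfForm v := by simp [halfForm]

theorem two_mul_halfForm (u : HIdx n → ℝ) : 2 * halfForm u
    = ∑ i : Fin n, u (Sum.inl i) * u (Sum.inr i) := by
  rw [halfForm]; ring

/-- The explicit description of the lattice. -/
noncomputable def explicitLattice (r : Fin n → ℕ) : Subgroup (Heis n) where
  carrier := {p | hor p.log ∈ horLattice r ∧ ver p.log - halfForm (hor p.log) ∈ intReal}
  mul_mem' := by
    rintro p q ⟨hp, hp'⟩ ⟨hq, hq'⟩
    refine ⟨by rw [hor_mul]; exact add_mem hp hq, ?_⟩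
    rw [hor_mul, ver_mul, halfForm_add]
    have h : ∑ i : Fin n, hor p.log (Sum.inr i) * hor q.log (Sum.inl i) ∈ intReal :=
      sum_mem fun _ _ => mul_mem_intReal (coord_mem_intReal hp _) (coord_mem_intReal hq _)
    have := sub_mem (add_mem hp' hq') h
    convert this using 1
    ring
  one_mem' := by
    refine ⟨zero_mem _, ?_⟩
    rw [hor_one, ver_one, halfForm_zero, sub_zero]
    exact zero_mem _
  inv_mem' := by
    rintro p ⟨hp, hp'⟩
    refine ⟨by rw [hor_inv]; exact neg_mem hp, ?_⟩
    rw [hor_inv, ver_inv, halfForm_neg]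
    have h : ∑ i : Fin n, hor p.log (Sum.inl i) * hor p.log (Sum.inr i) ∈ intReal :=
      sum_mem fun _ _ => mul_mem_intReal (coord_mem_intReal hp _) (coord_mem_intReal hp _)
    rw [← two_mul_halfForm] at h
    have := sub_mem (neg_mem hp') h
    convert this using 1
    ring

theorem mem_explicitLattice {r : Fin n → ℕ} {p : Heis n} : p ∈ explicitLattice r ↔
    hor p.log ∈ horLattice r ∧ ver p.log - halfForm (hor p.log) ∈ intReal := Iff.rfl

theorem heisLattice_le (r : Fin n → ℕ) : heisLattice r ≤ explicitLattice r := by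
  have hs : ∀ (i : HIdx n), (⟨Pi.single (Sum.inl i) (latScale r i)⟩ : Heis n)
      ∈ explicitLattice r := by
    intro i
    have hh : hor (Pi.single (Sum.inl i) (latScale r i)) = Pi.single i (latScale r i) := by
      funext j
      simp [hor, Pi.single_apply]
    have hv : ver (Pi.single (Sum.inl i) (latScale r i) : HeisLie n) = 0 := by simp [ver]
    rw [mem_explicitLattice]
    simp only [hh, hv]
    have h0 : halfForm (Pi.single i (latScale r i)) = 0 := by
      rw [halfForm, Finset.sum_eq_zero, mul_zero]
      intro j _
      rcases i with i | i <;> simp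
    rw [h0, sub_zero]
    refine ⟨fun j => ?_, zero_mem _⟩
    by_cases hj : j = i
    · subst hj; simp
    · rw [Pi.single_eq_of_ne hj]; exact zero_mem _
  rw [heisLattice, Subgroup.closure_le]
  rintro p ((⟨i, rfl⟩ | ⟨i, rfl⟩) | rfl)
  · exact hs (Sum.inl i)
  · exact hs (Sum.inr i)
  · change hor (zVec 1) ∈ horLattice r ∧ ver (zVec 1 : HeisLie n) - halfForm (hor (zVec 1)) ∈ intReal
    rw [hor_zVec, ver_zVec, halfForm_zero, sub_zero]
    exact ⟨zero_mem _, by exact_mod_cast intCast_mem_intReal 1⟩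

theorem zVec_mem_heisLattice (r : Fin n → ℕ) {s : ℝ} (hs : s ∈ intReal) :
    (⟨zVec s⟩ : Heis n) ∈ heisLattice r := by
  let S : AddSubgroup ℝ :=
    { carrier := {s | (⟨zVec s⟩ : Heis n) ∈ heisLattice r}
      add_mem' := fun {a b} ha hb => by
        have := (heisLattice r).mul_mem ha hb
        rwa [zVec_mul] at this
      zero_mem' := by
        have : (⟨zVec 0⟩ : Heis n) = 1 := by apply heis_ext <;> simp
        rw [Set.mem_ofPred_eq, this]
        exact one_mem _
      neg_mem' := fun {a} ha => by
        have h := (heisLattice r).inv_mem ha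
        have : (⟨zVec a⟩ : Heis n)⁻¹ = ⟨zVec (-a)⟩ := by apply heis_ext <;> simp
        rwa [this] at h }
  have h1 : (1 : ℝ) ∈ S := Subgroup.subset_closure (Or.inr rfl)
  exact (AddSubgroup.zmultiples_le_of_mem h1) hs

theorem exists_mem_heisLattice {r : Fin n → ℕ} {v : HIdx n → ℝ} (hv : v ∈ horLattice r) :
    ∃ p ∈ heisLattice r, hor p.log = v := by
  let S : AddSubgroup (HIdx n → ℝ) :=
    { carrier := {v | ∃ p ∈ heisLattice r, hor p.log = v}
      add_mem' := by
        rintro _ _ ⟨p, hp, rfl⟩ ⟨q, hq, rfl⟩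
        exact ⟨p * q, mul_mem hp hq, hor_mul p q⟩
      zero_mem' := ⟨1, one_mem _, rfl⟩
      neg_mem' := by
        rintro _ ⟨p, hp, rfl⟩
        exact ⟨p⁻¹, inv_mem hp, rfl⟩ }
  have hs : ∀ i : HIdx n, (Pi.single i (latScale r i) : HIdx n → ℝ) ∈ S := by
    intro i
    refine ⟨⟨Pi.single (Sum.inl i) (latScale r i)⟩, Subgroup.subset_closure (Or.inl ?_), ?_⟩
    · rcases i with i | i
      · exact Or.inl ⟨i, rfl⟩
      · exact Or.inr ⟨i, rfl⟩
    · funext j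
      simp [hor, Pi.single_apply]
  obtain ⟨x, rfl⟩ := mem_horLattice_iff_exists.1 hv
  have : (fun i => latScale r i * x i) = ∑ i, x i • (Pi.single i (latScale r i) : HIdx n → ℝ) := by
    funext j
    rw [Finset.sum_apply, Finset.sum_eq_single j]
    · simp [mul_comm]
    · intro b _ hb; simp [Pi.single_eq_of_ne hb.symm]
    · simp
  rw [this]
  exact S.sum_mem fun i _ => S.zsmul_mem (hs i) _

/-- Two elements of the explicit lattice with equal horizontal part differ by an integral multiple
of Z, which lies in the generated lattice. -/
theorem heisLattice_eq (r : Fin n → ℕ) : heisLattice r = explicitLattice r := by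
  refine le_antisymm (heisLattice_le r) fun p hp => ?_
  obtain ⟨q, hq, hqp⟩ := exists_mem_heisLattice hp.1
  have h1 := (heisLattice_le r hq).2
  have h2 : ver p.log - ver q.log ∈ intReal := by
    have := sub_mem hp.2 h1
    rw [hqp] at this
    simpa using this
  have : p = q * ⟨zVec (ver p.log - ver q.log)⟩ := by
    apply heis_ext <;> simp [hqp]
  rw [this]
  exact mul_mem hq (zVec_mem_heisLattice r h2)

theorem mem_heisLattice {r : Fin n → ℕ} {p : Heis n} : p ∈ heisLattice r ↔
    hor p.log ∈ horLattice r ∧ ver p.log - halfForm (hor p.log) ∈ intReal := by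
  rw [heisLattice_eq]; rfl

theorem mem_projLattice {r : Fin n → ℕ} {v : HIdx n → ℝ} :
    v ∈ projLattice r ↔ v ∈ horLattice r := by
  constructor
  · rintro ⟨p, hp, rfl⟩
    exact (mem_heisLattice.1 hp).1
  · intro hv
    obtain ⟨p, hp, rfl⟩ := exists_mem_heisLattice hv
    exact ⟨p, hp, rfl⟩

theorem exists_intReal_add_mem_Ico (x : ℝ) : ∃ k ∈ intReal, x + k ∈ Set.Ico (0 : ℝ) 1 := by
  refine ⟨-⌊x⌋, neg_mem (intCast_mem_intReal _), ?_⟩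
  rw [← sub_eq_add_neg]
  exact ⟨Int.fract_nonneg x, Int.fract_lt_one x⟩

/-- Lattice translates of any point fill a bounded region. -/
theorem exists_bound_heisLattice {r : Fin n → ℕ} (hr : ∀ i, 0 < r i) :
    ∃ R : ℝ, ∀ p : Heis n, ∃ g ∈ heisLattice r, ‖(g * p).log‖ ≤ R := by
  refine ⟨1 + ‖latScale r‖, fun p => ?_⟩
  have h1 : ∀ i, ∃ k ∈ AddSubgroup.zmultiples (latScale r i),
      ‖hor p.log i + k‖ ≤ latScale r i := by
    intro i
    have hpos := latScale_pos hr i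
    obtain ⟨k, hk, hk'⟩ := exists_intReal_add_mem_Ico (hor p.log i / latScale r i)
    obtain ⟨k, rfl⟩ := mem_intReal_iff.1 hk
    refine ⟨latScale r i * k, ⟨k, by simp [mul_comm]⟩, ?_⟩
    have : hor p.log i + latScale r i * k
        = latScale r i * (hor p.log i / latScale r i + k) := by
      field_simp
    rw [this, Real.norm_eq_abs, abs_mul, abs_of_pos hpos, abs_of_nonneg hk'.1]
    exact mul_le_of_le_one_right hpos.le hk'.2.le
  choose v hv hv' using h1
  obtain ⟨g, hg, hgv⟩ := exists_mem_heisLattice (r := r) (v := v) hv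
  obtain ⟨k, hk, hk'⟩ := exists_intReal_add_mem_Ico (ver (g * p).log)
  refine ⟨⟨zVec k⟩ * g, mul_mem (zVec_mem_heisLattice r hk) hg, ?_⟩
  apply lie_norm_le
  · refine (pi_norm_le_iff_of_nonneg (by positivity)).2 fun i => ?_
    simp only [hor_mul, hor_zVec, zero_add, hgv, Pi.add_apply]
    rw [add_comm]
    refine (hv' i).trans ((le_abs_self _).trans ((norm_le_pi_norm (latScale r) i).trans ?_))
    linarith
  · rw [mul_assoc, ver_mul]
    simp only [ver_zVec, hor_zVec, symp_zero_left, mul_zero, add_zero]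
    rw [add_comm, abs_of_nonneg hk'.1]
    linarith [hk'.2, norm_nonneg (latScale r)]

theorem continuous_hor : Continuous (hor : HeisLie n → HIdx n → ℝ) := by
  unfold hor; fun_prop

theorem continuous_ver : Continuous (ver : HeisLie n → ℝ) := by
  unfold ver; fun_prop

theorem continuous_symp : Continuous fun x : (HIdx n → ℝ) × (HIdx n → ℝ) => symp x.1 x.2 := by
  unfold symp; fun_prop

theorem isClosed_heisLattice (r : Fin n → ℕ) :
    IsClosed {u : HeisLie n | (⟨u⟩ : Heis n) ∈ heisLattice r} := by
  have hz : ∀ a : ℝ, IsClosed (AddSubgroup.zmultiples a : Set ℝ) :=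
    fun a => AddSubgroup.isClosed_of_discrete
  have : {u : HeisLie n | (⟨u⟩ : Heis n) ∈ heisLattice r}
      = (⋂ i, (fun u : HeisLie n => hor u i) ⁻¹' (AddSubgroup.zmultiples (latScale r i) : Set ℝ))
        ∩ (fun u : HeisLie n => ver u - halfForm (hor u)) ⁻¹' (intReal : Set ℝ) := by
    ext u
    simp only [Set.mem_ofPred_eq, mem_heisLattice, mem_horLattice]
    simp
  rw [this]
  refine IsClosed.inter (isClosed_iInter fun i => (hz _).preimage ?_) ((hz _).preimage ?_)
  · unfold hor; fun_prop
  · unfold hor ver halfForm; fun_prop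

theorem continuous_mul_log {X : Type*} [TopologicalSpace X] {f g : X → HeisLie n}
    (hf : Continuous f) (hg : Continuous g) :
    Continuous fun x => ((⟨f x⟩ : Heis n) * ⟨g x⟩).log := by
  refine continuous_pi fun i => ?_
  rcases i with i | i
  · have : (fun x => ((⟨f x⟩ : Heis n) * ⟨g x⟩).log (Sum.inl i))
        = fun x => f x (Sum.inl i) + g x (Sum.inl i) :=
      funext fun x => congrFun (hor_mul (⟨f x⟩ : Heis n) ⟨g x⟩) i
    rw [this]
    fun_prop
  · have : (fun x => ((⟨f x⟩ : Heis n) * ⟨g x⟩).log (Sum.inr i))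
        = fun x => ver (f x) + ver (g x) + 1 / 2 * symp (hor (f x)) (hor (g x)) :=
      funext fun x => ver_mul (⟨f x⟩ : Heis n) ⟨g x⟩
    rw [this]
    exact ((continuous_ver.comp hf).add (continuous_ver.comp hg)).add (continuous_const.mul
      (continuous_symp.comp ((continuous_hor.comp hf).prodMk (continuous_hor.comp hg))))

/-- Distinct points of the quotient have separated lifts. -/
theorem exists_separation (r : Fin n → ℕ) (p q : Heis n) (h : p * q⁻¹ ∉ heisLattice r) :
    ∃ δ > 0, ∀ g ∈ heisLattice r, δ ≤ ‖(p⁻¹ * (g * q)).log‖ := by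
  -- The u with p·exp(u)·q⁻¹ in the lattice form a closed set that omits 0.
  have hcont : Continuous fun u : HeisLie n => (p * ⟨u⟩ * q⁻¹).log :=
    continuous_mul_log (continuous_mul_log continuous_const continuous_id) continuous_const
  have hclosed := (isClosed_heisLattice r).preimage hcont
  have h0 : (0 : HeisLie n) ∈ ((fun u : HeisLie n => (p * ⟨u⟩ * q⁻¹).log) ⁻¹'
      {u : HeisLie n | (⟨u⟩ : Heis n) ∈ heisLattice r})ᶜ := by
    have : p * (⟨0⟩ : Heis n) = p := mul_one p
    simpa [this] using h
  obtain ⟨δ, hδ, hball⟩ := Metric.isOpen_iff.1 hclosed.isOpen_compl 0 h0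
  refine ⟨δ, hδ, fun g hg => ?_⟩
  by_contra hlt
  push Not at hlt
  have hmem := hball (show (p⁻¹ * (g * q)).log ∈ Metric.ball 0 δ by simpa using hlt)
  apply hmem
  change p * (p⁻¹ * (g * q)) * q⁻¹ ∈ heisLattice r
  have : p * (p⁻¹ * (g * q)) * q⁻¹ = g := by group
  rwa [this]

end Lattice

/-! ### Absolutely continuous curves -/

section AbsCont

open MeasureTheory Set AbsolutelyContinuousOnInterval

/-- A monotone or antitone map keeps non-overlapping intervals non-overlapping, and the Lipschitz
bound controls their total length. Needed to reverse and to concatenate paths. -/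
theorem AbsolutelyContinuousOnInterval.comp_monotone_or_antitone {X : Type*} [PseudoMetricSpace X]
    {f : ℝ → X} {φ : ℝ → ℝ} {a b c d : ℝ} {K : NNReal} (hf : AbsolutelyContinuousOnInterval f c d)
    (hφ : Monotone φ ∨ Antitone φ) (hK : LipschitzWith K φ)
    (hmaps : ∀ t ∈ uIcc a b, φ t ∈ uIcc c d) :
    AbsolutelyContinuousOnInterval (fun t => f (φ t)) a b := by
  rw [absolutelyContinuousOnInterval_iff] at hf ⊢
  intro ε hε
  obtain ⟨δ, hδ, h⟩ := hf ε hε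
  -- Dividing by K + 1 avoids the case K = 0.
  refine ⟨δ / (K + 1), by positivity, fun E hE hlen => ?_⟩
  refine h (E.1, fun i => (φ (E.2 i).1, φ (E.2 i).2)) ⟨?_, ?_⟩ ?_
  · exact fun i hi => ⟨hmaps _ (hE.1 i hi).1, hmaps _ (hE.1 i hi).2⟩
  · intro i hi j hj hij
    have hd := hE.2 hi hj hij
    simp only [Function.onFun, Set.disjoint_left, uIoc, mem_Ioc] at hd ⊢
    intro x hx hx'
    -- Disjoint half-open intervals are ordered, unless one of them is degenerate.
    have key : ∀ s t u v : ℝ, (∀ y, min s t < y ∧ y ≤ max s t → ¬(min u v < y ∧ y ≤ max u v)) →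
        max s t ≤ min u v ∨ max u v ≤ min s t ∨ s = t ∨ u = v := by
      intro s t u v H
      by_contra hne
      push Not at hne
      obtain ⟨h1, h2, h3, h4⟩ := hne
      have h5 : min s t < max s t := min_lt_max.2 h3
      have h6 : min u v < max u v := min_lt_max.2 h4
      exact H (min (max s t) (max u v)) ⟨lt_min h5 h2, min_le_left _ _⟩
        ⟨lt_min h1 h6, min_le_right _ _⟩
    rcases hφ with hφ | hφ
    · rw [← hφ.map_min, ← hφ.map_max] at hx hx'
      rcases key _ _ _ _ hd with h1 | h1 | h1 | h1
      · exact absurd (hx.2.trans (hφ h1)) (not_le.2 hx'.1)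
      · exact absurd (hx'.2.trans (hφ h1)) (not_le.2 hx.1)
      · rw [h1] at hx; simp only [min_self, max_self] at hx; exact absurd hx.2 (not_le.2 hx.1)
      · rw [h1] at hx'; simp only [min_self, max_self] at hx'; exact absurd hx'.2 (not_le.2 hx'.1)
    · rw [← hφ.map_min, ← hφ.map_max] at hx hx'
      rcases key _ _ _ _ hd with h1 | h1 | h1 | h1
      · exact absurd (hx'.2.trans (hφ h1)) (not_le.2 hx.1)
      · exact absurd (hx.2.trans (hφ h1)) (not_le.2 hx'.1)
      · rw [h1] at hx; simp only [min_self, max_self] at hx; exact absurd hx.2 (not_le.2 hx.1)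
      · rw [h1] at hx'; simp only [min_self, max_self] at hx'; exact absurd hx'.2 (not_le.2 hx'.1)
  · calc ∑ i ∈ Finset.range E.1, dist (φ (E.2 i).1) (φ (E.2 i).2)
        ≤ ∑ i ∈ Finset.range E.1, (K + 1) * dist (E.2 i).1 (E.2 i).2 := by
          refine Finset.sum_le_sum fun i _ => (hK.dist_le_mul _ _).trans ?_
          gcongr; linarith
      _ = (K + 1) * ∑ i ∈ Finset.range E.1, dist (E.2 i).1 (E.2 i).2 := by rw [Finset.mul_sum]
      _ < (K + 1) * (δ / (K + 1)) := by gcongr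
      _ = δ := by field_simp

theorem LipschitzWith.comp_absolutelyContinuousOnInterval {X Y : Type*} [PseudoMetricSpace X]
    [PseudoMetricSpace Y] {F : X → Y} {K : NNReal} (hF : LipschitzWith K F) {f : ℝ → X} {a b : ℝ}
    (hf : AbsolutelyContinuousOnInterval f a b) :
    AbsolutelyContinuousOnInterval (fun t => F (f t)) a b := by
  have h : Filter.Tendsto (fun E : ℕ × (ℕ → ℝ × ℝ) => (K : ℝ) *
      ∑ i ∈ Finset.range E.1, dist (f (E.2 i).1) (f (E.2 i).2))
      (totalLengthFilter ⊓ Filter.principal (disjWithin a b)) (nhds ((K : ℝ) * 0)) :=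
    Filter.Tendsto.const_mul _ hf
  rw [mul_zero] at h
  refine squeeze_zero (fun E => Finset.sum_nonneg fun _ _ => dist_nonneg) (fun E => ?_) h
  rw [Finset.mul_sum]
  exact Finset.sum_le_sum fun i _ => hF.dist_le_mul _ _

variable {ι : Type*} [Fintype ι]

theorem AbsolutelyContinuousOnInterval.apply {c : ℝ → ι → ℝ} {a b : ℝ}
    (hc : AbsolutelyContinuousOnInterval c a b) (i : ι) :
    AbsolutelyContinuousOnInterval (fun t => c t i) a b :=
  LipschitzWith.comp_absolutelyContinuousOnInterval (F := fun v : ι → ℝ => v i) (K := 1)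
    (LipschitzWith.eval (α := fun _ : ι => ℝ) i) hc

theorem absolutelyContinuousOnInterval_pi {c : ℝ → ι → ℝ} {a b : ℝ}
    (hc : ∀ i, AbsolutelyContinuousOnInterval (fun t => c t i) a b) :
    AbsolutelyContinuousOnInterval c a b := by
  have h : Filter.Tendsto (fun E : ℕ × (ℕ → ℝ × ℝ) =>
      ∑ j, ∑ i ∈ Finset.range E.1, dist (c (E.2 i).1 j) (c (E.2 i).2 j))
      (totalLengthFilter ⊓ Filter.principal (disjWithin a b)) (nhds (∑ _j : ι, (0 : ℝ))) :=
    tendsto_finsetSum _ fun j _ => hc j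
  rw [Finset.sum_const_zero] at h
  refine squeeze_zero (fun E => Finset.sum_nonneg fun _ _ => dist_nonneg) (fun E => ?_) h
  rw [Finset.sum_comm]
  refine Finset.sum_le_sum fun i _ => ?_
  refine (dist_pi_le_iff (Finset.sum_nonneg fun _ _ => dist_nonneg)).2 fun j => ?_
  exact Finset.single_le_sum (f := fun j => dist (c (E.2 i).1 j) (c (E.2 i).2 j))
    (fun _ _ => dist_nonneg) (Finset.mem_univ j)

theorem AbsolutelyContinuousOnInterval.ae_differentiableAt_pi {c : ℝ → ι → ℝ} {a b : ℝ}
    (hc : AbsolutelyContinuousOnInterval c a b) :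
    ∀ᵐ t, t ∈ uIcc a b → DifferentiableAt ℝ c t := by
  have : ∀ᵐ t, ∀ i, t ∈ uIcc a b → DifferentiableAt ℝ (fun t => c t i) t :=
    ae_all_iff.2 fun i => (hc.apply i).ae_differentiableAt
  filter_upwards [this] with t ht hmem
  exact differentiableAt_pi.2 fun i => ht i hmem

theorem AbsolutelyContinuousOnInterval.ae_deriv_apply {c : ℝ → ι → ℝ} {a b : ℝ}
    (hc : AbsolutelyContinuousOnInterval c a b) :
    ∀ᵐ t, t ∈ uIcc a b → ∀ i, deriv (fun t => c t i) t = deriv c t i := by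
  filter_upwards [hc.ae_differentiableAt_pi] with t ht hmem i
  exact (hasDerivAt_pi.1 (ht hmem).hasDerivAt i).deriv

theorem AbsolutelyContinuousOnInterval.intervalIntegrable_deriv_apply {c : ℝ → ι → ℝ} {a b : ℝ}
    (hc : AbsolutelyContinuousOnInterval c a b) (i : ι) :
    IntervalIntegrable (fun t => deriv c t i) volume a b := by
  refine (hc.apply i).intervalIntegrable_deriv.congr_ae ?_
  refine (ae_restrict_iff' measurableSet_uIoc).2 ?_
  filter_upwards [hc.ae_deriv_apply] with t ht hmem
  exact ht (uIoc_subset_uIcc hmem) i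

theorem AbsolutelyContinuousOnInterval.eq_add_integral_deriv {c : ℝ → ι → ℝ} {a b t : ℝ}
    (hc : AbsolutelyContinuousOnInterval c a b) (ht : t ∈ uIcc a b) (i : ι) :
    c t i = c a i + ∫ s in a..t, deriv c s i := by
  have hc' := hc.mono (uIcc_subset_uIcc_left ht)
  have h := (hc'.apply i).integral_deriv_eq_sub
  rw [show (∫ s in a..t, deriv c s i) = ∫ s in a..t, deriv (fun t => c t i) s from
    intervalIntegral.integral_congr_ae ?_, h]
  · ring
  · filter_upwards [hc'.ae_deriv_apply] with s hs hmem
    exact (hs (uIoc_subset_uIcc hmem) i).symm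

/-- The curve with given starting point and velocity. -/
noncomputable def primitiveCurve {ι : Type*} (p : ι → ℝ) (V : ℝ → ι → ℝ) (t : ℝ) : ι → ℝ :=
  fun i => p i + ∫ s in (0 : ℝ)..t, V s i

theorem primitiveCurve_zero {ι : Type*} (p : ι → ℝ) (V : ℝ → ι → ℝ) : primitiveCurve p V 0 = p := by
  funext i; simp [primitiveCurve]

theorem absolutelyContinuousOnInterval_primitiveCurve {V : ℝ → ι → ℝ}
    (hV : ∀ i, IntervalIntegrable (fun t => V t i) volume 0 1) (p : ι → ℝ) :
    AbsolutelyContinuousOnInterval (primitiveCurve p V) 0 1 := by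
  refine absolutelyContinuousOnInterval_pi fun i => ?_
  have h1 : AbsolutelyContinuousOnInterval (fun _ : ℝ => p i) 0 1 :=
    (LipschitzWith.const (p i)).lipschitzOnWith.absolutelyContinuousOnInterval
  exact h1.add ((hV i).absolutelyContinuousOnInterval_intervalIntegral (by simp))

theorem ae_deriv_primitiveCurve {V : ℝ → ι → ℝ}
    (hV : ∀ i, IntervalIntegrable (fun t => V t i) volume 0 1) (p : ι → ℝ) :
    ∀ᵐ t ∂(volume.restrict (Icc (0 : ℝ) 1)), deriv (primitiveCurve p V) t = V t := by
  refine (ae_restrict_iff' measurableSet_Icc).2 ?_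
  have : ∀ᵐ t, ∀ i, t ∈ uIcc (0 : ℝ) 1 → ∀ c ∈ uIcc (0 : ℝ) 1,
      HasDerivAt (fun x => ∫ s in c..x, V s i) (V t i) t :=
    ae_all_iff.2 fun i => (hV i).ae_hasDerivAt_integral
  filter_upwards [this] with t ht hmem
  rw [← uIcc_of_le zero_le_one] at hmem
  refine (hasDerivAt_pi.2 fun i => ?_).deriv
  exact (ht i hmem 0 (by simp)).const_add (p i)

end AbsCont

/-! ### Controls -/

section Controls

open MeasureTheory Set

variable {n : ℕ}

/-- All coordinates of a curve are integrable on `[0, 1]`. -/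
def CoordIntegrable {ι : Type*} (V : ℝ → ι → ℝ) : Prop :=
  ∀ i, IntervalIntegrable (fun t => V t i) volume 0 1

theorem CoordIntegrable.mulVec {ι κ : Type*} [Fintype ι] {V : ℝ → ι → ℝ} (hV : CoordIntegrable V)
    (A : Matrix κ ι ℝ) : CoordIntegrable fun t => A *ᵥ V t := by
  intro i
  simp only [Matrix.mulVec, dotProduct]
  have := IntervalIntegrable.sum Finset.univ (f := fun j t => A i j * V t j) (μ := volume)
    (a := 0) (b := 1) fun j _ => (hV j).const_mul (A i j)
  rw [show (fun t => ∑ j, A i j * V t j) = ∑ j, fun t => A i j * V t j by funext t; simp]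
  exact this

theorem CoordIntegrable.symp {V : ℝ → HIdx n → ℝ} (hV : CoordIntegrable V) {c : ℝ → HIdx n → ℝ}
    (hc : ContinuousOn c (Icc 0 1)) :
    IntervalIntegrable (fun t => symp (c t) (V t)) volume 0 1 := by
  rw [← uIcc_of_le zero_le_one] at hc
  have hc' : ∀ i, ContinuousOn (fun t => c t i) (uIcc 0 1) := fun i => continuousOn_pi.1 hc i
  have := IntervalIntegrable.sum Finset.univ (f := fun (i : Fin n) t =>
      c t (Sum.inl i) * V t (Sum.inr i) - c t (Sum.inr i) * V t (Sum.inl i)) (μ := volume)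
    (a := 0) (b := 1) fun j _ => ((hV _).continuousOn_mul (hc' _)).sub
      ((hV _).continuousOn_mul (hc' _))
  rw [show (fun t => _root_.symp (c t) (V t)) = ∑ i : Fin n, fun t =>
      c t (Sum.inl i) * V t (Sum.inr i) - c t (Sum.inr i) * V t (Sum.inl i) by
    funext t; simp [_root_.symp]]
  exact this

theorem CoordIntegrable.hor {V : ℝ → HeisLie n} (hV : CoordIntegrable V) :
    CoordIntegrable fun t => hor (V t) := fun i => hV (Sum.inl i)

theorem CoordIntegrable.leftDiff {V : ℝ → HeisLie n} (hV : CoordIntegrable V) {c : ℝ → HeisLie n}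
    (hc : ContinuousOn (fun t => _root_.hor (c t)) (Icc 0 1)) :
    CoordIntegrable fun t => leftDiff (c t) (V t) := by
  intro i
  rcases i with i | i
  · have : (fun t => _root_.leftDiff (c t) (V t) (Sum.inl i)) = fun t => V t (Sum.inl i) :=
      funext fun t => congrFun (hor_leftDiff (c t) (V t)) i
    rw [this]; exact hV _
  · have : (fun t => _root_.leftDiff (c t) (V t) (Sum.inr i))
        = fun t => V t (Sum.inr i) + 1 / 2 * _root_.symp (_root_.hor (c t)) (_root_.hor (V t)) :=
      funext fun t => ver_leftDiff (c t) (V t)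
    rw [this]; exact (hV _).add ((hV.hor.symp hc).const_mul _)

/-- `c` is the trajectory of the control `U` for the left-invariant structure given by `A`. -/
structure IsControl (A : Matrix (Idx n) (Idx n) ℝ) (U c : ℝ → HeisLie n) : Prop where
  integrable : CoordIntegrable U
  continuousOn : ContinuousOn c (Icc 0 1)
  eq : ∀ t ∈ Icc (0 : ℝ) 1, ∀ i,
    c t i = c 0 i + ∫ s in (0 : ℝ)..t, leftDiff (c s) (A *ᵥ U s) i

/-- The linear section of shortest preimages, applied to the velocity translated back to the
identity, is a control of pointwise minimal length. Being linear, it inherits integrability from the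
derivative, and the length of the path becomes the L¹ norm of the control. -/
theorem IsAdmissible.exists_isControl {A : Matrix (Idx n) (Idx n) ℝ} (hA : A ∈ frames n)
    {c : ℝ → HeisLie n} (hc : IsAdmissible A c) :
    ∃ U, IsControl A U c ∧
      pathLength A c = ∫⁻ t in Icc (0 : ℝ) 1, ENNReal.ofReal (eLen (U t)) := by
  obtain ⟨N, hN⟩ := exists_minimal_section hA
  have hcont : ContinuousOn c (Icc 0 1) := by
    simpa using hc.absCont.continuousOn
  have hhor : ContinuousOn (fun t => hor (-c t)) (Icc 0 1) :=
    continuous_hor.comp_continuousOn hcont.neg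
  have key : ∀ᵐ t ∂(volume.restrict (Icc (0 : ℝ) 1)),
      deriv c t = leftDiff (c t) (A *ᵥ (N *ᵥ leftDiff (-c t) (deriv c t))) ∧
      subNorm A (c t) (deriv c t) = eLen (N *ᵥ leftDiff (-c t) (deriv c t)) := by
    filter_upwards [hc.tangent] with t ht
    obtain ⟨V, hV⟩ := ht
    obtain ⟨h1, h2⟩ := hN V (c t)
    have h3 : leftDiff (-c t) (deriv c t) = A *ᵥ V := by rw [← hV, leftDiff_neg_leftDiff]
    rw [h3, h1, ← h2, hV]
    exact ⟨rfl, rfl⟩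
  refine ⟨fun t => N *ᵥ leftDiff (-c t) (deriv c t), ⟨?_, hcont, fun t ht i => ?_⟩, ?_⟩
  · exact CoordIntegrable.mulVec (CoordIntegrable.leftDiff
      (fun i => hc.absCont.intervalIntegrable_deriv_apply i) hhor) N
  · rw [hc.absCont.eq_add_integral_deriv (by rwa [uIcc_of_le zero_le_one]) i]
    congr 1
    refine intervalIntegral.integral_congr_ae ?_
    filter_upwards [(ae_restrict_iff' measurableSet_Icc).1 key] with s hs hmem
    rw [uIoc_of_le ht.1] at hmem
    exact congrFun (hs ⟨hmem.1.le, hmem.2.trans ht.2⟩).1 i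
  · refine lintegral_congr_ae ?_
    filter_upwards [key] with t ht
    rw [ht.2]

/-- The vertical coordinate never enters the velocity, so the equation is solved by two successive
integrations. The length bound is only an inequality because the control need not be minimal. -/
theorem exists_trajectory (A : Matrix (Idx n) (Idx n) ℝ) {U : ℝ → HeisLie n}
    (hU : CoordIntegrable U) (p : HeisLie n) :
    ∃ c, c 0 = p ∧ IsAdmissible A c ∧ IsControl A U c ∧
      pathLength A c ≤ ∫⁻ t in Icc (0 : ℝ) 1, ENNReal.ofReal (eLen (U t)) := by
  have hAU := hU.mulVec A
  -- Only the horizontal part of this curve is correct, but that is all `leftDiff` sees.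
  let h : ℝ → HeisLie n := primitiveCurve p fun s => A *ᵥ U s
  have hh : ContinuousOn (fun t => hor (h t)) (Icc 0 1) := by
    have := (absolutelyContinuousOnInterval_primitiveCurve hAU p).continuousOn
    rw [uIcc_of_le zero_le_one] at this
    exact continuous_hor.comp_continuousOn this
  have hV : CoordIntegrable fun t => leftDiff (h t) (A *ᵥ U t) := hAU.leftDiff hh
  let c : ℝ → HeisLie n := primitiveCurve p fun t => leftDiff (h t) (A *ᵥ U t)
  have hhor : ∀ t, hor (c t) = hor (h t) := by
    intro t
    funext i
    change p (Sum.inl i) + _ = p (Sum.inl i) + _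
    congr 1
    refine intervalIntegral.integral_congr fun s _ => ?_
    exact congrFun (hor_leftDiff (h s) (A *ᵥ U s)) i
  have hld : ∀ t w, leftDiff (h t) w = leftDiff (c t) w := by
    intro t w
    apply lie_ext <;> simp [hhor]
  have hac : AbsolutelyContinuousOnInterval c 0 1 :=
    absolutelyContinuousOnInterval_primitiveCurve hV p
  have hderiv : ∀ᵐ t ∂(volume.restrict (Icc (0 : ℝ) 1)),
      deriv c t = leftDiff (c t) (A *ᵥ U t) := by
    filter_upwards [ae_deriv_primitiveCurve hV p] with t ht
    rw [← hld]; exact ht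
  refine ⟨c, primitiveCurve_zero p _, ⟨hac, ?_⟩, ⟨hU, ?_, fun t _ i => ?_⟩, ?_⟩
  · filter_upwards [hderiv] with t ht
    exact ⟨U t, ht.symm⟩
  · simpa using hac.continuousOn
  · rw [show c 0 = p from primitiveCurve_zero p _]
    change p i + _ = p i + _
    congr 1
    refine intervalIntegral.integral_congr fun s _ => ?_
    exact congrFun (hld s _) i
  · refine lintegral_mono_ae ?_
    filter_upwards [hderiv] with t ht
    rw [ht]
    exact ENNReal.ofReal_le_ofReal (subNorm_leftDiff_le A (c t) (U t))

end Controls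

/-! ### The distance on the group -/

section HeisDist

open MeasureTheory Set

variable {n : ℕ}

theorem subNorm_smul_le {A : Matrix (Idx n) (Idx n) ℝ} {p v : HeisLie n}
    (hv : v ∈ distribution A p) (s : ℝ) : subNorm A p (s • v) ≤ |s| * subNorm A p v := by
  rcases eq_or_ne s 0 with rfl | hs
  · rw [zero_smul, abs_zero, zero_mul]
    have h0 : leftDiff p (A *ᵥ 0) = 0 := by apply lie_ext <;> simp
    have := subNorm_leftDiff_le A p 0
    rwa [h0, eLen_zero] at this
  · rw [← div_le_iff₀' (abs_pos.2 hs)]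
    obtain ⟨U, hU⟩ := hv
    refine le_csInf ⟨_, U, hU, rfl⟩ ?_
    rintro _ ⟨V, hV, rfl⟩
    rw [div_le_iff₀' (abs_pos.2 hs)]
    refine csInf_le ⟨0, by rintro _ ⟨V, -, rfl⟩; exact Real.sqrt_nonneg _⟩ ⟨s • V, ?_, ?_⟩
    · rw [← hV, Matrix.mulVec_smul]
      apply lie_ext <;> simp; ring
    · exact (eLen_smul s V).symm

theorem smul_mem_distribution {A : Matrix (Idx n) (Idx n) ℝ} {p v : HeisLie n}
    (hv : v ∈ distribution A p) (s : ℝ) : s • v ∈ distribution A p := by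
  obtain ⟨U, rfl⟩ := hv
  refine ⟨s • U, ?_⟩
  rw [Matrix.mulVec_smul]
  apply lie_ext <;> simp; ring

/-- Affine maps which respect the distributions and the norms do not increase distances. -/
theorem heisDist_affine_le {A B : Matrix (Idx n) (Idx n) ℝ} (L : HeisLie n →ₗ[ℝ] HeisLie n)
    (b : HeisLie n)
    (h : ∀ p U, L (leftDiff p (A *ᵥ U)) ∈ distribution B (L p + b) ∧
      subNorm B (L p + b) (L (leftDiff p (A *ᵥ U))) ≤ subNorm A p (leftDiff p (A *ᵥ U)))
    (p q : Heis n) : heisDist B ⟨L p.log + b⟩ ⟨L q.log + b⟩ ≤ heisDist A p q := by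
  refine le_iInf₂ fun c hc => ?_
  obtain ⟨hadm, hc0, hc1⟩ := hc
  let L' : HeisLie n →L[ℝ] HeisLie n := LinearMap.toContinuousLinearMap L
  have hL : ∀ u, L' u = L u := fun u => rfl
  have hlip : LipschitzWith ‖L'‖₊ fun u => L u + b := by
    have := L'.lipschitz.add (LipschitzWith.const b)
    rwa [add_zero] at this
  have hac : AbsolutelyContinuousOnInterval (fun t => L (c t) + b) 0 1 :=
    hlip.comp_absolutelyContinuousOnInterval hadm.absCont
  have hderiv : ∀ᵐ t ∂(volume.restrict (Icc (0 : ℝ) 1)),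
      deriv (fun t => L (c t) + b) t = L (deriv c t) := by
    refine (ae_restrict_iff' measurableSet_Icc).2 ?_
    filter_upwards [hadm.absCont.ae_differentiableAt_pi] with t ht hmem
    rw [uIcc_of_le zero_le_one] at ht
    exact ((L'.hasFDerivAt.comp_hasDerivAt t (ht hmem).hasDerivAt).add_const b).deriv
  refine iInf₂_le_of_le (fun t => L (c t) + b) ⟨⟨hac, ?_⟩, by simp [hc0], by simp [hc1]⟩ ?_
  · filter_upwards [hderiv, hadm.tangent] with t ht ht'
    obtain ⟨U, hU⟩ := ht'
    rw [ht, ← hU]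
    exact (h (c t) U).1
  · refine lintegral_mono_ae ?_
    filter_upwards [hderiv, hadm.tangent] with t ht ht'
    obtain ⟨U, hU⟩ := ht'
    rw [ht, ← hU]
    exact ENNReal.ofReal_le_ofReal (h (c t) U).2

/-- The map carries the frame of A at p to the frame of B at the image point with unchanged
coordinates, so lengths do not grow. -/
theorem heisDist_affine_le_of_eq {A B : Matrix (Idx n) (Idx n) ℝ}
    (L : HeisLie n →ₗ[ℝ] HeisLie n) (b : HeisLie n)
    (h : ∀ p U, L (leftDiff p (A *ᵥ U)) = leftDiff (L p + b) (B *ᵥ U)) (p q : Heis n) :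
    heisDist B ⟨L p.log + b⟩ ⟨L q.log + b⟩ ≤ heisDist A p q := by
  refine heisDist_affine_le L b (fun p U => ⟨⟨U, (h p U).symm⟩, ?_⟩) p q
  refine le_csInf ⟨_, U, rfl, rfl⟩ ?_
  rintro _ ⟨V, hV, rfl⟩
  refine csInf_le ⟨0, by rintro _ ⟨V, -, rfl⟩; exact Real.sqrt_nonneg _⟩ ⟨V, ?_, rfl⟩
  rw [← hV, h]

/-- The distance depends on `A * Aᵀ` only. -/
theorem heisDist_congr {A B : Matrix (Idx n) (Idx n) ℝ} (h : A * Aᵀ = B * Bᵀ) :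
    heisDist A = heisDist B := by
  have key : ∀ {A B : Matrix (Idx n) (Idx n) ℝ}, A * Aᵀ = B * Bᵀ →
      ∀ p q, heisDist B p q ≤ heisDist A p q := by
    intro A B h p q
    have := heisDist_affine_le (A := A) (B := B) LinearMap.id 0 (fun p U => ?_) p q
    · simpa using this
    · obtain ⟨V, hV, hVn⟩ := subNorm_congr h p U
      simp only [LinearMap.id_apply, add_zero]
      exact ⟨⟨V, by rw [hV]⟩, hVn.le⟩
  funext p q
  exact le_antisymm (key h.symm p q) (key h p q)

/-- The left translation in exponential coordinates is affine with this linear part. -/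
noncomputable def leftDiffLinear (g : HeisLie n) : HeisLie n →ₗ[ℝ] HeisLie n where
  toFun := leftDiff g
  map_add' u v := by apply lie_ext <;> simp; ring
  map_smul' s v := by apply lie_ext <;> simp; ring

/-- Left translations are affine in exponential coordinates and preserve the frame; the inverse
translation gives the reverse inequality. -/
theorem heisDist_mul_left (A : Matrix (Idx n) (Idx n) ℝ) (g p q : Heis n) :
    heisDist A (g * p) (g * q) = heisDist A p q := by
  have key : ∀ g p q : Heis n, heisDist A (g * p) (g * q) ≤ heisDist A p q := by
    intro g p q
    have hmul : ∀ p : Heis n, g * p = ⟨leftDiffLinear g.log p.log + g.log⟩ := by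
      intro p
      apply heis_ext <;> simp [leftDiffLinear] <;> ring
    rw [hmul, hmul]
    refine heisDist_affine_le_of_eq _ _ (fun p U => ?_) p q
    apply lie_ext <;> simp [leftDiffLinear]; ring
  refine le_antisymm (key g p q) ?_
  simpa using key g⁻¹ (g * p) (g * q)

theorem heisDist_eq_one_left (A : Matrix (Idx n) (Idx n) ℝ) (p q : Heis n) :
    heisDist A p q = heisDist A 1 (p⁻¹ * q) := by
  rw [← heisDist_mul_left A p 1]; simp

/-! ### Reparametrization, reversal and concatenation of paths -/

theorem map_affine_volume {a : ℝ} (ha : a ≠ 0) (e : ℝ) :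
    Measure.map (fun t : ℝ => a * t + e) volume = ENNReal.ofReal |a⁻¹| • volume := by
  have : (fun t : ℝ => a * t + e) = (fun t => t + e) ∘ fun t => a * t := rfl
  rw [this, ← Measure.map_map (by fun_prop) (by fun_prop), Real.map_volume_mul_left ha,
    Measure.map_smul, map_add_right_eq_self]

theorem measurableEmbedding_affine {a : ℝ} (ha : a ≠ 0) (e : ℝ) :
    MeasurableEmbedding fun t : ℝ => a * t + e :=
  (measurableEmbedding_addRight e).comp (measurableEmbedding_mulLeft₀ ha)

theorem setLIntegral_comp_affine {a : ℝ} (ha : a ≠ 0) (e : ℝ) (F : ℝ → ENNReal) (S : Set ℝ) :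
    ∫⁻ t in (fun t : ℝ => a * t + e) ⁻¹' S, F (a * t + e)
      = ENNReal.ofReal |a⁻¹| * ∫⁻ s in S, F s := by
  have he := measurableEmbedding_affine ha e
  rw [← he.lintegral_map, ← he.restrict_map, map_affine_volume ha, Measure.restrict_smul,
    lintegral_smul_measure, smul_eq_mul]

theorem ae_comp_affine {a : ℝ} (ha : a ≠ 0) (e : ℝ) {P : ℝ → Prop} (h : ∀ᵐ s : ℝ, P s) :
    ∀ᵐ t : ℝ, P (a * t + e) := by
  have : Measure.QuasiMeasurePreserving (fun t : ℝ => a * t + e) volume volume := by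
    refine ⟨by fun_prop, ?_⟩
    rw [map_affine_volume ha]
    exact Measure.smul_absolutelyContinuous
  exact this.ae h

theorem deriv_comp_affine {E : Type*} [NormedAddCommGroup E] [NormedSpace ℝ E] (c : ℝ → E)
    (a e t : ℝ) : deriv (fun t => c (a * t + e)) t = a • deriv c (a * t + e) := by
  have h1 := deriv_comp_mul_left a (fun s => c (s + e)) t
  rw [h1, deriv_comp_add_const]

/-- The part of a path which is an affine reparametrization of an admissible path. -/
theorem lintegral_reparam_le {A : Matrix (Idx n) (Idx n) ℝ} {c c' : ℝ → HeisLie n}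
    (hc : IsAdmissible A c) {a : ℝ} (ha : a ≠ 0) (e : ℝ) {S : Set ℝ} (hS : IsOpen S)
    (hSm : (fun t : ℝ => a * t + e) '' S ⊆ Icc 0 1)
    (heq : ∀ t ∈ S, c' t = c (a * t + e)) :
    (∀ᵐ t ∂(volume.restrict S), deriv c' t ∈ distribution A (c' t)) ∧
    ∫⁻ t in S, ENNReal.ofReal (subNorm A (c' t) (deriv c' t)) ≤ pathLength A c := by
  -- Openness of `S` makes the equality of curves local, so it passes to derivatives.
  have hd : ∀ t ∈ S, deriv c' t = a • deriv c (a * t + e) := by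
    intro t ht
    rw [← deriv_comp_affine c a e t]
    exact Filter.EventuallyEq.deriv_eq (Filter.eventually_of_mem (hS.mem_nhds ht) heq)
  have htan : ∀ᵐ t ∂(volume.restrict S),
      deriv c (a * t + e) ∈ distribution A (c (a * t + e)) ∧ t ∈ S := by
    refine (ae_restrict_iff' hS.measurableSet).2 ?_
    filter_upwards [ae_comp_affine ha e ((ae_restrict_iff' measurableSet_Icc).1 hc.tangent)]
      with t ht hmem
    exact ⟨ht (hSm ⟨t, hmem, rfl⟩), hmem⟩
  constructor
  · filter_upwards [htan] with t ht
    rw [hd t ht.2, heq t ht.2]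
    exact smul_mem_distribution ht.1 a
  · calc ∫⁻ t in S, ENNReal.ofReal (subNorm A (c' t) (deriv c' t))
        ≤ ∫⁻ t in S, ENNReal.ofReal |a| *
            ENNReal.ofReal (subNorm A (c (a * t + e)) (deriv c (a * t + e))) := by
          refine lintegral_mono_ae ?_
          filter_upwards [htan] with t ht
          rw [hd t ht.2, heq t ht.2, ← ENNReal.ofReal_mul (abs_nonneg a)]
          exact ENNReal.ofReal_le_ofReal (subNorm_smul_le ht.1 a)
      _ ≤ ∫⁻ t in (fun t : ℝ => a * t + e) ⁻¹' Icc 0 1, ENNReal.ofReal |a| *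
            ENNReal.ofReal (subNorm A (c (a * t + e)) (deriv c (a * t + e))) :=
          lintegral_mono_set (image_subset_iff.1 hSm)
      _ = ENNReal.ofReal |a| * (ENNReal.ofReal |a⁻¹| * pathLength A c) := by
          rw [lintegral_const_mul' _ _ ENNReal.ofReal_ne_top,
            setLIntegral_comp_affine ha e (fun s => ENNReal.ofReal (subNorm A (c s) (deriv c s))) (Icc 0 1)]
          rfl
      _ = pathLength A c := by
          rw [← mul_assoc, ← ENNReal.ofReal_mul (abs_nonneg a), abs_inv,
            mul_inv_cancel₀ (abs_ne_zero.2 ha), ENNReal.ofReal_one, one_mul]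

theorem heisDist_comm (A : Matrix (Idx n) (Idx n) ℝ) (p q : Heis n) :
    heisDist A p q = heisDist A q p := by
  have key : ∀ p q, heisDist A p q ≤ heisDist A q p := by
    intro p q
    refine le_iInf₂ fun c hc => ?_
    obtain ⟨hadm, hc0, hc1⟩ := hc
    have hL := lintegral_reparam_le (c' := fun t => c (-1 * t + 1)) hadm (a := -1) (by norm_num) 1
      (S := Ioo 0 1) isOpen_Ioo (by
        rintro _ ⟨t, ht, rfl⟩
        exact ⟨by linarith [ht.2], by linarith [ht.1]⟩) (fun _ _ => rfl)
    rw [restrict_Ioo_eq_restrict_Icc] at hL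
    refine iInf₂_le_of_le (fun t => c (-1 * t + 1)) ⟨⟨?_, hL.1⟩, by simp [hc1], by simp [hc0]⟩ hL.2
    refine hadm.absCont.comp_monotone_or_antitone (K := 1) (Or.inr ?_) ?_ ?_
    · intro s t hst; dsimp only; linarith
    · refine LipschitzWith.of_dist_le_mul fun s t => ?_
      rw [Real.dist_eq, Real.dist_eq, NNReal.coe_one, one_mul, abs_sub_comm s t]
      apply le_of_eq; congr 1; ring
    · intro t ht
      rw [uIcc_of_le zero_le_one] at ht ⊢
      exact ⟨by linarith [ht.2], by linarith [ht.1]⟩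
  exact le_antisymm (key p q) (key q p)

theorem heisDist_triangle (A : Matrix (Idx n) (Idx n) ℝ) (p q s : Heis n) :
    heisDist A p s ≤ heisDist A p q + heisDist A q s := by
  refine ENNReal.le_of_forall_pos_le_add fun ε hε hfin => ?_
  have hlt : ∀ p q, heisDist A p q ≠ ⊤ → ∃ c, (IsAdmissible A c ∧ c 0 = p.log ∧ c 1 = q.log) ∧
      pathLength A c ≤ heisDist A p q + ((ε / 2 : NNReal) : ENNReal) := by
    intro p q hpq
    have h1 : heisDist A p q < heisDist A p q + ((ε / 2 : NNReal) : ENNReal) :=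
      ENNReal.lt_add_right hpq (by simpa using hε.ne')
    obtain ⟨c, hc⟩ := iInf_lt_iff.1 h1
    obtain ⟨hc', hlt⟩ := iInf_lt_iff.1 hc
    exact ⟨c, hc', hlt.le⟩
  obtain ⟨c₁, ⟨h₁, h₁0, h₁1⟩, hl₁⟩ := hlt p q (ne_top_of_le_ne_top hfin.ne le_self_add)
  obtain ⟨c₂, ⟨h₂, h₂0, h₂1⟩, hl₂⟩ := hlt q s (ne_top_of_le_ne_top hfin.ne le_add_self)
  -- The first path is run at double speed on [0, 1/2] and then stops; the second waits and then
  -- runs.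
  let φ₁ : ℝ → ℝ := fun t => min (2 * t) 1
  let φ₂ : ℝ → ℝ := fun t => max (2 * t - 1) 0
  have hlip₁ : LipschitzWith 2 φ₁ := by
    have : LipschitzWith 2 fun t : ℝ => 2 * t := by
      refine LipschitzWith.of_dist_le_mul fun s t => ?_
      rw [Real.dist_eq, Real.dist_eq, ← mul_sub, abs_mul]; simp
    exact this.min_const 1
  have hlip₂ : LipschitzWith 2 φ₂ := by
    have : LipschitzWith 2 fun t : ℝ => 2 * t - 1 := by
      refine LipschitzWith.of_dist_le_mul fun s t => ?_
      rw [Real.dist_eq, Real.dist_eq, sub_sub_sub_cancel_right, ← mul_sub, abs_mul]; simp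
    exact this.max_const 0
  have hac₁ : AbsolutelyContinuousOnInterval (fun t => c₁ (φ₁ t)) 0 1 := by
    refine h₁.absCont.comp_monotone_or_antitone (Or.inl fun s t hst => ?_) hlip₁ fun t ht => ?_
    · exact min_le_min_right 1 (by linarith)
    · rw [uIcc_of_le zero_le_one] at ht ⊢
      exact ⟨le_min (by linarith [ht.1]) zero_le_one, min_le_right _ _⟩
  have hac₂ : AbsolutelyContinuousOnInterval (fun t => c₂ (φ₂ t)) 0 1 := by
    refine h₂.absCont.comp_monotone_or_antitone (Or.inl fun s t hst => ?_) hlip₂ fun t ht => ?_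
    · exact max_le_max_right 0 (by linarith)
    · rw [uIcc_of_le zero_le_one] at ht ⊢
      exact ⟨le_max_right _ _, max_le (by linarith [ht.2]) zero_le_one⟩
  have hconst : AbsolutelyContinuousOnInterval (fun _ : ℝ => q.log) 0 1 :=
    (LipschitzWith.const q.log).lipschitzOnWith.absolutelyContinuousOnInterval
  -- At every time one summand equals `q.log`, so this is the concatenation; as a sum it is
  -- absolutely continuous without any gluing.
  let c : ℝ → HeisLie n := fun t => c₁ (φ₁ t) + c₂ (φ₂ t) - q.log
  have hac : AbsolutelyContinuousOnInterval c 0 1 := (hac₁.add hac₂).sub hconst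
  have hL₁ := lintegral_reparam_le (c' := c) h₁ (a := 2) two_ne_zero 0
    (S := Ioo 0 (1 / 2)) isOpen_Ioo (by
      rintro _ ⟨t, ht, rfl⟩
      exact ⟨by linarith [ht.1], by linarith [ht.2]⟩) (by
      intro t ht
      have e1 : φ₁ t = 2 * t + 0 := by rw [add_zero]; exact min_eq_left (by linarith [ht.2])
      have e2 : φ₂ t = 0 := max_eq_right (by linarith [ht.2])
      simp only [c, e1, e2, h₂0, add_sub_cancel_right])
  have hL₂ := lintegral_reparam_le (c' := c) h₂ (a := 2) two_ne_zero (-1)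
    (S := Ioo (1 / 2) 1) isOpen_Ioo (by
      rintro _ ⟨t, ht, rfl⟩
      exact ⟨by linarith [ht.1], by linarith [ht.2]⟩) (by
      intro t ht
      have e1 : φ₁ t = 1 := min_eq_right (by linarith [ht.1])
      have e2 : φ₂ t = 2 * t + -1 := max_eq_left (by linarith [ht.1])
      simp only [c, e1, e2, h₁1, add_sub_cancel_left])
  have hsplit : volume.restrict (Icc (0 : ℝ) 1)
      = volume.restrict (Ioo (0 : ℝ) (1 / 2)) + volume.restrict (Ioo (1 / 2 : ℝ) 1) := by
    rw [Measure.restrict_congr_set Ioo_ae_eq_Icc.symm,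
      Measure.restrict_congr_set (Ioo_ae_eq_Ioc (a := (0 : ℝ)) (b := 1 / 2)),
      Measure.restrict_congr_set (Ioo_ae_eq_Ioc (a := (1 / 2 : ℝ)) (b := 1)),
      Measure.restrict_congr_set (Ioo_ae_eq_Ioc (a := (0 : ℝ)) (b := 1)),
      ← Measure.restrict_union (by
        rw [Set.disjoint_left]; intro x hx hx'; exact absurd hx.2 (not_le.2 hx'.1))
        measurableSet_Ioc, Ioc_union_Ioc_eq_Ioc (by norm_num) (by norm_num)]
  have hadm : IsAdmissible A c := by
    refine ⟨hac, ?_⟩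
    rw [hsplit, ae_add_measure_iff]
    exact ⟨hL₁.1, hL₂.1⟩
  have hlen : pathLength A c ≤ pathLength A c₁ + pathLength A c₂ := by
    rw [pathLength, hsplit, lintegral_add_measure]
    exact add_le_add hL₁.2 hL₂.2
  have h0 : c 0 = p.log := by simp [c, φ₁, φ₂, h₁0, h₂0]
  have h1 : c 1 = s.log := by
    have e1 : φ₁ 1 = 1 := min_eq_right (by norm_num)
    have e2 : φ₂ 1 = 1 := by simp only [φ₂]; norm_num
    simp [c, e1, e2, h₁1, h₂1]
  calc heisDist A p s ≤ pathLength A c := iInf₂_le_of_le c ⟨hadm, h0, h1⟩ le_rfl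
    _ ≤ _ := hlen.trans (add_le_add hl₁ hl₂)
    _ = heisDist A p q + heisDist A q s + ε := by
      rw [add_add_add_comm, ← ENNReal.coe_add, add_halves]

/-- One-parameter subgroups tangent to the distribution. -/
theorem heisDist_one_mulVec_le (A : Matrix (Idx n) (Idx n) ℝ) (U : HeisLie n) :
    heisDist A 1 ⟨A *ᵥ U⟩ ≤ ENNReal.ofReal (eLen U) := by
  have hd : ∀ t : ℝ, HasDerivAt (fun t : ℝ => t • (A *ᵥ U)) (A *ᵥ U) t := fun t => by
    simpa using (hasDerivAt_id t).smul_const (A *ᵥ U)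
  have htan : ∀ t : ℝ, leftDiff (t • (A *ᵥ U)) (A *ᵥ U) = A *ᵥ U := by
    intro t; apply lie_ext <;> simp
  have hac : AbsolutelyContinuousOnInterval (fun t : ℝ => t • (A *ᵥ U)) 0 1 := by
    refine ContDiffOn.absolutelyContinuousOnInterval (ContDiff.contDiffOn ?_)
    fun_prop
  refine iInf₂_le_of_le (fun t : ℝ => t • (A *ᵥ U)) ⟨⟨hac, ?_⟩, ?_, ?_⟩ ?_
  · exact Filter.Eventually.of_forall fun t => ⟨U, by rw [(hd t).deriv, htan]⟩
  · simp [Heis.one_log]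
  · simp
  · calc pathLength A (fun t : ℝ => t • (A *ᵥ U))
        ≤ ∫⁻ _ in Icc (0 : ℝ) 1, ENNReal.ofReal (eLen U) := by
          refine lintegral_mono fun t => ENNReal.ofReal_le_ofReal ?_
          rw [(hd t).deriv]
          have := subNorm_leftDiff_le A (t • (A *ᵥ U)) U
          rwa [htan] at this
      _ = ENNReal.ofReal (eLen U) := by simp

theorem heisDist_self (A : Matrix (Idx n) (Idx n) ℝ) (p : Heis n) : heisDist A p p = 0 := by
  rw [heisDist_eq_one_left, inv_mul_cancel]
  have := heisDist_one_mulVec_le A (0 : HeisLie n)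
  rw [Matrix.mulVec_zero, eLen_zero, ENNReal.ofReal_zero] at this
  exact le_antisymm this zero_le

end HeisDist

/-! ### Quantitative estimates -/

section Estimates

open MeasureTheory Set

variable {n : ℕ}

theorem card_Idx : (Fintype.card (Idx n) : ℝ) = 2 * n + 1 := by
  simp [Fintype.card_sum]; ring

theorem card_HIdx : (Fintype.card (HIdx n) : ℝ) = 2 * n := by
  simp [Fintype.card_sum]; ring

theorem heisDist_one_mul_le (A : Matrix (Idx n) (Idx n) ℝ) (g h : Heis n) :
    heisDist A 1 (g * h) ≤ heisDist A 1 g + heisDist A 1 h := by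
  refine (heisDist_triangle A 1 g (g * h)).trans (add_le_add le_rfl (le_of_eq ?_))
  rw [heisDist_eq_one_left, inv_mul_cancel_left]

/-- The central element obtained as a commutator. -/
theorem heisDist_one_zVec_symp_le (A : Matrix (Idx n) (Idx n) ℝ) (U V : HeisLie n) :
    heisDist A 1 ⟨zVec (symp (hor (A *ᵥ U)) (hor (A *ᵥ V)))⟩
      ≤ ENNReal.ofReal (2 * (eLen U + eLen V)) := by
  have h : (⟨zVec (symp (hor (A *ᵥ U)) (hor (A *ᵥ V)))⟩ : Heis n)
      = (⟨A *ᵥ U⟩ * ⟨A *ᵥ V⟩) * (⟨A *ᵥ (-U)⟩ * ⟨A *ᵥ (-V)⟩) := by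
    apply heis_ext
    · simp [Matrix.mulVec_neg]
      abel
    · simp [Matrix.mulVec_neg, symp_swap (hor (A *ᵥ V)) (hor (A *ᵥ U))]; ring
  rw [h]
  refine (heisDist_one_mul_le A _ _).trans ((add_le_add (heisDist_one_mul_le A _ _)
    (heisDist_one_mul_le A _ _)).trans ((add_le_add (add_le_add (heisDist_one_mulVec_le A U)
    (heisDist_one_mulVec_le A V)) (add_le_add (heisDist_one_mulVec_le A (-U))
    (heisDist_one_mulVec_le A (-V)))).trans (le_of_eq ?_)))
  rw [eLen_neg, eLen_neg, ← ENNReal.ofReal_add (eLen_nonneg _) (eLen_nonneg _),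
    ← ENNReal.ofReal_add (by positivity [eLen_nonneg U, eLen_nonneg V])
      (by positivity [eLen_nonneg U, eLen_nonneg V])]
  congr 1; ring

theorem exists_symp_eq_one_norm_le (hn : 1 ≤ n) :
    ∃ a b : HIdx n → ℝ, symp a b = 1 ∧ ‖a‖ ≤ 1 ∧ ‖b‖ ≤ 1 := by
  refine ⟨Pi.single (Sum.inl ⟨0, hn⟩) 1, Pi.single (Sum.inr ⟨0, hn⟩) 1, ?_, ?_, ?_⟩
  · rw [symp, Finset.sum_eq_single ⟨0, hn⟩] <;> simp
    intro b hb; left; rw [Pi.single_eq_of_ne]; simpa using hb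
  · rw [Pi.norm_single]; simp
  · rw [Pi.norm_single]; simp

theorem heisDist_one_mulVec_le_norm (A : Matrix (Idx n) (Idx n) ℝ) (U : HeisLie n) {b : ℝ}
    (h : ‖U‖ ≤ b) : heisDist A 1 ⟨A *ᵥ U⟩ ≤ ENNReal.ofReal ((2 * n + 1) * b) := by
  refine (heisDist_one_mulVec_le A U).trans (ENNReal.ofReal_le_ofReal ?_)
  refine (eLen_le_card_mul_norm U).trans ?_
  rw [card_Idx]
  gcongr

/-- A uniform upper bound for the distance in terms of a right inverse. -/
theorem heisDist_one_le (hn : 1 ≤ n) {A : Matrix (Idx n) (Idx n) ℝ}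
    {N : Matrix (Idx n) (HIdx n) ℝ} (hN : ∀ v, hor (A *ᵥ (N *ᵥ v)) = v) {M : ℝ} (hM : 0 ≤ M)
    (hAM : ∀ U, ‖A *ᵥ U‖ ≤ M * ‖U‖) (hNM : ∀ v, ‖N *ᵥ v‖ ≤ M * ‖v‖) (g : Heis n) :
    heisDist A 1 g ≤ ENNReal.ofReal ((2 * n + 1) * (M * ‖hor g.log‖) +
      4 * ((2 * n + 1) * (M * Real.sqrt (|ver g.log| + M * (M * ‖hor g.log‖))))) := by
  set v := hor g.log
  set w := ver g.log - ver (A *ᵥ (N *ᵥ v))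
  -- Move straight to a point with the right horizontal part, then correct the vertical error w by a
  -- commutator of arcs of length of order √|w|.
  have hg : g = ⟨A *ᵥ (N *ᵥ v)⟩ * ⟨zVec w⟩ := by
    apply heis_ext
    · rw [hor_mul, hN, hor_zVec, add_zero]
    · rw [ver_mul, ver_zVec, hor_zVec, symp_zero_right]; ring
  have hw : |w| ≤ |ver g.log| + M * (M * ‖v‖) := by
    refine (abs_sub _ _).trans (add_le_add le_rfl ((abs_ver_le _).trans ((hAM _).trans ?_)))
    exact mul_le_mul_of_nonneg_left (hNM v) hM
  obtain ⟨a, b, hab, ha, hb⟩ := exists_symp_eq_one_norm_le hn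
  set s := Real.sqrt |w|
  -- The factor t carries the sign of w.
  obtain ⟨t, ht, hst⟩ : ∃ t, |t| = s ∧ s * t = w := by
    have hss : s * s = |w| := Real.mul_self_sqrt (abs_nonneg w)
    rcases le_total 0 w with h | h
    · exact ⟨s, abs_of_nonneg (Real.sqrt_nonneg _), by rw [hss, abs_of_nonneg h]⟩
    · refine ⟨-s, by rw [abs_neg, abs_of_nonneg (Real.sqrt_nonneg _)], ?_⟩
      rw [mul_neg, hss, abs_of_nonpos h, neg_neg]
  have hsz : heisDist A 1 ⟨zVec w⟩ ≤ ENNReal.ofReal (4 * ((2 * n + 1) * (M * s))) := by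
    have h1 := heisDist_one_zVec_symp_le A (N *ᵥ (s • a)) (N *ᵥ (t • b))
    rw [hN, hN, symp_smul_left, symp_smul_right, hab, mul_one, hst] at h1
    refine h1.trans (ENNReal.ofReal_le_ofReal ?_)
    have h2 : ∀ x : HIdx n → ℝ, ‖x‖ ≤ s → eLen (N *ᵥ x) ≤ (2 * n + 1) * (M * s) := by
      intro x hx
      refine (eLen_le_card_mul_norm _).trans ?_
      rw [card_Idx]
      have := (hNM x).trans (mul_le_mul_of_nonneg_left hx hM)
      gcongr
    have h3 := h2 (s • a) (by
      rw [norm_smul, Real.norm_eq_abs, abs_of_nonneg (Real.sqrt_nonneg _)]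
      exact mul_le_of_le_one_right (Real.sqrt_nonneg _) ha)
    have h4 := h2 (t • b) (by
      rw [norm_smul, Real.norm_eq_abs, ht]
      exact mul_le_of_le_one_right (Real.sqrt_nonneg _) hb)
    linarith
  have hsle : s ≤ Real.sqrt (|ver g.log| + M * (M * ‖v‖)) := Real.sqrt_le_sqrt hw
  calc heisDist A 1 g ≤ heisDist A 1 ⟨A *ᵥ (N *ᵥ v)⟩ + heisDist A 1 ⟨zVec w⟩ := by
        conv_lhs => rw [hg]
        exact heisDist_one_mul_le A _ _
    _ ≤ ENNReal.ofReal ((2 * n + 1) * (M * ‖v‖)) + ENNReal.ofReal (4 * ((2 * n + 1) * (M * s))) :=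
        add_le_add (heisDist_one_mulVec_le_norm A _ (hNM v)) hsz
    _ = ENNReal.ofReal ((2 * n + 1) * (M * ‖v‖) + 4 * ((2 * n + 1) * (M * s))) := by
        rw [← ENNReal.ofReal_add (by positivity) (by positivity)]
    _ ≤ _ := by
        apply ENNReal.ofReal_le_ofReal
        gcongr

theorem CoordIntegrable.eLen {U : ℝ → HeisLie n} (hU : CoordIntegrable U) :
    IntervalIntegrable (fun t => eLen (U t)) volume 0 1 := by
  have h1 := IntervalIntegrable.sum Finset.univ (f := fun i t => |U t i|) (μ := volume)
    (a := 0) (b := 1) fun i _ => (hU i).abs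
  refine h1.mono_fun ?_ (Filter.Eventually.of_forall fun t => ?_)
  · refine continuous_eLen.comp_aestronglyMeasurable ?_
    rw [uIoc_of_le zero_le_one]
    exact (aemeasurable_pi_lambda _ fun i =>
      (hU i).aestronglyMeasurable.aemeasurable).aestronglyMeasurable
  · dsimp only
    rw [Real.norm_eq_abs, abs_of_nonneg (eLen_nonneg _), Finset.sum_apply]
    exact (eLen_le_sum_abs _).trans (le_abs_self _)

/-- The length of a control. -/
noncomputable def ctrlLen (U : ℝ → HeisLie n) : ℝ := ∫ t in (0 : ℝ)..1, eLen (U t)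

theorem ctrlLen_nonneg (U : ℝ → HeisLie n) : 0 ≤ ctrlLen U :=
  intervalIntegral.integral_nonneg zero_le_one fun _ _ => eLen_nonneg _

theorem lintegral_eLen_eq {U : ℝ → HeisLie n} (hU : CoordIntegrable U) :
    ∫⁻ t in Icc (0 : ℝ) 1, ENNReal.ofReal (eLen (U t)) = ENNReal.ofReal (ctrlLen U) := by
  have h := (intervalIntegrable_iff_integrableOn_Icc_of_le zero_le_one).1 hU.eLen
  rw [ctrlLen, intervalIntegral.integral_of_le zero_le_one, ← integral_Icc_eq_integral_Ioc,
    ofReal_integral_eq_lintegral_ofReal h (Filter.Eventually.of_forall fun t => eLen_nonneg _)]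

/-- All estimates along trajectories reduce to this one: an integrand dominated by the speed of the
control contributes at most a multiple of its length. -/
theorem abs_integral_le_ctrlLen {U : ℝ → HeisLie n} (hU : CoordIntegrable U) {f : ℝ → ℝ} {K : ℝ}
    (hK : 0 ≤ K) (hf : ∀ s ∈ Icc (0 : ℝ) 1, |f s| ≤ K * ‖U s‖) {t : ℝ} (ht : t ∈ Icc (0 : ℝ) 1) :
    |∫ s in (0 : ℝ)..t, f s| ≤ K * ctrlLen U := by
  have hi : IntervalIntegrable (fun s => K * eLen (U s)) volume 0 1 := hU.eLen.const_mul K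
  have h1 : ‖∫ s in (0 : ℝ)..t, f s‖ ≤ ∫ s in (0 : ℝ)..t, K * eLen (U s) := by
    refine intervalIntegral.norm_integral_le_of_norm_le ht.1
      (Filter.Eventually.of_forall fun s hs => ?_) (hi.mono_set ?_)
    · exact (hf s ⟨hs.1.le, hs.2.trans ht.2⟩).trans
        (mul_le_mul_of_nonneg_left (norm_le_eLen _) hK)
    · rw [uIcc_of_le ht.1, uIcc_of_le zero_le_one]; exact Icc_subset_Icc_right ht.2
  refine h1.trans ?_
  rw [ctrlLen, ← intervalIntegral.integral_const_mul]
  refine intervalIntegral.integral_mono_interval le_rfl ht.1 ht.2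
    (Filter.Eventually.of_forall fun s => ?_) hi
  exact mul_nonneg hK (eLen_nonneg _)

theorem IsControl.hor_eq {A : Matrix (Idx n) (Idx n) ℝ} {U c : ℝ → HeisLie n}
    (hc : IsControl A U c) (h0 : c 0 = 0) {t : ℝ} (ht : t ∈ Icc (0 : ℝ) 1) (i : HIdx n) :
    hor (c t) i = ∫ s in (0 : ℝ)..t, hor (A *ᵥ U s) i := by
  have := hc.eq t ht (Sum.inl i)
  rw [h0, Pi.zero_apply, zero_add] at this
  rw [show hor (c t) i = c t (Sum.inl i) from rfl, this]
  exact intervalIntegral.integral_congr fun s _ => congrFun (hor_leftDiff (c s) (A *ᵥ U s)) i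

theorem IsControl.ver_eq {A : Matrix (Idx n) (Idx n) ℝ} {U c : ℝ → HeisLie n}
    (hc : IsControl A U c) (h0 : c 0 = 0) {t : ℝ} (ht : t ∈ Icc (0 : ℝ) 1) :
    ver (c t) = ∫ s in (0 : ℝ)..t, (ver (A *ᵥ U s) + 1 / 2 * symp (hor (c s)) (hor (A *ᵥ U s))) := by
  have := hc.eq t ht (Sum.inr ())
  rw [h0, Pi.zero_apply, zero_add] at this
  rw [show ver (c t) = c t (Sum.inr ()) from rfl, this]
  exact intervalIntegral.integral_congr fun s _ => ver_leftDiff (c s) (A *ᵥ U s)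

theorem IsControl.ver_integrable {A : Matrix (Idx n) (Idx n) ℝ} {U c : ℝ → HeisLie n}
    (hc : IsControl A U c) : IntervalIntegrable
      (fun s => ver (A *ᵥ U s) + 1 / 2 * symp (hor (c s)) (hor (A *ᵥ U s))) volume 0 1 := by
  have h := hc.integrable.mulVec A
  exact (h (Sum.inr ())).add ((h.hor.symp (continuous_hor.comp_continuousOn
    hc.continuousOn)).const_mul _)

theorem norm_hor_mulVec_le {A : Matrix (Idx n) (Idx n) ℝ} {M : ℝ}
    (hAM : ∀ U, ‖A *ᵥ U‖ ≤ M * ‖U‖) (U : HeisLie n) : ‖hor (A *ᵥ U)‖ ≤ M * ‖U‖ :=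
  (norm_hor_le _).trans (hAM U)

theorem abs_ver_mulVec_le {A : Matrix (Idx n) (Idx n) ℝ} {M : ℝ}
    (hAM : ∀ U, ‖A *ᵥ U‖ ≤ M * ‖U‖) (U : HeisLie n) : |ver (A *ᵥ U)| ≤ M * ‖U‖ :=
  (abs_ver_le _).trans (hAM U)

theorem IsControl.norm_hor_le {A : Matrix (Idx n) (Idx n) ℝ} {U c : ℝ → HeisLie n}
    (hc : IsControl A U c) (h0 : c 0 = 0) {M : ℝ} (hM : 0 ≤ M) (hAM : ∀ U, ‖A *ᵥ U‖ ≤ M * ‖U‖)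
    {t : ℝ} (ht : t ∈ Icc (0 : ℝ) 1) : ‖hor (c t)‖ ≤ M * ctrlLen U := by
  refine (pi_norm_le_iff_of_nonneg (mul_nonneg hM (ctrlLen_nonneg U))).2 fun i => ?_
  rw [hc.hor_eq h0 ht i]
  exact abs_integral_le_ctrlLen hc.integrable hM
    (fun s _ => (norm_le_pi_norm (hor (A *ᵥ U s)) i).trans (norm_hor_mulVec_le hAM _)) ht

theorem abs_half_symp_le {u v : HIdx n → ℝ} {a b : ℝ} (hu : ‖u‖ ≤ a) (hv : ‖v‖ ≤ b) :
    |1 / 2 * symp u v| ≤ n * a * b := by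
  rw [abs_mul, abs_of_nonneg (by norm_num : (0 : ℝ) ≤ 1 / 2)]
  have h1 := abs_symp_le u v
  have h2 : ‖u‖ * ‖v‖ ≤ a * b :=
    mul_le_mul hu hv (norm_nonneg _) ((norm_nonneg _).trans hu)
  have h3 : (n : ℝ) * (‖u‖ * ‖v‖) ≤ n * (a * b) := mul_le_mul_of_nonneg_left h2 n.cast_nonneg
  linarith

theorem IsControl.abs_ver_le {A : Matrix (Idx n) (Idx n) ℝ} {U c : ℝ → HeisLie n}
    (hc : IsControl A U c) (h0 : c 0 = 0) {M : ℝ} (hM : 0 ≤ M) (hAM : ∀ U, ‖A *ᵥ U‖ ≤ M * ‖U‖)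
    {t : ℝ} (ht : t ∈ Icc (0 : ℝ) 1) :
    |ver (c t)| ≤ (M + n * (M * ctrlLen U) * M) * ctrlLen U := by
  have hl := ctrlLen_nonneg U
  rw [hc.ver_eq h0 ht]
  refine abs_integral_le_ctrlLen hc.integrable (by positivity) (fun s hs => ?_) ht
  refine (abs_add_le _ _).trans ?_
  have h1 := abs_ver_mulVec_le hAM (U s)
  have h2 := abs_half_symp_le (hc.norm_hor_le h0 hM hAM hs) (norm_hor_mulVec_le hAM (U s))
  linarith

/-- A path of bounded length comes from a control. -/
theorem exists_control_of_pathLength_lt {A : Matrix (Idx n) (Idx n) ℝ} (hA : A ∈ frames n)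
    {g : Heis n} {L : ENNReal} (h : heisDist A 1 g < L) :
    ∃ U c, IsControl A U c ∧ c 0 = 0 ∧ c 1 = g.log ∧ ENNReal.ofReal (ctrlLen U) < L := by
  obtain ⟨c, hc⟩ := iInf_lt_iff.1 h
  obtain ⟨⟨hadm, h0, h1⟩, hlt⟩ := iInf_lt_iff.1 hc
  obtain ⟨U, hU, hlen⟩ := hadm.exists_isControl hA
  exact ⟨U, c, hU, h0, h1, by rwa [← lintegral_eLen_eq hU.integrable, ← hlen]⟩

/-- Small balls are small in exponential coordinates. -/
theorem norm_log_le_of_heisDist_lt {A : Matrix (Idx n) (Idx n) ℝ} (hA : A ∈ frames n) {M : ℝ}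
    (hM : 0 ≤ M) (hAM : ∀ U, ‖A *ᵥ U‖ ≤ M * ‖U‖) {g : Heis n} {δ : ℝ} (hδ : δ ≤ 1)
    (h : heisDist A 1 g < ENNReal.ofReal δ) : ‖g.log‖ ≤ (M + n * M * M) * δ := by
  obtain ⟨U, c, hc, h0, h1, hlt⟩ := exists_control_of_pathLength_lt hA h
  have hl := ctrlLen_nonneg U
  have hlt' : ctrlLen U < δ := (ENNReal.ofReal_lt_ofReal_iff_of_nonneg hl).1 hlt
  have hmem : (1 : ℝ) ∈ Icc (0 : ℝ) 1 := by simp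
  rw [← h1]
  have hn : (0 : ℝ) ≤ n * M * M := by positivity
  apply lie_norm_le
  · refine (hc.norm_hor_le h0 hM hAM hmem).trans ?_
    have : M * ctrlLen U ≤ M * δ := mul_le_mul_of_nonneg_left hlt'.le hM
    nlinarith
  · refine (hc.abs_ver_le h0 hM hAM hmem).trans ?_
    -- The quadratic term is absorbed into the linear one because lengths are at most 1.
    have h2 : (M + n * (M * ctrlLen U) * M) ≤ M + n * M * M := by
      have : n * M * M * ctrlLen U ≤ n * M * M * 1 :=
        mul_le_mul_of_nonneg_left (hlt'.le.trans hδ) hn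
      linarith
    exact mul_le_mul h2 hlt'.le hl (by positivity)

/-- The projection to the horizontal plane does not increase distances. -/
theorem norm_inv_mulVec_hor_le {A : Matrix (Idx n) (Idx n) ℝ} (hA : A ∈ frames n)
    (hw : IsWeakCanonical A) {g : Heis n} {δ : ℝ}
    (h : heisDist A 1 g < ENNReal.ofReal δ) : ‖(tildeBlock A)⁻¹ *ᵥ hor g.log‖ ≤ δ := by
  obtain ⟨U, c, hc, h0, h1, hlt⟩ := exists_control_of_pathLength_lt hA h
  have hl := ctrlLen_nonneg U
  have hlt' : ctrlLen U < δ := (ENNReal.ofReal_lt_ofReal_iff_of_nonneg hl).1 hlt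
  have hmem : (1 : ℝ) ∈ Icc (0 : ℝ) 1 := by simp
  have hdet := isUnit_det_of_frames hw hA
  refine (pi_norm_le_iff_of_nonneg (hl.trans hlt'.le)).2 fun i => ?_
  -- In orthonormal coordinates the horizontal displacement is the integral of the horizontal
  -- control itself.
  have key : ((tildeBlock A)⁻¹ *ᵥ hor g.log) i = ∫ s in (0 : ℝ)..1, hor (U s) i := by
    have hsum : ∀ s, hor (U s) i = ∑ j, (tildeBlock A)⁻¹ i j * hor (A *ᵥ U s) j := by
      intro s
      have : hor (U s) = (tildeBlock A)⁻¹ *ᵥ hor (A *ᵥ U s) := by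
        rw [hor_mulVec_of_isWeakCanonical hw, Matrix.mulVec_mulVec, Matrix.nonsing_inv_mul _ hdet,
          Matrix.one_mulVec]
      rw [this]; rfl
    simp only [hsum]
    rw [intervalIntegral.integral_finsetSum fun j _ =>
      ((hc.integrable.mulVec A).hor j).const_mul _]
    simp only [intervalIntegral.integral_const_mul, ← hc.hor_eq h0 hmem, h1]
    rfl
  rw [key, Real.norm_eq_abs]
  have := abs_integral_le_ctrlLen hc.integrable (f := fun s => hor (U s) i) zero_le_one
    (fun s _ => by rw [one_mul]; exact (norm_le_pi_norm (hor (U s)) i).trans (_root_.norm_hor_le _)) hmem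
  rw [one_mul] at this
  exact this.trans hlt'.le

/-- The same control, used for two different structures. -/
theorem IsControl.compare {A B : Matrix (Idx n) (Idx n) ℝ} {U c c' : ℝ → HeisLie n}
    (hc : IsControl A U c) (h0 : c 0 = 0) (hc' : IsControl B U c') (h0' : c' 0 = 0) {M δ : ℝ}
    (hM : 0 ≤ M) (hAM : ∀ U, ‖A *ᵥ U‖ ≤ M * ‖U‖) (hBM : ∀ U, ‖B *ᵥ U‖ ≤ M * ‖U‖) (hδ : 0 ≤ δ)
    (hAB : ∀ U, ‖A *ᵥ U - B *ᵥ U‖ ≤ δ * ‖U‖) {p q : Heis n} (hp : c 1 = p.log) (hq : c' 1 = q.log) :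
    ‖hor (q⁻¹ * p).log‖ ≤ δ * ctrlLen U ∧
    |ver (q⁻¹ * p).log| ≤ δ * (ctrlLen U + 3 * n * M * ctrlLen U ^ 2) := by
  have hl := ctrlLen_nonneg U
  have hmem : (1 : ℝ) ∈ Icc (0 : ℝ) 1 := by simp
  have hor_diff : ∀ t ∈ Icc (0 : ℝ) 1, ‖hor (c t) - hor (c' t)‖ ≤ δ * ctrlLen U := by
    intro t ht
    refine (pi_norm_le_iff_of_nonneg (by positivity)).2 fun i => ?_
    have hsub : uIcc (0 : ℝ) t ⊆ uIcc 0 1 := by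
      rw [uIcc_of_le ht.1, uIcc_of_le zero_le_one]; exact Icc_subset_Icc_right ht.2
    rw [Pi.sub_apply, hc.hor_eq h0 ht i, hc'.hor_eq h0' ht i,
      ← intervalIntegral.integral_sub (((hc.integrable.mulVec A).hor i).mono_set hsub)
        (((hc.integrable.mulVec B).hor i).mono_set hsub)]
    refine abs_integral_le_ctrlLen hc.integrable hδ (fun s _ => ?_) ht
    exact (norm_le_pi_norm (A *ᵥ U s - B *ᵥ U s) (Sum.inl i)).trans (hAB _)
  have hver : |ver (c 1) - ver (c' 1)| ≤ (δ + (n * (δ * ctrlLen U) * M + n * (M * ctrlLen U) * δ))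
      * ctrlLen U := by
    rw [hc.ver_eq h0 hmem, hc'.ver_eq h0' hmem,
      ← intervalIntegral.integral_sub hc.ver_integrable hc'.ver_integrable]
    refine abs_integral_le_ctrlLen hc.integrable (by positivity) (fun s hs => ?_) hmem
    -- The difference of the bilinear terms is split so that each piece contains one small factor.
    have e : ver (A *ᵥ U s) + 1 / 2 * symp (hor (c s)) (hor (A *ᵥ U s))
        - (ver (B *ᵥ U s) + 1 / 2 * symp (hor (c' s)) (hor (B *ᵥ U s)))
        = ver (A *ᵥ U s - B *ᵥ U s) + (1 / 2 * symp (hor (c s) - hor (c' s)) (hor (A *ᵥ U s))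
          + 1 / 2 * symp (hor (c' s)) (hor (A *ᵥ U s - B *ᵥ U s))) := by
      simp; ring
    rw [e]
    refine (abs_add_le _ _).trans ((add_le_add le_rfl (abs_add_le _ _)).trans ?_)
    have h1 := (_root_.abs_ver_le (A *ᵥ U s - B *ᵥ U s)).trans (hAB (U s))
    have h2 := abs_half_symp_le (hor_diff s hs) (norm_hor_mulVec_le hAM (U s))
    have h3 := abs_half_symp_le (hc'.norm_hor_le h0' hM hBM hs)
      ((_root_.norm_hor_le (A *ᵥ U s - B *ᵥ U s)).trans (hAB (U s)))
    linarith
  have hh : hor (q⁻¹ * p).log = hor (c 1) - hor (c' 1) := by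
    rw [hor_mul, hor_inv, hp, hq]; abel
  -- The group law adds one cross term to the two from the integral, whence the constant 3.
  have hv : ver (q⁻¹ * p).log = (ver (c 1) - ver (c' 1))
      - 1 / 2 * symp (hor (c' 1)) (hor (c 1) - hor (c' 1)) := by
    rw [ver_mul, ver_inv, hor_inv, hp, hq]; simp; ring
  refine ⟨by rw [hh]; exact hor_diff 1 hmem, ?_⟩
  rw [hv]
  refine (abs_sub _ _).trans ?_
  have h3 := abs_half_symp_le (hc'.norm_hor_le h0' hM hBM hmem) (hor_diff 1 hmem)
  nlinarith

/-- Uniform comparison of the distances of nearby structures. -/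
theorem exists_heisDist_le_add (hn : 1 ≤ n) {M : ℝ} (hM : 0 ≤ M) (R : ℝ) {ε : ℝ} (hε : 0 < ε) :
    ∃ δ > 0, ∀ (A B : Matrix (Idx n) (Idx n) ℝ) (N : Matrix (Idx n) (HIdx n) ℝ), A ∈ frames n →
      (∀ v, hor (B *ᵥ (N *ᵥ v)) = v) → (∀ v, ‖N *ᵥ v‖ ≤ M * ‖v‖) →
      (∀ U, ‖A *ᵥ U‖ ≤ M * ‖U‖) → (∀ U, ‖B *ᵥ U‖ ≤ M * ‖U‖) →
      (∀ U, ‖A *ᵥ U - B *ᵥ U‖ ≤ δ * ‖U‖) →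
      ∀ p q, heisDist A p q < ENNReal.ofReal R →
        heisDist B p q ≤ heisDist A p q + ENNReal.ofReal ε := by
  -- The bound of `heisDist_one_le` at a point with horizontal part at most δR and vertical part at
  -- most δ(R + 3nMR²); it vanishes at δ = 0.
  let F : ℝ → ℝ := fun δ => (2 * n + 1) * (M * (δ * R)) +
      4 * ((2 * n + 1) * (M * Real.sqrt (δ * (R + 3 * n * M * R ^ 2) + M * (M * (δ * R)))))
  have hF : Continuous F := by fun_prop
  have hF0 : F 0 < ε := by simpa [F] using hε
  obtain ⟨δ, hδ, hδF⟩ : ∃ δ > 0, F δ < ε := by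
    have := (hF.tendsto 0).eventually (gt_mem_nhds hF0)
    obtain ⟨r, hr, hball⟩ := Metric.eventually_nhds_iff.1 this
    refine ⟨r / 2, by positivity, hball ?_⟩
    rw [Real.dist_eq, sub_zero, abs_of_pos (by positivity)]; linarith
  refine ⟨δ, hδ, fun A B N hA hN hNM hAM hBM hAB p q hR => ?_⟩
  rw [heisDist_eq_one_left B, heisDist_eq_one_left A] at *
  set g := p⁻¹ * q
  by_contra hcon
  push Not at hcon
  -- Assuming the contrary yields one path that is shorter than R and also short enough to
  -- contradict the bound for B.
  have h2 : heisDist A 1 g < min (ENNReal.ofReal R) (heisDist B 1 g - ENNReal.ofReal ε) :=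
    lt_min hR (lt_tsub_iff_right.2 hcon)
  obtain ⟨U, c, hc, h0, h1, hlt⟩ := exists_control_of_pathLength_lt hA h2
  have hl := ctrlLen_nonneg U
  have hlR : ctrlLen U < R :=
    (ENNReal.ofReal_lt_ofReal_iff_of_nonneg hl).1 (hlt.trans_le (min_le_left _ _))
  have hlB := hlt.trans_le (min_le_right _ _)
  rw [lt_tsub_iff_right] at hlB
  obtain ⟨c', h0', hadm', hc', hlen'⟩ := exists_trajectory B hc.integrable 0
  obtain ⟨hh, hv⟩ := hc.compare h0 hc' h0' hM hAM hBM hδ.le hAB (p := g) (q := ⟨c' 1⟩) h1 rfl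
  have hd1 : heisDist B 1 ⟨c' 1⟩ ≤ ENNReal.ofReal (ctrlLen U) := by
    rw [lintegral_eLen_eq hc.integrable] at hlen'
    exact (iInf₂_le_of_le c' ⟨hadm', h0', rfl⟩ le_rfl).trans hlen'
  have hd2 : heisDist B 1 (⟨c' 1⟩⁻¹ * g) ≤ ENNReal.ofReal ε := by
    refine (heisDist_one_le hn hN hM hBM hNM _).trans (ENNReal.ofReal_le_ofReal ?_)
    refine le_trans ?_ hδF.le
    have e1 : δ * ctrlLen U ≤ δ * R := by gcongr
    have e2 : δ * (ctrlLen U + 3 * n * M * ctrlLen U ^ 2) ≤ δ * (R + 3 * n * M * R ^ 2) := by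
      gcongr
    have h3 := hh.trans e1
    have h4 := hv.trans e2
    simp only [F]
    gcongr
  have h5 : heisDist B 1 g ≤ ENNReal.ofReal (ctrlLen U) + ENNReal.ofReal ε := by
    have := heisDist_one_mul_le B ⟨c' 1⟩ (⟨c' 1⟩⁻¹ * g)
    rw [mul_inv_cancel_left] at this
    exact this.trans (add_le_add hd1 hd2)
  exact absurd hlB (not_lt.2 h5)

end Estimates

/-! ### The distance on the quotient -/

section ManifoldDist

open Set Filter Topology

variable {n : ℕ}

/-- The sum of the absolute values of the entries. -/
def matSum {ι κ : Type*} [Fintype ι] [Fintype κ] (A : Matrix ι κ ℝ) : ℝ := ∑ i, ∑ j, |A i j|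

theorem matSum_nonneg {ι κ : Type*} [Fintype ι] [Fintype κ] (A : Matrix ι κ ℝ) : 0 ≤ matSum A :=
  Finset.sum_nonneg fun _ _ => Finset.sum_nonneg fun _ _ => abs_nonneg _

theorem continuous_matSum {ι κ : Type*} [Fintype ι] [Fintype κ] :
    Continuous (matSum : Matrix ι κ ℝ → ℝ) := by
  unfold matSum
  refine continuous_finsetSum _ fun i _ => continuous_finsetSum _ fun j _ => ?_
  exact (continuous_id.matrix_elem i j).abs

theorem norm_mulVec_le {ι κ : Type*} [Fintype ι] [Fintype κ] (A : Matrix ι κ ℝ) (v : κ → ℝ) :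
    ‖A *ᵥ v‖ ≤ matSum A * ‖v‖ := by
  refine (pi_norm_le_iff_of_nonneg (mul_nonneg (matSum_nonneg A) (norm_nonneg v))).2 fun i => ?_
  refine (Finset.abs_sum_le_sum_abs _ _).trans ?_
  have h1 : ∑ j, |A i j * v j| ≤ ∑ j, |A i j| * ‖v‖ := by
    refine Finset.sum_le_sum fun j _ => ?_
    rw [abs_mul]
    exact mul_le_mul_of_nonneg_left (norm_le_pi_norm v j) (abs_nonneg _)
  refine h1.trans ?_
  rw [← Finset.sum_mul]
  refine mul_le_mul_of_nonneg_right ?_ (norm_nonneg v)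
  exact Finset.single_le_sum (f := fun i => ∑ j, |A i j|)
    (fun _ _ => Finset.sum_nonneg fun _ _ => abs_nonneg _) (Finset.mem_univ i)

theorem tendsto_inv_one {ι : Type*} [Fintype ι] [DecidableEq ι] :
    Tendsto (fun A : Matrix ι ι ℝ => A⁻¹) (𝓝 1) (𝓝 1) := by
  have h : ContinuousAt (fun A : Matrix ι ι ℝ => A⁻¹) 1 := by
    refine continuousAt_matrix_inv 1 ?_
    rw [Ring.inverse_eq_inv']
    exact continuousAt_inv₀ (by simp)
  simpa using h.tendsto

/-- Uniform bounds near a given structure. -/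
theorem exists_uniform_bound {A : Matrix (Idx n) (Idx n) ℝ} (hA : A ∈ frames n) :
    ∃ M ≥ 0, ∀ᶠ B in 𝓝 A, matSum B ≤ M ∧ ∃ N : Matrix (Idx n) (HIdx n) ℝ,
      (∀ v, hor (B *ᵥ (N *ᵥ v)) = v) ∧ ∀ v, ‖N *ᵥ v‖ ≤ M * ‖v‖ := by
  obtain ⟨N₀, hN₀⟩ := exists_right_inverse hA
  -- The horizontal part of B N₀ is the identity at B = A, hence invertible nearby, and N₀ P(B)⁻¹ is
  -- a right inverse for B depending continuously on B.
  let P : Matrix (Idx n) (Idx n) ℝ → Matrix (HIdx n) (HIdx n) ℝ :=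
    fun B => (B * N₀).submatrix Sum.inl id
  have hP : Continuous P := by
    refine Continuous.matrix_submatrix ?_ _ _
    fun_prop
  have hPv : ∀ B v, P B *ᵥ v = hor (B *ᵥ (N₀ *ᵥ v)) := by
    intro B v
    rw [Matrix.mulVec_mulVec]
    rfl
  have hPA : P A = 1 := by
    apply Matrix.ext_of_mulVec_single
    intro i
    rw [hPv, hN₀, Matrix.one_mulVec]
  have hdet : ∀ᶠ B in 𝓝 A, IsUnit (P B).det := by
    have h1 : ContinuousAt (fun B => (P B).det) A := hP.matrix_det.continuousAt
    have h2 : (P A).det ≠ 0 := by simp [hPA]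
    filter_upwards [h1.eventually_ne h2] with B hB
    exact isUnit_iff_ne_zero.2 hB
  have hlim : Tendsto (fun B => matSum (N₀ * (P B)⁻¹)) (𝓝 A) (𝓝 (matSum (N₀ * (1 : Matrix (HIdx n) (HIdx n) ℝ)))) := by
    have h1 : Tendsto P (𝓝 A) (𝓝 1) := by
      have := hP.tendsto A; rwa [hPA] at this
    have h2 := tendsto_inv_one.comp h1
    have h3 : Continuous fun C : Matrix (HIdx n) (HIdx n) ℝ => matSum (N₀ * C) :=
      continuous_matSum.comp (by fun_prop)
    exact (h3.tendsto 1).comp h2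
  rw [Matrix.mul_one] at hlim
  refine ⟨(matSum A + 1) + (matSum N₀ + 1), ?_, ?_⟩
  · have := matSum_nonneg A
    have := matSum_nonneg N₀
    linarith
  have hb1 := hlim.eventually (gt_mem_nhds (lt_add_one _))
  have hb2 := (continuous_matSum.tendsto A).eventually (gt_mem_nhds (lt_add_one _))
  filter_upwards [hdet, hb1, hb2] with B h1 h2 h3
  have h4 := matSum_nonneg A
  have h5 := matSum_nonneg N₀
  refine ⟨by linarith, N₀ * (P B)⁻¹, fun v => ?_, fun v => ?_⟩
  · rw [← Matrix.mulVec_mulVec v N₀, ← hPv, Matrix.mulVec_mulVec, Matrix.mul_nonsing_inv _ h1,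
      Matrix.one_mulVec]
  · refine (norm_mulVec_le _ v).trans (mul_le_mul_of_nonneg_right ?_ (norm_nonneg v))
    linarith

/-- Locally uniform continuity of the distance on the group in the structure. -/
theorem eventually_heisDist_le_add (hn : 1 ≤ n) {A : Matrix (Idx n) (Idx n) ℝ} (hA : A ∈ frames n)
    (R : ℝ) {ε : ℝ} (hε : 0 < ε) : ∀ᶠ B in 𝓝[frames n] A,
      (∀ p q, heisDist A p q < ENNReal.ofReal R →
        heisDist B p q ≤ heisDist A p q + ENNReal.ofReal ε) ∧
      (∀ p q, heisDist B p q < ENNReal.ofReal R →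
        heisDist A p q ≤ heisDist B p q + ENNReal.ofReal ε) := by
  obtain ⟨M, hM, hbd⟩ := exists_uniform_bound hA
  obtain ⟨δ, hδ, hcmp⟩ := exists_heisDist_le_add hn hM R hε
  obtain ⟨hAM, NA, hNA, hNAM⟩ := hbd.self_of_nhds
  have hclose : ∀ᶠ B in 𝓝 A, matSum (A - B) < δ := by
    have h1 : Continuous fun B : Matrix (Idx n) (Idx n) ℝ => matSum (A - B) :=
      continuous_matSum.comp (continuous_const.sub continuous_id)
    have h2 : matSum (A - A) < δ := by simpa [matSum] using hδ
    exact (h1.tendsto A).eventually (gt_mem_nhds h2)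
  have hb : ∀ {B : Matrix (Idx n) (Idx n) ℝ} {M : ℝ}, matSum B ≤ M → ∀ U, ‖B *ᵥ U‖ ≤ M * ‖U‖ :=
    fun h U => (norm_mulVec_le _ U).trans (mul_le_mul_of_nonneg_right h (norm_nonneg U))
  filter_upwards [mem_nhdsWithin_of_mem_nhds hbd, mem_nhdsWithin_of_mem_nhds hclose,
    self_mem_nhdsWithin] with B hB hBδ hBf
  obtain ⟨hBM, NB, hNB, hNBM⟩ := hB
  have hAB : ∀ U, ‖A *ᵥ U - B *ᵥ U‖ ≤ δ * ‖U‖ := by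
    intro U
    rw [← Matrix.sub_mulVec]
    exact hb hBδ.le U
  refine ⟨hcmp A B NB hA hNB hNBM (hb hAM) (hb hBM) hAB,
    hcmp B A NA hBf hNA hNAM (hb hBM) (hb hAM) fun U => ?_⟩
  rw [norm_sub_rev]; exact hAB U

variable {r : Fin n → ℕ}

theorem mk_eq_mk_iff {p q : Heis n} :
    (Quotient.mk _ p : HeisManifold r) = Quotient.mk _ q ↔ ∃ g ∈ heisLattice r, q = g * p := by
  rw [Quotient.eq]
  rw [QuotientGroup.rightRel_apply]
  constructor
  · intro h
    exact ⟨_, h, by simp⟩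
  · rintro ⟨g, hg, rfl⟩
    simpa using hg

/-- By left invariance one of the two lifts may be fixed, leaving an infimum over the lattice. -/
theorem manifoldDist_lt_iff {A : Matrix (Idx n) (Idx n) ℝ} {p q : Heis n} {L : ENNReal} :
    manifoldDist r A (Quotient.mk _ p) (Quotient.mk _ q) < L ↔
      ∃ g ∈ heisLattice r, heisDist A p (g * q) < L := by
  simp only [manifoldDist, iInf_lt_iff]
  constructor
  · rintro ⟨p', q', ⟨hp, hq⟩, hlt⟩
    obtain ⟨g, hg, rfl⟩ := mk_eq_mk_iff.1 hp.symm
    obtain ⟨h, hh, rfl⟩ := mk_eq_mk_iff.1 hq.symm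
    refine ⟨g⁻¹ * h, mul_mem (inv_mem hg) hh, ?_⟩
    rw [← heisDist_mul_left A g, ← mul_assoc g, mul_inv_cancel_left]
    exact hlt
  · rintro ⟨g, hg, hlt⟩
    exact ⟨p, g * q, ⟨rfl, (mk_eq_mk_iff.2 ⟨g, hg, rfl⟩).symm⟩, hlt⟩

theorem manifoldDist_le (A : Matrix (Idx n) (Idx n) ℝ) (p q : Heis n) :
    manifoldDist r A (Quotient.mk _ p) (Quotient.mk _ q) ≤ heisDist A p q :=
  iInf_le_of_le p (iInf_le_of_le q (iInf_le_of_le ⟨rfl, rfl⟩ le_rfl))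

theorem manifoldDist_self (A : Matrix (Idx n) (Idx n) ℝ) (a : HeisManifold r) :
    manifoldDist r A a a = 0 := by
  induction a using Quotient.inductionOn with
  | h p => exact le_antisymm ((manifoldDist_le A p p).trans (heisDist_self A p).le) zero_le

theorem manifoldDist_comm (A : Matrix (Idx n) (Idx n) ℝ) (a b : HeisManifold r) :
    manifoldDist r A a b = manifoldDist r A b a := by
  have key : ∀ a b : HeisManifold r, manifoldDist r A a b ≤ manifoldDist r A b a := by
    intro a b
    refine le_iInf fun p => le_iInf fun q => le_iInf fun h => ?_
    rw [heisDist_comm]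
    exact iInf_le_of_le q (iInf_le_of_le p (iInf_le_of_le ⟨h.2, h.1⟩ le_rfl))
  exact le_antisymm (key a b) (key b a)

theorem manifoldDist_triangle (A : Matrix (Idx n) (Idx n) ℝ) (a b c : HeisManifold r) :
    manifoldDist r A a c ≤ manifoldDist r A a b + manifoldDist r A b c := by
  induction a using Quotient.inductionOn with | h p => ?_
  induction b using Quotient.inductionOn with | h q => ?_
  induction c using Quotient.inductionOn with | h s => ?_
  refine ENNReal.le_of_forall_pos_le_add fun ε hε hfin => ?_
  have hε' : ((ε / 2 : NNReal) : ENNReal) ≠ 0 := by simpa using hε.ne'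
  obtain ⟨g, hg, h1⟩ := manifoldDist_lt_iff.1
    (ENNReal.lt_add_right (ne_top_of_le_ne_top hfin.ne le_self_add) hε')
  obtain ⟨h, hh, h2⟩ := manifoldDist_lt_iff.1
    (ENNReal.lt_add_right (ne_top_of_le_ne_top hfin.ne le_add_self) hε')
  rw [← heisDist_mul_left A g] at h2
  have h3 : manifoldDist r A (Quotient.mk _ p) (Quotient.mk _ s)
      ≤ heisDist A p (g * (h * s)) := by
    rw [(mk_eq_mk_iff.2 ⟨g * h, mul_mem hg hh, by rw [mul_assoc]⟩ :
      (Quotient.mk _ s : HeisManifold r) = Quotient.mk _ (g * (h * s)))]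
    exact manifoldDist_le A _ _
  refine h3.trans ((heisDist_triangle A _ (g * q) _).trans ((add_le_add h1.le h2.le).trans ?_))
  rw [add_add_add_comm, ← ENNReal.coe_add, add_halves]

/-- The upper bound of the distance to the identity. -/
theorem exists_continuous_bound (hn : 1 ≤ n) {A : Matrix (Idx n) (Idx n) ℝ} (hA : A ∈ frames n) :
    ∃ F : HeisLie n → ℝ, Continuous F ∧ F 0 = 0 ∧
      ∀ g : Heis n, heisDist A 1 g ≤ ENNReal.ofReal (F g.log) := by
  obtain ⟨M, hM, hbd⟩ := exists_uniform_bound hA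
  obtain ⟨hAM, N, hN, hNM⟩ := hbd.self_of_nhds
  refine ⟨fun u => (2 * n + 1) * (M * ‖hor u‖) +
      4 * ((2 * n + 1) * (M * Real.sqrt (|ver u| + M * (M * ‖hor u‖)))), ?_, by simp,
    heisDist_one_le hn hN hM (fun U => (norm_mulVec_le A U).trans
      (mul_le_mul_of_nonneg_right hAM (norm_nonneg U))) hNM⟩
  have h1 := continuous_hor (n := n)
  have h2 := continuous_ver (n := n)
  fun_prop

/-- Every point has a lift in a fixed ball, on which the continuous upper bound of the distance to
the identity is bounded. -/
theorem exists_diam_bound (hn : 1 ≤ n) (hr : ∀ i, 0 < r i) {A : Matrix (Idx n) (Idx n) ℝ}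
    (hA : A ∈ frames n) : ∃ D : ℝ, 0 < D ∧ ∀ a b : HeisManifold r,
      manifoldDist r A a b < ENNReal.ofReal D := by
  obtain ⟨F, hF, -, hFb⟩ := exists_continuous_bound hn hA
  obtain ⟨R, hR⟩ := exists_bound_heisLattice hr
  obtain ⟨C, hC⟩ := ((isCompact_closedBall (0 : HeisLie n) R).image hF).bddAbove
  have hC0 : 0 ≤ C ⊔ 0 := le_sup_right
  have hone : ∀ a : HeisManifold r,
      manifoldDist r A (Quotient.mk _ 1) a ≤ ENNReal.ofReal (C ⊔ 0) := by
    intro a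
    induction a using Quotient.inductionOn with | h p => ?_
    obtain ⟨g, hg, hgp⟩ := hR p
    rw [(mk_eq_mk_iff.2 ⟨g, hg, rfl⟩ : (Quotient.mk _ p : HeisManifold r) = Quotient.mk _ (g * p))]
    refine (manifoldDist_le A _ _).trans ((hFb _).trans (ENNReal.ofReal_le_ofReal ?_))
    exact (hC ⟨_, by simpa using hgp, rfl⟩).trans le_sup_left
  refine ⟨2 * (C ⊔ 0) + 1, by linarith, fun a b => ?_⟩
  refine (manifoldDist_triangle A a (Quotient.mk _ 1) b).trans_lt ?_
  rw [manifoldDist_comm A a]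
  refine (add_le_add (hone a) (hone b)).trans_lt ?_
  rw [← ENNReal.ofReal_add hC0 hC0]
  exact (ENNReal.ofReal_lt_ofReal_iff (by linarith)).2 (by linarith)

/-- Lifts of distinct points stay a fixed amount apart in coordinates, while a short path moves
coordinates by at most a constant times its length. -/
theorem eq_of_manifoldDist_eq_zero {A : Matrix (Idx n) (Idx n) ℝ} (hA : A ∈ frames n)
    {a b : HeisManifold r} (h : manifoldDist r A a b = 0) : a = b := by
  induction a using Quotient.inductionOn with | h p => ?_
  induction b using Quotient.inductionOn with | h q => ?_
  by_contra hne
  have hpq : p * q⁻¹ ∉ heisLattice r := by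
    intro hmem
    exact hne (mk_eq_mk_iff.2 ⟨p * q⁻¹, hmem, by simp⟩).symm
  obtain ⟨δ, hδ, hsep⟩ := exists_separation r p q hpq
  set K := matSum A + n * matSum A * matSum A
  have hK : 0 ≤ K := by
    have := matSum_nonneg A
    positivity
  set η := min 1 (δ / (K + 1) / 2)
  have hη : 0 < η := by positivity
  obtain ⟨g, hg, hlt⟩ := manifoldDist_lt_iff.1 (h.trans_lt (ENNReal.ofReal_pos.2 hη))
  rw [heisDist_eq_one_left] at hlt
  have h1 := norm_log_le_of_heisDist_lt hA (matSum_nonneg A) (norm_mulVec_le A)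
    (min_le_left _ _) hlt
  have h2 : K * η < δ := by
    have h3 : η ≤ δ / (K + 1) / 2 := min_le_right _ _
    have h4 : (K + 1) * (δ / (K + 1) / 2) = δ / 2 := by field_simp
    nlinarith
  exact absurd (hsep g hg) (not_le.2 (h1.trans_lt h2))

/-- Uniform continuity of the distance on the quotient in the structure. -/
theorem eventually_manifoldDist_le_add (hn : 1 ≤ n) (hr : ∀ i, 0 < r i)
    {A : Matrix (Idx n) (Idx n) ℝ} (hA : A ∈ frames n) {ε : ℝ} (hε : 0 < ε) :
    ∀ᶠ B in 𝓝[frames n] A, ∀ a b : HeisManifold r,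
      manifoldDist r B a b ≤ manifoldDist r A a b + ENNReal.ofReal ε ∧
      manifoldDist r A a b ≤ manifoldDist r B a b + ENNReal.ofReal ε := by
  obtain ⟨D, hD, hdiam⟩ := exists_diam_bound hn hr hA
  have key : ∀ {A B : Matrix (Idx n) (Idx n) ℝ} {R : ℝ},
      (∀ p q, heisDist A p q < ENNReal.ofReal R →
        heisDist B p q ≤ heisDist A p q + ENNReal.ofReal ε) →
      ∀ a b : HeisManifold r, manifoldDist r A a b < ENNReal.ofReal R →
        manifoldDist r B a b ≤ manifoldDist r A a b + ENNReal.ofReal ε := by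
    intro A B R h a b hab
    induction a using Quotient.inductionOn with | h p => ?_
    induction b using Quotient.inductionOn with | h q => ?_
    by_contra hcon
    push Not at hcon
    obtain ⟨g, hg, hlt⟩ := manifoldDist_lt_iff.1 (lt_min hab (lt_tsub_iff_right.2 hcon))
    have h1 := h p (g * q) (hlt.trans_le (min_le_left _ _))
    have h2 := lt_tsub_iff_right.1 (hlt.trans_le (min_le_right _ _))
    rw [(mk_eq_mk_iff.2 ⟨g, hg, rfl⟩ :
      (Quotient.mk _ q : HeisManifold r) = Quotient.mk _ (g * q))] at h2
    exact absurd (h2.trans_le (manifoldDist_le B _ _)) (not_lt.2 h1)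
  -- The radius D + ε leaves room for the distances of B, which by the first comparison may exceed
  -- those of A by ε.
  filter_upwards [eventually_heisDist_le_add hn hA (D + ε) hε] with B hB a b
  have hle : ENNReal.ofReal (D + ε) = ENNReal.ofReal D + ENNReal.ofReal ε :=
    ENNReal.ofReal_add hD.le hε.le
  have h1 := key hB.1 a b ((hdiam a b).trans_le (ENNReal.ofReal_le_ofReal (by linarith)))
  refine ⟨h1, key hB.2 a b (h1.trans_lt ?_)⟩
  rw [hle]
  exact ENNReal.add_lt_add_right ENNReal.ofReal_ne_top (hdiam a b)

/-! ### The quotient as a compact metric space -/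

/-- The quotient `Γ_r \ H_n`, to be equipped with the distance of `A`. -/
@[ext] structure MetricCopy (hn : 1 ≤ n) (hr : ∀ i, 0 < r i) (A : frames n) : Type where
  /-- The underlying point. -/
  pt : HeisManifold r

theorem manifoldDist_ne_top (hn : 1 ≤ n) (hr : ∀ i, 0 < r i) (A : frames n)
    (a b : HeisManifold r) : manifoldDist r A.1 a b ≠ ⊤ := by
  obtain ⟨D, -, hdiam⟩ := exists_diam_bound hn hr A.2
  exact ((hdiam a b).trans ENNReal.ofReal_lt_top).ne

noncomputable instance (hn : 1 ≤ n) (hr : ∀ i, 0 < r i) (A : frames n) :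
    MetricSpace (MetricCopy hn hr A) where
  dist a b := (manifoldDist r A.1 a.pt b.pt).toReal
  dist_self a := by rw [manifoldDist_self, ENNReal.toReal_zero]
  dist_comm a b := by rw [manifoldDist_comm]
  dist_triangle a b c := by
    rw [← ENNReal.toReal_add (manifoldDist_ne_top hn hr A _ _) (manifoldDist_ne_top hn hr A _ _)]
    exact ENNReal.toReal_mono (ENNReal.add_ne_top.2 ⟨manifoldDist_ne_top hn hr A _ _,
      manifoldDist_ne_top hn hr A _ _⟩) (manifoldDist_triangle A.1 a.pt b.pt c.pt)
  eq_of_dist_eq_zero {a b} h := by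
    rcases (ENNReal.toReal_eq_zero_iff _).1 h with h | h
    · exact MetricCopy.ext (eq_of_manifoldDist_eq_zero A.2 h)
    · exact absurd h (manifoldDist_ne_top hn hr A _ _)

theorem dist_metricCopy (hn : 1 ≤ n) (hr : ∀ i, 0 < r i) (A : frames n)
    (a b : MetricCopy hn hr A) : dist a b = (manifoldDist r A.1 a.pt b.pt).toReal := rfl

instance (hn : 1 ≤ n) (hr : ∀ i, 0 < r i) (A : frames n) : Nonempty (MetricCopy hn hr A) :=
  ⟨⟨Quotient.mk _ 1⟩⟩

theorem continuous_mk_metricCopy (hn : 1 ≤ n) (hr : ∀ i, 0 < r i) (A : frames n) :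
    Continuous fun u : HeisLie n => (⟨Quotient.mk _ ⟨u⟩⟩ : MetricCopy hn hr A) := by
  obtain ⟨F, hF, hF0, hFb⟩ := exists_continuous_bound hn A.2
  refine continuous_iff_continuousAt.2 fun u => ?_
  rw [ContinuousAt, tendsto_iff_dist_tendsto_zero]
  have hlim : Tendsto (fun v : HeisLie n => max (F ((⟨v⟩ : Heis n)⁻¹ * ⟨u⟩).log) 0) (𝓝 u)
      (𝓝 0) := by
    have hc : Continuous fun v : HeisLie n => max (F ((⟨v⟩ : Heis n)⁻¹ * ⟨u⟩).log) 0 :=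
      (hF.comp (continuous_mul_log continuous_neg continuous_const)).max continuous_const
    have := hc.tendsto u
    rwa [inv_mul_cancel, Heis.one_log, hF0, max_self] at this
  refine squeeze_zero (fun _ => dist_nonneg) (fun v => ?_) hlim
  rw [dist_metricCopy]
  refine ENNReal.toReal_le_of_le_ofReal (le_max_right _ _) ?_
  refine (manifoldDist_le A.1 _ _).trans ?_
  rw [heisDist_eq_one_left]
  exact (hFb _).trans (ENNReal.ofReal_le_ofReal (le_max_left _ _))

instance (hn : 1 ≤ n) (hr : ∀ i, 0 < r i) (A : frames n) : CompactSpace (MetricCopy hn hr A) := by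
  obtain ⟨R, hR⟩ := exists_bound_heisLattice hr
  refine ⟨?_⟩
  have : (univ : Set (MetricCopy hn hr A)) = (fun u : HeisLie n =>
      (⟨Quotient.mk _ ⟨u⟩⟩ : MetricCopy hn hr A)) '' Metric.closedBall 0 R := by
    refine (eq_univ_of_forall fun a => ?_).symm
    obtain ⟨p, hp⟩ := Quotient.exists_rep a.pt
    obtain ⟨g, hg, hgp⟩ := hR p
    refine ⟨(g * p).log, by simpa using hgp, ?_⟩
    exact MetricCopy.ext ((mk_eq_mk_iff.2 ⟨g, hg, rfl⟩ : (Quotient.mk _ p : HeisManifold r)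
      = Quotient.mk _ (g * p)).symm.trans hp)
  rw [this]
  exact (isCompact_closedBall _ _).image (continuous_mk_metricCopy hn hr A)

/-! ### The map to the Gromov-Hausdorff space -/

/-- The Gromov-Hausdorff class of a structure. -/
noncomputable def ghClass (hn : 1 ≤ n) (hr : ∀ i, 0 < r i) (A : frames n) :
    GromovHausdorff.GHSpace := GromovHausdorff.toGHSpace (MetricCopy hn hr A)

theorem ghClass_eq_iff (hn : 1 ≤ n) (hr : ∀ i, 0 < r i) (A B : frames n) :
    ghClass hn hr A = ghClass hn hr B ↔ moduliClass r A = moduliClass r B := by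
  rw [ghClass, ghClass, GromovHausdorff.toGHSpace_eq_toGHSpace_iff_isometryEquiv, moduliClass,
    moduliClass, Quotient.eq]
  constructor
  · rintro ⟨f⟩
    refine ⟨⟨fun a => (f ⟨a⟩).pt, fun b => (f.symm ⟨b⟩).pt, 
      fun a => congrArg MetricCopy.pt (f.symm_apply_apply ⟨a⟩),
      fun b => congrArg MetricCopy.pt (f.apply_symm_apply ⟨b⟩)⟩,
      fun a b => ?_⟩
    have := f.isometry.dist_eq ⟨a⟩ ⟨b⟩
    rw [dist_metricCopy, dist_metricCopy] at this
    exact (ENNReal.toReal_eq_toReal_iff' (manifoldDist_ne_top hn hr B _ _)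
      (manifoldDist_ne_top hn hr A _ _)).1 this
  · rintro ⟨f, hf⟩
    refine ⟨⟨⟨fun a => ⟨f a.pt⟩, fun b => ⟨f.symm b.pt⟩, fun a => by simp, fun b => by simp⟩, ?_⟩⟩
    refine Isometry.of_dist_eq fun a b => ?_
    rw [dist_metricCopy, dist_metricCopy]
    exact congrArg ENNReal.toReal (hf a.pt b.pt)

/-- For close frames the identity of the quotient distorts distances by at most ε, so the
Gromov-Hausdorff distance is at most ε/2. -/
theorem continuous_ghClass (hn : 1 ≤ n) (hr : ∀ i, 0 < r i) :
    Continuous (ghClass hn hr : frames n → GromovHausdorff.GHSpace) := by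
  refine continuous_iff_continuousAt.2 fun A => ?_
  rw [ContinuousAt, Metric.tendsto_nhds]
  intro ε hε
  have h := eventually_manifoldDist_le_add hn hr A.2 (r := r) hε
  rw [← eventually_nhds_subtype_iff] at h
  filter_upwards [h] with B hB
  have hle : GromovHausdorff.ghDist (MetricCopy hn hr B) (MetricCopy hn hr A)
      ≤ 0 + ε / 2 + 0 := by
    let Φ : ↥(univ : Set (MetricCopy hn hr B)) → MetricCopy hn hr A := fun a => ⟨a.1.pt⟩
    have hΦ : ∀ x, ∃ y, dist x (Φ y) ≤ 0 := fun x =>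
      ⟨⟨⟨x.pt⟩, mem_univ _⟩, by rw [show Φ ⟨⟨x.pt⟩, mem_univ _⟩ = x from rfl, dist_self]⟩
    have hid : ∀ x : MetricCopy hn hr B, ∃ y ∈ univ, dist x y ≤ 0 := fun x =>
      ⟨x, mem_univ _, by rw [dist_self]⟩
    refine GromovHausdorff.ghDist_le_of_approx_subsets Φ hid hΦ fun a b => ?_
    rw [Subtype.dist_eq, dist_metricCopy, dist_metricCopy]
    obtain ⟨h1, h2⟩ := hB a.1.pt b.1.pt
    have hA' := manifoldDist_ne_top hn hr A a.1.pt b.1.pt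
    have hB' := manifoldDist_ne_top hn hr B a.1.pt b.1.pt
    have h1' := ENNReal.toReal_mono (ENNReal.add_ne_top.2 ⟨hA', ENNReal.ofReal_ne_top⟩) h1
    have h2' := ENNReal.toReal_mono (ENNReal.add_ne_top.2 ⟨hB', ENNReal.ofReal_ne_top⟩) h2
    rw [ENNReal.toReal_add hA' ENNReal.ofReal_ne_top, ENNReal.toReal_ofReal hε.le] at h1'
    rw [ENNReal.toReal_add hB' ENNReal.ofReal_ne_top, ENNReal.toReal_ofReal hε.le] at h2'
    rw [abs_le]
    exact ⟨by linarith, by linarith⟩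
  exact lt_of_le_of_lt hle (by linarith)

/-- The moduli space is Hausdorff: it maps continuously and injectively to the
Gromov-Hausdorff space. -/
theorem t2Space_moduli (hn : 1 ≤ n) (hr : ∀ i, 0 < r i) : T2Space (Moduli r) := by
  let f : Moduli r → GromovHausdorff.GHSpace :=
    Quotient.lift (ghClass hn hr) fun A B h => (ghClass_eq_iff hn hr A B).2 (Quotient.sound h)
  have hf : Continuous f := (continuous_ghClass hn hr).quotient_lift _
  refine T2Space.of_injective_continuous (f := f) (fun x y hxy => ?_) hf
  induction x using Quotient.inductionOn with | h A => ?_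
  induction y using Quotient.inductionOn with | h B => ?_
  exact (ghClass_eq_iff hn hr A B).1 hxy

end ManifoldDist

/-! ### Isometries -/

section Isometries

open Set

variable {n : ℕ} {r : Fin n → ℕ}

theorem manifoldDist_map_le {A B : Matrix (Idx n) (Idx n) ℝ} {F : Heis n → Heis n}
    (hd : ∀ p q, heisDist B (F p) (F q) ≤ heisDist A p q)
    (hF : ∀ g ∈ heisLattice r, ∀ p, ∃ h ∈ heisLattice r, F (g * p) = h * F p) (p q : Heis n) :
    manifoldDist r B (Quotient.mk _ (F p)) (Quotient.mk _ (F q))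
      ≤ manifoldDist r A (Quotient.mk _ p) (Quotient.mk _ q) := by
  refine le_of_forall_gt fun L hL => ?_
  obtain ⟨g, hg, hlt⟩ := manifoldDist_lt_iff.1 hL
  obtain ⟨h, hh, heq⟩ := hF g hg q
  refine manifoldDist_lt_iff.2 ⟨h, hh, ?_⟩
  rw [← heq]
  exact (hd p _).trans_lt hlt

/-- Equivariant isometries of the group induce isometries of the quotient. -/
theorem moduliClass_eq_of_equiv {A B : frames n} (F : Heis n ≃ Heis n)
    (hd : ∀ p q, heisDist B.1 (F p) (F q) = heisDist A.1 p q)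
    (hF : ∀ g ∈ heisLattice r, ∀ p, ∃ h ∈ heisLattice r, F (g * p) = h * F p)
    (hF' : ∀ g ∈ heisLattice r, ∀ p, ∃ h ∈ heisLattice r, F.symm (g * p) = h * F.symm p) :
    moduliClass r A = moduliClass r B := by
  refine Quotient.sound ⟨Quotient.congr F fun p q => ?_, fun a b => ?_⟩
  · rw [← Quotient.eq, ← Quotient.eq, mk_eq_mk_iff, mk_eq_mk_iff]
    constructor
    · rintro ⟨g, hg, rfl⟩
      exact hF g hg p
    · rintro ⟨g, hg, hq⟩
      obtain ⟨h, hh, heq⟩ := hF' g hg (F p)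
      rw [← hq, Equiv.symm_apply_apply, Equiv.symm_apply_apply] at heq
      exact ⟨h, hh, heq⟩
  · induction a using Quotient.inductionOn with | h p => ?_
    induction b using Quotient.inductionOn with | h q => ?_
    refine le_antisymm (manifoldDist_map_le (fun p q => (hd p q).le) hF p q) ?_
    have := manifoldDist_map_le (r := r) (A := B.1) (B := A.1) (F := F.symm)
      (fun p q => by rw [← hd, F.apply_symm_apply, F.apply_symm_apply]) hF' (F p) (F q)
    rwa [F.symm_apply_apply, F.symm_apply_apply] at this

/-! ### Reduction to weak canonical form -/

theorem exists_symp_eq_dotProduct (l : HIdx n → ℝ) : ∃ w : HIdx n → ℝ, ∀ v, symp v w = l ⬝ᵥ v := by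
  refine ⟨Sum.elim (fun i => -l (Sum.inr i)) (fun i => l (Sum.inl i)), fun v => ?_⟩
  simp only [symp, dotProduct, Fintype.sum_sum_type, ← Finset.sum_add_distrib]
  exact Finset.sum_congr rfl fun i _ => by simp; ring

/-- Linear part of a right translation in exponential coordinates. -/
noncomputable def rightLinear (w : HIdx n → ℝ) : HeisLie n →ₗ[ℝ] HeisLie n where
  toFun u := u + zVec (1 / 2 * symp (hor u) w)
  map_add' u v := by apply lie_ext <;> simp; ring
  map_smul' s v := by apply lie_ext <;> simp; ring

/-- Right translation by exp w turns a left-invariant frame into its image under Ad(exp(-w)), which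
alters only the Z-components. It commutes with the lattice acting on the left. -/
theorem heisDist_mul_right {A B : Matrix (Idx n) (Idx n) ℝ} {w : HIdx n → ℝ}
    (hh : ∀ U, hor (B *ᵥ U) = hor (A *ᵥ U))
    (hv : ∀ U, ver (B *ᵥ U) = ver (A *ᵥ U) + symp (hor (A *ᵥ U)) w) (p q : Heis n) :
    heisDist B (p * ⟨horVec w⟩) (q * ⟨horVec w⟩) = heisDist A p q := by
  have hmul : ∀ (w : HIdx n → ℝ) (p : Heis n), p * ⟨horVec w⟩
      = ⟨rightLinear w p.log + horVec w⟩ := by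
    intro w p
    apply heis_ext <;> simp [rightLinear]
  have key : ∀ {A B : Matrix (Idx n) (Idx n) ℝ} {w : HIdx n → ℝ},
      (∀ U, hor (B *ᵥ U) = hor (A *ᵥ U)) →
      (∀ U, ver (B *ᵥ U) = ver (A *ᵥ U) + symp (hor (A *ᵥ U)) w) → ∀ p q : Heis n,
      heisDist B (p * ⟨horVec w⟩) (q * ⟨horVec w⟩) ≤ heisDist A p q := by
    intro A B w hh hv p q
    rw [hmul, hmul]
    refine heisDist_affine_le_of_eq _ _ (fun p U => ?_) p q
    apply lie_ext
    · simp [rightLinear, hh]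
    · simp only [rightLinear, LinearMap.coe_mk, AddHom.coe_mk, ver_add, ver_leftDiff, ver_zVec,
        hor_leftDiff, hor_add, hor_zVec, hor_horVec, hh, hv, symp_add_left', symp_zero_left,
        symp_swap w (hor (A *ᵥ U))]
      ring
  refine le_antisymm (key hh hv p q) ?_
  have := key (A := B) (B := A) (w := -w) (fun U => (hh U).symm)
    (fun U => by rw [hv, hh, symp_neg_right]; ring) (p * ⟨horVec w⟩) (q * ⟨horVec w⟩)
  have hinv : (⟨horVec w⟩ : Heis n) * ⟨horVec (-w)⟩ = 1 := by
    apply heis_ext <;> simp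
  rwa [mul_assoc, mul_assoc, hinv, mul_one, mul_one] at this

/-- The block diagonal matrix with given blocks. -/
def blockFrame (T : Matrix (HIdx n) (HIdx n) ℝ) (ρ : ℝ) : Matrix (Idx n) (Idx n) ℝ :=
  Matrix.fromBlocks T 0 0 (Matrix.of fun _ _ => ρ)

theorem isWeakCanonical_blockFrame (T : Matrix (HIdx n) (HIdx n) ℝ) (ρ : ℝ) :
    IsWeakCanonical (blockFrame T ρ) :=
  ⟨Matrix.toBlocks_fromBlocks₁₂ _ _ _ _, Matrix.toBlocks_fromBlocks₂₁ _ _ _ _⟩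

theorem tildeBlock_blockFrame (T : Matrix (HIdx n) (HIdx n) ℝ) (ρ : ℝ) :
    tildeBlock (blockFrame T ρ) = T := Matrix.toBlocks_fromBlocks₁₁ _ _ _ _

theorem rhoEntry_blockFrame (T : Matrix (HIdx n) (HIdx n) ℝ) (ρ : ℝ) :
    rhoEntry (blockFrame T ρ) = ρ := rfl

-- The Gram matrix a aᵀ is positive semidefinite and so has a square factor; this replaces a
-- rectangular frame by a square block.
open scoped MatrixOrder in
theorem exists_mul_transpose_eq {ι κ : Type*} [Fintype ι] [Fintype κ] [DecidableEq κ]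
    [DecidableEq ι] (a : Matrix ι κ ℝ) : ∃ T : Matrix ι ι ℝ, T * Tᵀ = a * aᵀ := by
  have h : (a * aᵀ).PosSemidef := by
    simpa using Matrix.posSemidef_self_mul_conjTranspose a
  obtain ⟨B, hB⟩ := CStarAlgebra.nonneg_iff_eq_star_mul_self.1 h.nonneg
  refine ⟨Bᵀ, ?_⟩
  rw [hB, Matrix.transpose_transpose, Matrix.star_eq_conjTranspose,
    Matrix.conjTranspose_eq_transpose_of_trivial]

/-- Every isometry class contains a structure of weak canonical form. -/
theorem exists_weakCanonical (hn : 1 ≤ n) (r : Fin n → ℕ) (A : frames n) :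
    ∃ B : frames n, IsWeakCanonical B.1 ∧ moduliClass r A = moduliClass r B := by
  obtain ⟨N, hN⟩ := exists_right_inverse A.2
  let a : Matrix (HIdx n) (Idx n) ℝ := A.1.submatrix Sum.inl id
  have ha : ∀ U, a *ᵥ U = hor (A.1 *ᵥ U) := fun U => rfl
  let ζ : Idx n → ℝ := A.1 (Sum.inr ())
  have hζ : ∀ U, ζ ⬝ᵥ U = ver (A.1 *ᵥ U) := fun U => rfl
  have haN : a * N = 1 := by
    apply Matrix.ext_of_mulVec_single
    intro i
    rw [← Matrix.mulVec_mulVec, ha, hN, Matrix.one_mulVec]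
  have hunit : IsUnit (a * aᵀ).det := by
    rw [← Matrix.isUnit_iff_isUnit_det, ← Matrix.mulVec_injective_iff_isUnit]
    refine (injective_iff_map_eq_zero (Matrix.mulVecLin (a * aᵀ))).2 fun x hx => ?_
    have h1 : (a * aᵀ) *ᵥ x = 0 := hx
    have h2 : (aᵀ *ᵥ x) ⬝ᵥ (aᵀ *ᵥ x) = 0 := by
      rw [Matrix.dotProduct_mulVec, Matrix.vecMul_transpose, Matrix.mulVec_mulVec, h1,
        zero_dotProduct]
    have h3 : aᵀ *ᵥ x = 0 := dotProduct_self_eq_zero.1 h2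
    calc x = (a * N)ᵀ *ᵥ x := by rw [haN]; simp
      _ = 0 := by rw [Matrix.transpose_mul, ← Matrix.mulVec_mulVec, h3, Matrix.mulVec_zero]
  -- Least squares: adding the combination `aᵀ l` of the rows of `a` makes the vertical row
  -- orthogonal to all of them.
  let l : HIdx n → ℝ := -((a * aᵀ)⁻¹ *ᵥ (a *ᵥ ζ))
  let ζ' : Idx n → ℝ := ζ + aᵀ *ᵥ l
  have haζ : a *ᵥ ζ' = 0 := by
    simp only [ζ', l, Matrix.mulVec_add, Matrix.mulVec_neg]
    rw [Matrix.mulVec_mulVec (_ *ᵥ _) a, Matrix.mulVec_mulVec (a *ᵥ ζ),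
      Matrix.mul_nonsing_inv _ hunit, Matrix.one_mulVec, add_neg_cancel]
  obtain ⟨w, hw⟩ := exists_symp_eq_dotProduct l
  -- The frame A after right translation by exp w, where `w` represents `l` through the symplectic
  -- form.
  let B₀ : Matrix (Idx n) (Idx n) ℝ := fun i => Sum.elim (fun i => a i) (fun _ => ζ') i
  have hB₀h : ∀ U, hor (B₀ *ᵥ U) = hor (A.1 *ᵥ U) := fun U => rfl
  have hB₀v : ∀ U, ver (B₀ *ᵥ U) = ver (A.1 *ᵥ U) + symp (hor (A.1 *ᵥ U)) w := by
    intro U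
    rw [hw, ← hζ, ← ha]
    change ζ' ⬝ᵥ U = _
    rw [add_dotProduct, Matrix.dotProduct_mulVec, Matrix.mulVec_transpose]
  obtain ⟨T, hT⟩ := exists_mul_transpose_eq a
  have hTu : IsUnit T.det := by
    have h1 : IsUnit (T * Tᵀ).det := by rw [hT]; exact hunit
    rw [Matrix.det_mul] at h1
    exact isUnit_of_mul_isUnit_left h1
  have hBf : blockFrame T (eLen ζ') ∈ frames n :=
    mem_frames_of_isUnit_det hn (isWeakCanonical_blockFrame _ _)
      (by rw [tildeBlock_blockFrame]; exact hTu)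
  -- By orthogonality the Gram matrix is block diagonal, so a block diagonal frame with the same
  -- Gram matrix defines the same distance.
  have hgram : B₀ * B₀ᵀ = blockFrame T (eLen ζ') * (blockFrame T (eLen ζ'))ᵀ := by
    have h11 : ∀ i j, (B₀ * B₀ᵀ) (Sum.inl i) (Sum.inl j) = (a * aᵀ) i j := fun i j => rfl
    have h12 : ∀ i j, (B₀ * B₀ᵀ) (Sum.inl i) (Sum.inr j) = (a *ᵥ ζ') i := fun i j => rfl
    have h21 : ∀ i j, (B₀ * B₀ᵀ) (Sum.inr i) (Sum.inl j) = (a *ᵥ ζ') j := fun i j => by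
      rw [← h12 j i]; simp only [Matrix.mul_apply, Matrix.transpose_apply]
      exact Finset.sum_congr rfl fun _ _ => mul_comm _ _
    have h22 : ∀ i j, (B₀ * B₀ᵀ) (Sum.inr i) (Sum.inr j) = ζ' ⬝ᵥ ζ' := fun i j => rfl
    rw [blockFrame, Matrix.fromBlocks_transpose, Matrix.fromBlocks_multiply]
    ext i j
    rcases i with i | i <;> rcases j with j | j
    · rw [h11]; simp [hT]
    · rw [h12, haζ]; simp
    · rw [h21, haζ]; simp
    · rw [h22, ← eLen_sq_dotProduct]; simp [Matrix.mul_apply, sq]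
  refine ⟨⟨blockFrame T (eLen ζ'), hBf⟩, isWeakCanonical_blockFrame _ _, ?_⟩
  refine moduliClass_eq_of_equiv (Equiv.mulRight (⟨horVec w⟩ : Heis n)) (fun p q => ?_)
    (fun g hg p => ⟨g, hg, by simp [mul_assoc]⟩) (fun g hg p => ⟨g, hg, by simp [mul_assoc]⟩)
  rw [← heisDist_congr hgram]
  exact heisDist_mul_right hB₀h hB₀v p q

/-! ### Symplectic automorphisms of the lattice -/

/-- The automorphism of the group given by a symplectic matrix. -/
def sympAut (S : Matrix (HIdx n) (HIdx n) ℝ) (p : Heis n) : Heis n :=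
  ⟨Sum.elim (S *ᵥ hor p.log) (fun _ => ver p.log)⟩

@[simp] theorem hor_sympAut (S : Matrix (HIdx n) (HIdx n) ℝ) (p : Heis n) :
    hor (sympAut S p).log = S *ᵥ hor p.log := rfl

@[simp] theorem ver_sympAut (S : Matrix (HIdx n) (HIdx n) ℝ) (p : Heis n) :
    ver (sympAut S p).log = ver p.log := rfl

theorem sympAut_mul {S : Matrix (HIdx n) (HIdx n) ℝ}
    (hS : ∀ u v, symp (S *ᵥ u) (S *ᵥ v) = symp u v) (p q : Heis n) :
    sympAut S (p * q) = sympAut S p * sympAut S q := by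
  apply heis_ext <;> simp [hS, Matrix.mulVec_add]

theorem heisDist_sympAut_le {S : Matrix (HIdx n) (HIdx n) ℝ}
    (hS : ∀ u v, symp (S *ᵥ u) (S *ᵥ v) = symp u v) (T : Matrix (HIdx n) (HIdx n) ℝ) (ρ : ℝ)
    (p q : Heis n) : heisDist (blockFrame (S * T) ρ) (sympAut S p) (sympAut S q)
      ≤ heisDist (blockFrame T ρ) p q := by
  let L : HeisLie n →ₗ[ℝ] HeisLie n :=
    { toFun := fun u => (sympAut S ⟨u⟩).log
      map_add' := fun u v => by apply lie_ext <;> simp [Matrix.mulVec_add]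
      map_smul' := fun s v => by apply lie_ext <;> simp [Matrix.mulVec_smul] }
  have hL : ∀ p : Heis n, sympAut S p = ⟨L p.log + 0⟩ := fun p => by rw [add_zero]; rfl
  rw [hL, hL]
  refine heisDist_affine_le_of_eq L 0 (fun p U => ?_) p q
  have h1 := isWeakCanonical_blockFrame T ρ
  have h2 := isWeakCanonical_blockFrame (S * T) ρ
  apply lie_ext
  · rw [hor_leftDiff, hor_mulVec_of_isWeakCanonical h2, tildeBlock_blockFrame,
      ← Matrix.mulVec_mulVec]
    change S *ᵥ hor (leftDiff p _) = _
    rw [hor_leftDiff, hor_mulVec_of_isWeakCanonical h1, tildeBlock_blockFrame]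
  · rw [ver_leftDiff, hor_mulVec_of_isWeakCanonical h2, ver_mulVec_of_isWeakCanonical h2,
      tildeBlock_blockFrame, ← Matrix.mulVec_mulVec, add_zero]
    change ver (leftDiff p _) = _ + 1 / 2 * symp (S *ᵥ hor p) _
    rw [ver_leftDiff, hor_mulVec_of_isWeakCanonical h1, ver_mulVec_of_isWeakCanonical h1, hS,
      tildeBlock_blockFrame, rhoEntry_blockFrame, rhoEntry_blockFrame]

/-- Symplectic automorphisms of the horizontal lattice do not change the isometry class. -/
theorem moduliClass_sympAut {S S' : Matrix (HIdx n) (HIdx n) ℝ} (hSS' : S * S' = 1)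
    (hS : ∀ u v, symp (S *ᵥ u) (S *ᵥ v) = symp u v)
    (hΛ : ∀ v ∈ horLattice r, S *ᵥ v ∈ horLattice r)
    (hΛ' : ∀ v ∈ horLattice r, S' *ᵥ v ∈ horLattice r) (hr : ∀ i, 0 < r i)
    {A B : frames n} {T : Matrix (HIdx n) (HIdx n) ℝ} {ρ : ℝ} (hA : A.1 = blockFrame T ρ)
    (hB : B.1 = blockFrame (S * T) ρ) : moduliClass r A = moduliClass r B := by
  have hS'S : S' * S = 1 := mul_eq_one_comm.1 hSS'
  have hinv : ∀ v, S *ᵥ (S' *ᵥ v) = v := fun v => by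
    rw [Matrix.mulVec_mulVec, hSS', Matrix.one_mulVec]
  have hinv' : ∀ v, S' *ᵥ (S *ᵥ v) = v := fun v => by
    rw [Matrix.mulVec_mulVec, hS'S, Matrix.one_mulVec]
  have hS' : ∀ u v, symp (S' *ᵥ u) (S' *ᵥ v) = symp u v := fun u v => by
    rw [← hS, hinv, hinv]
  -- choose an inner automorphism which corrects the vertical coordinates of the basis
  obtain ⟨w, hw⟩ : ∃ w : HIdx n → ℝ, ∀ i, symp w (S *ᵥ Pi.single i (latScale r i))
      = halfForm (S *ᵥ Pi.single i (latScale r i)) - halfForm (Pi.single i (latScale r i)) := by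
    let c : HIdx n → ℝ := fun i =>
      halfForm (S *ᵥ Pi.single i (latScale r i)) - halfForm (Pi.single i (latScale r i))
    obtain ⟨w, hw⟩ := exists_symp_eq_dotProduct (-(S'ᵀ *ᵥ fun i => c i / latScale r i))
    refine ⟨w, fun i => ?_⟩
    rw [symp_swap, hw, neg_dotProduct, neg_neg, dotProduct_mulVec_transpose, hinv',
      dotProduct_single, div_mul_cancel₀ _ (latScale_pos hr i).ne']
  -- the correction is additive modulo integers
  have hint : ∀ v ∈ horLattice r,
      halfForm v - halfForm (S *ᵥ v) + symp w (S *ᵥ v) ∈ intReal := by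
    let H : AddSubgroup (HIdx n → ℝ) :=
      { carrier := {v | v ∈ horLattice r ∧
          halfForm v - halfForm (S *ᵥ v) + symp w (S *ᵥ v) ∈ intReal}
        add_mem' := by
          rintro u v ⟨hu, hu'⟩ ⟨hv, hv'⟩
          refine ⟨add_mem hu hv, ?_⟩
          rw [Matrix.mulVec_add, halfForm_add, halfForm_add, hS, symp_add_right']
          have h1 : ∑ i : Fin n, u (Sum.inr i) * v (Sum.inl i) ∈ intReal :=
            sum_mem fun _ _ => mul_mem_intReal (coord_mem_intReal hu _) (coord_mem_intReal hv _)
          have h2 : ∑ i : Fin n, (S *ᵥ u) (Sum.inr i) * (S *ᵥ v) (Sum.inl i) ∈ intReal :=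
            sum_mem fun _ _ => mul_mem_intReal (coord_mem_intReal (hΛ u hu) _)
              (coord_mem_intReal (hΛ v hv) _)
          have := add_mem (add_mem hu' hv') (sub_mem h1 h2)
          convert this using 1
          ring
        zero_mem' := by
          refine ⟨zero_mem _, ?_⟩
          simp [halfForm_zero]
        neg_mem' := by
          rintro v ⟨hv, hv'⟩
          refine ⟨neg_mem hv, ?_⟩
          rw [Matrix.mulVec_neg, halfForm_neg, halfForm_neg, symp_neg_right]
          have h1 : ∑ i : Fin n, v (Sum.inl i) * v (Sum.inr i) ∈ intReal :=
            sum_mem fun _ _ => mul_mem_intReal (coord_mem_intReal hv _) (coord_mem_intReal hv _)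
          have h2 : ∑ i : Fin n, (S *ᵥ v) (Sum.inl i) * (S *ᵥ v) (Sum.inr i) ∈ intReal :=
            sum_mem fun _ _ => mul_mem_intReal (coord_mem_intReal (hΛ v hv) _)
              (coord_mem_intReal (hΛ v hv) _)
          rw [← two_mul_halfForm] at h1 h2
          have := add_mem (neg_mem hv') (sub_mem h1 h2)
          convert this using 1
          ring }
    have hs : ∀ i : HIdx n, (Pi.single i (latScale r i) : HIdx n → ℝ) ∈ H := by
      intro i
      refine ⟨fun j => ?_, ?_⟩
      · by_cases hj : j = i
        · subst hj; simp
        · rw [Pi.single_eq_of_ne hj]; exact zero_mem _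
      · rw [hw]
        have : ∀ x y : ℝ, x - y + (y - x) = 0 := fun x y => by ring
        rw [this]; exact zero_mem _
    intro v hv
    obtain ⟨x, rfl⟩ := mem_horLattice_iff_exists.1 hv
    have : (fun i => latScale r i * x i)
        = ∑ i, x i • (Pi.single i (latScale r i) : HIdx n → ℝ) := by
      funext j
      rw [Finset.sum_apply, Finset.sum_eq_single j]
      · simp [mul_comm]
      · intro b _ hb; simp [Pi.single_eq_of_ne hb.symm]
      · simp
    have hmem : (fun i => latScale r i * (x i : ℝ)) ∈ H := by
      rw [this]; exact H.sum_mem fun i _ => H.zsmul_mem (hs i) _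
    exact hmem.2
  let g : Heis n := ⟨horVec w⟩
  -- Conjugation by g shifts the vertical coordinate by symp w (S hor p), exactly the defect of
  -- `halfForm` under S modulo integers.
  have hconj : ∀ p : Heis n, p ∈ heisLattice r ↔ g * sympAut S p * g⁻¹ ∈ heisLattice r := by
    intro p
    have hh : hor (g * sympAut S p * g⁻¹).log = S *ᵥ hor p.log := by
      simp [g]
    have hv : ver (g * sympAut S p * g⁻¹).log = ver p.log + symp w (S *ᵥ hor p.log) := by
      simp [g, symp_swap (S *ᵥ hor p.log) w]; ring
    rw [mem_heisLattice, mem_heisLattice, hh, hv]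
    constructor
    · rintro ⟨h1, h2⟩
      refine ⟨hΛ _ h1, ?_⟩
      have := add_mem h2 (hint _ h1)
      convert this using 1
      ring
    · rintro ⟨h1, h2⟩
      have h3 : hor p.log ∈ horLattice r := by
        have := hΛ' _ h1
        rwa [hinv'] at this
      refine ⟨h3, ?_⟩
      have := sub_mem h2 (hint _ h3)
      convert this using 1
      ring
  -- Only the left translation by g is applied, since it is an isometry; the conjugate by g appears
  -- in the equivariance instead.
  let F : Heis n ≃ Heis n :=
    { toFun := fun p => g * sympAut S p
      invFun := fun p => sympAut S' (g⁻¹ * p)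
      left_inv := fun p => by
        change sympAut S' (g⁻¹ * (g * sympAut S p)) = p
        rw [inv_mul_cancel_left]
        apply heis_ext
        · rw [hor_sympAut, hor_sympAut, hinv']
        · rfl
      right_inv := fun p => by
        have : sympAut S (sympAut S' (g⁻¹ * p)) = g⁻¹ * p := by
          apply heis_ext
          · rw [hor_sympAut, hor_sympAut, hinv]
          · rfl
        change g * sympAut S (sympAut S' (g⁻¹ * p)) = p
        rw [this, mul_inv_cancel_left] }
  have hFeq : ∀ h p, F (h * p) = (g * sympAut S h * g⁻¹) * F p := by
    intro h p
    change g * sympAut S (h * p) = (g * sympAut S h * g⁻¹) * (g * sympAut S p)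
    rw [sympAut_mul hS]; group
  refine moduliClass_eq_of_equiv F (fun p q => ?_) (fun h hh p => ⟨_, (hconj h).1 hh, hFeq h p⟩)
    (fun h hh p => ?_)
  · change heisDist B.1 (g * sympAut S p) (g * sympAut S q) = _
    rw [heisDist_mul_left, hA, hB]
    refine le_antisymm (heisDist_sympAut_le hS T ρ p q) ?_
    have := heisDist_sympAut_le hS' (S * T) ρ (sympAut S p) (sympAut S q)
    have e : ∀ p : Heis n, sympAut S' (sympAut S p) = p := fun p => by
      apply heis_ext
      · rw [hor_sympAut, hor_sympAut, hinv']
      · rfl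
    rwa [← Matrix.mul_assoc, hS'S, Matrix.one_mul, e, e] at this
  · obtain ⟨k, hk⟩ : ∃ k, g * sympAut S k * g⁻¹ = h := by
      refine ⟨F.symm (h * g), ?_⟩
      change F (F.symm (h * g)) * g⁻¹ = h
      rw [F.apply_symm_apply]; group
    refine ⟨k, (hconj k).2 (by rwa [hk]), ?_⟩
    rw [Equiv.symm_apply_eq, hFeq, hk, F.apply_symm_apply]

end Isometries

/-! ### Reduction of positive definite quadratic forms -/

section Reduction

variable {ι κ : Type*} [Fintype ι] [Fintype κ]

/-- The value of a real quadratic form at an integral vector. -/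
def intVal (Q : Matrix ι ι ℝ) (x : ι → ℤ) : ℝ :=
  (fun i => (x i : ℝ)) ⬝ᵥ (Q *ᵥ fun i => (x i : ℝ))

theorem intVal_submatrix (e : ι ≃ κ) (Q : Matrix κ κ ℝ) (x : ι → ℤ) :
    intVal (Q.submatrix e e) x = intVal Q (x ∘ e.symm) := by
  have h : (fun i => ((x ∘ e.symm) i : ℝ)) = (fun i => (x i : ℝ)) ∘ e.symm := rfl
  rw [intVal, intVal, Matrix.submatrix_mulVec_equiv, h, ← comp_equiv_symm_dotProduct]

theorem intVal_transpose_mul_mul (Q : Matrix ι ι ℝ) (γ : Matrix ι ι ℤ) (x : ι → ℤ) :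
    intVal ((γ.map (Int.cast : ℤ → ℝ))ᵀ * Q * γ.map (Int.cast : ℤ → ℝ)) x
      = intVal Q (γ *ᵥ x) := by
  have h : (fun i => ((γ *ᵥ x) i : ℝ)) = γ.map (Int.cast : ℤ → ℝ) *ᵥ fun i => (x i : ℝ) := by
    funext i
    simp [Matrix.mulVec, dotProduct]
  rw [intVal, intVal, h, ← Matrix.mulVec_mulVec, ← Matrix.mulVec_mulVec, dotProduct_comm,
    dotProduct_mulVec_transpose, dotProduct_comm]

/-- The symmetric matrix obtained by adding a first row and column. -/
def bordered (a : ℝ) (b : κ → ℝ) (Q : Matrix κ κ ℝ) : Matrix (Unit ⊕ κ) (Unit ⊕ κ) ℝ :=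
  Matrix.fromBlocks (Matrix.of fun _ _ => a) (Matrix.of fun _ j => b j)
    (Matrix.of fun i _ => b i) Q

/-- The Schur complement of the first entry. -/
noncomputable def schurCompl (a : ℝ) (b : κ → ℝ) (Q : Matrix κ κ ℝ) : Matrix κ κ ℝ :=
  Q - Matrix.of fun i j => a⁻¹ * b i * b j

/-- Completing the square in the first variable. -/
theorem dotProduct_bordered {a : ℝ} (ha : a ≠ 0) (b : κ → ℝ) (Q : Matrix κ κ ℝ) (t : ℝ)
    (y : κ → ℝ) :
    Sum.elim (fun _ => t) y ⬝ᵥ (bordered a b Q *ᵥ Sum.elim (fun _ => t) y)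
      = a * (t + a⁻¹ * (b ⬝ᵥ y)) ^ 2 + y ⬝ᵥ (schurCompl a b Q *ᵥ y) := by
  have h1 : (Matrix.of fun i j => a⁻¹ * b i * b j) *ᵥ y = (a⁻¹ * (b ⬝ᵥ y)) • b := by
    funext i
    simp only [Matrix.mulVec, dotProduct, Matrix.of_apply, Pi.smul_apply, smul_eq_mul,
      Finset.mul_sum, Finset.sum_mul]
    exact Finset.sum_congr rfl fun j _ => by ring
  have h2 : (Matrix.of fun i (_ : Unit) => b i) *ᵥ (fun _ => t) = t • b := by
    funext i; simp [Matrix.mulVec, dotProduct, mul_comm]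
  have h3 : (fun _ : Unit => t) ⬝ᵥ ((Matrix.of fun (_ : Unit) (_ : Unit) => a) *ᵥ fun _ => t)
      = a * t ^ 2 := by
    simp [Matrix.mulVec, dotProduct]; ring
  have h4 : (fun _ : Unit => t) ⬝ᵥ ((Matrix.of fun (_ : Unit) j => b j) *ᵥ y) = t * (b ⬝ᵥ y) := by
    simp [Matrix.mulVec, dotProduct]
  rw [bordered, schurCompl, Matrix.fromBlocks_mulVec, Matrix.sub_mulVec, h1, Sum.elim_comp_inl,
    Sum.elim_comp_inr, h2, sumElim_dotProduct_sumElim, dotProduct_sub, dotProduct_add,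
    dotProduct_add, dotProduct_smul, dotProduct_smul, dotProduct_comm y b, h3, h4, smul_eq_mul,
    smul_eq_mul]
  field_simp
  ring

theorem intVal_bordered {a : ℝ} (ha : a ≠ 0) (b : κ → ℝ) (Q : Matrix κ κ ℝ) (t : ℤ) (y : κ → ℤ) :
    intVal (bordered a b Q) (Sum.elim (fun _ => t) y)
      = a * (t + a⁻¹ * (b ⬝ᵥ fun i => (y i : ℝ))) ^ 2 + intVal (schurCompl a b Q) y := by
  have h : (fun i => ((Sum.elim (fun _ : Unit => t) y i : ℤ) : ℝ))
      = Sum.elim (fun _ => (t : ℝ)) (fun i => (y i : ℝ)) := by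
    funext i; rcases i with i | i <;> rfl
  rw [intVal, h, dotProduct_bordered ha, intVal]

/-- The Schur complement at y is the minimum of the form over the first variable, so it inherits
positive definiteness. -/
theorem exists_eq_bordered {Q : Matrix (Unit ⊕ κ) (Unit ⊕ κ) ℝ} (hQ : Q.PosDef) :
    ∃ a b Q', Q = bordered a b Q' ∧ 0 < a ∧ (schurCompl a b Q').PosDef := by
  have hs : ∀ i j, Q i j = Q j i := fun i j => by simpa using (hQ.1.apply i j).symm
  have ha : 0 < Q (Sum.inl ()) (Sum.inl ()) := hQ.diag_pos
  have hb : Q = bordered (Q (Sum.inl ()) (Sum.inl ())) (fun j => Q (Sum.inl ()) (Sum.inr j))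
      Q.toBlocks₂₂ := by
    ext i j
    rcases i with i | i <;> rcases j with j | j
    · rfl
    · rfl
    · exact hs _ _
    · rfl
  refine ⟨_, _, _, hb, ha, Matrix.PosDef.of_dotProduct_mulVec_pos ?_ fun y hy => ?_⟩
  · ext i j
    simp only [schurCompl, Matrix.conjTranspose_apply, Matrix.sub_apply, Matrix.of_apply,
      star_trivial, Matrix.toBlocks₂₂, hs (Sum.inr j) (Sum.inr i)]
    ring
  · set a := Q (Sum.inl ()) (Sum.inl ())
    set b : κ → ℝ := fun j => Q (Sum.inl ()) (Sum.inr j)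
    have h0 : Sum.elim (fun _ : Unit => -(a⁻¹ * (b ⬝ᵥ y))) y ≠ 0 := fun h =>
      hy (funext fun i => congrFun h (Sum.inr i))
    have h1 := hQ.dotProduct_mulVec_pos h0
    rw [hb, star_trivial, dotProduct_bordered ha.ne'] at h1
    simpa using h1

/-- The values at integral vectors with prescribed last coordinates come close to those of the
Schur complement. -/
theorem exists_intVal_bordered_le {a : ℝ} (ha : 0 < a) (b : κ → ℝ) (Q : Matrix κ κ ℝ)
    (y : κ → ℤ) : ∃ t : ℤ, intVal (bordered a b Q) (Sum.elim (fun _ => t) y)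
      ≤ a / 4 + intVal (schurCompl a b Q) y := by
  let z := a⁻¹ * (b ⬝ᵥ fun i => (y i : ℝ))
  -- Rounding makes the completed square at most 1/4.
  refine ⟨-round z, ?_⟩
  rw [intVal_bordered ha.ne']
  have h1 := abs_sub_round z
  have h2 : ((-round z : ℤ) + z) ^ 2 ≤ 1 / 4 := by
    push_cast
    have := sq_le_sq' (neg_le_of_abs_le h1) (le_of_abs_le h1)
    nlinarith
  have := mul_le_mul_of_nonneg_left h2 ha.le
  change a * ((-round z : ℤ) + z) ^ 2 + _ ≤ _
  linarith

variable [DecidableEq ι] [DecidableEq κ]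

/-- Members of some integral basis. -/
def IsBasisVec (x : ι → ℤ) : Prop :=
  ∃ γ γ' : Matrix ι ι ℤ, γ * γ' = 1 ∧ ∃ j, γ.col j = x

/-- A positive definite form whose values on the members of integral bases are bounded below has
determinant bounded below; when its determinant is bounded above, it has bounded values on some
integral basis. -/
def HasReduction (ι : Type*) [Fintype ι] [DecidableEq ι] : Prop :=
  ∀ c : ℝ, 0 < c → ∀ V : ℝ, ∃ C v : ℝ, 0 < v ∧ ∀ Q : Matrix ι ι ℝ, Q.PosDef →
    (∀ x : ι → ℤ, IsBasisVec x → c ≤ intVal Q x) →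
    v ≤ Q.det ∧ (Q.det ≤ V → ∃ γ γ' : Matrix ι ι ℤ, γ * γ' = 1 ∧ ∀ j, intVal Q (γ.col j) ≤ C)

theorem IsBasisVec.comp_equiv (e : ι ≃ κ) {x : ι → ℤ} (hx : IsBasisVec x) :
    IsBasisVec (x ∘ e.symm) := by
  obtain ⟨γ, γ', h, j, rfl⟩ := hx
  refine ⟨γ.submatrix e.symm e.symm, γ'.submatrix e.symm e.symm, ?_, e j, ?_⟩
  · rw [Matrix.submatrix_mul_equiv, h, Matrix.submatrix_one_equiv]
  · funext i; simp [Matrix.col]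

theorem HasReduction.of_equiv (e : ι ≃ κ) (h : HasReduction ι) : HasReduction κ := by
  intro c hc V
  obtain ⟨C, v, hv, H⟩ := h c hc V
  refine ⟨C, v, hv, fun Q hQ hmin => ?_⟩
  obtain ⟨h1, h2⟩ := H (Q.submatrix e e) (hQ.submatrix e.injective) fun x hx => by
    rw [intVal_submatrix]; exact hmin _ (hx.comp_equiv e)
  rw [Matrix.det_submatrix_equiv_self] at h1 h2
  refine ⟨h1, fun hV => ?_⟩
  obtain ⟨γ, γ', hγ, hC⟩ := h2 hV
  refine ⟨γ.submatrix e.symm e.symm, γ'.submatrix e.symm e.symm, ?_, fun j => ?_⟩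
  · rw [Matrix.submatrix_mul_equiv, hγ, Matrix.submatrix_one_equiv]
  · have := hC (e.symm j)
    rw [intVal_submatrix] at this
    exact this

theorem IsBasisVec.mulVec {γ γ' : Matrix ι ι ℤ} (h : γ * γ' = 1) {x : ι → ℤ}
    (hx : IsBasisVec x) : IsBasisVec (γ *ᵥ x) := by
  obtain ⟨δ, δ', hδ, j, rfl⟩ := hx
  refine ⟨γ * δ, δ' * γ', ?_, j, ?_⟩
  · rw [Matrix.mul_assoc, ← Matrix.mul_assoc δ, hδ, Matrix.one_mul, h]
  · funext i; simp [Matrix.col, Matrix.mul_apply, Matrix.mulVec, dotProduct]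

theorem map_intCast_mul_eq_one {γ γ' : Matrix ι ι ℤ} (h : γ * γ' = 1) :
    γ.map (Int.cast : ℤ → ℝ) * γ'.map (Int.cast : ℤ → ℝ) = 1 := by
  have := congrArg (fun M : Matrix ι ι ℤ => M.map (Int.castRingHom ℝ)) h
  rw [Matrix.map_mul, Matrix.map_one _ (map_zero _) (map_one _)] at this
  exact this

theorem det_map_intCast_sq {γ γ' : Matrix ι ι ℤ} (h : γ * γ' = 1) :
    (γ.map (Int.cast : ℤ → ℝ)).det ^ 2 = 1 := by
  have h1 : IsUnit γ.det := (Matrix.isUnit_iff_isUnit_det _).1 (IsUnit.of_mul_eq_one _ h)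
  have h2 : (γ.map (Int.cast : ℤ → ℝ)).det = (γ.det : ℝ) := (Int.cast_det γ).symm
  rw [h2]
  rcases Int.isUnit_iff.1 h1 with h3 | h3 <;> simp [h3]

theorem det_bordered {a : ℝ} (ha : a ≠ 0) (b : κ → ℝ) (Q : Matrix κ κ ℝ) :
    (bordered a b Q).det = a * (schurCompl a b Q).det := by
  let _ : Invertible (Matrix.of fun _ _ : Unit => a) :=
    ⟨Matrix.of fun _ _ => a⁻¹, by ext i j; simp [Matrix.mul_apply, ha],
      by ext i j; simp [Matrix.mul_apply, ha]⟩
  have h : ⅟(Matrix.of fun _ _ : Unit => a) = Matrix.of fun _ _ => a⁻¹ := rfl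
  rw [bordered, Matrix.det_fromBlocks₁₁, h, Matrix.det_unique, schurCompl]
  congr 3
  ext i j
  simp only [Matrix.mul_apply, Matrix.of_apply, Finset.univ_unique, Finset.sum_singleton]
  ring

/-- An integral basis in the last coordinates, lifted arbitrarily, together with the first unit
vector is again an integral basis. -/
theorem fromBlocks_row_mul {γ γ' : Matrix κ κ ℤ} (h : γ * γ' = 1) (t : Matrix Unit κ ℤ) :
    Matrix.fromBlocks (1 : Matrix Unit Unit ℤ) t 0 γ *
      Matrix.fromBlocks (1 : Matrix Unit Unit ℤ) (-(t * γ')) 0 γ' = 1 := by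
  rw [Matrix.fromBlocks_multiply, ← Matrix.fromBlocks_one]
  simp [h]

theorem col_fromBlocks_row {κ : Type*} (γ : Matrix κ κ ℤ) (t : Matrix Unit κ ℤ) (j : κ) :
    (Matrix.fromBlocks (1 : Matrix Unit Unit ℤ) t 0 γ).col (Sum.inr j)
      = Sum.elim (fun _ => t () j) (γ.col j) := by
  funext i; rcases i with i | i <;> rfl

theorem IsBasisVec.elim {y : κ → ℤ} (hy : IsBasisVec y) (t : ℤ) :
    IsBasisVec (Sum.elim (fun _ : Unit => t) y) := by
  obtain ⟨γ, γ', h, j, rfl⟩ := hy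
  exact ⟨_, _, fromBlocks_row_mul h (Matrix.of fun _ _ => t), Sum.inr j, col_fromBlocks_row _ _ _⟩

/-- A vector within a factor 2 of the infimum is enough for the reduction, so attainment of the
minimum is not needed. -/
theorem exists_intVal_le_two_mul [Nonempty ι] {Q : Matrix ι ι ℝ} {c : ℝ} (hc : 0 < c)
    (h : ∀ x : ι → ℤ, IsBasisVec x → c ≤ intVal Q x) :
    ∃ x, IsBasisVec x ∧ ∀ y, IsBasisVec y → intVal Q x ≤ 2 * intVal Q y := by
  let s : Set ℝ := intVal Q '' {x | IsBasisVec x}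
  have hne : s.Nonempty :=
    ⟨_, _, ⟨1, 1, one_mul 1, Classical.arbitrary ι, rfl⟩, rfl⟩
  have hb : ∀ z ∈ s, c ≤ z := by
    rintro _ ⟨x, hx, rfl⟩; exact h x hx
  have hpos : 0 < sInf s := hc.trans_le (le_csInf hne hb)
  obtain ⟨_, ⟨x, hx, rfl⟩, hlt⟩ := exists_lt_of_csInf_lt hne (by linarith : sInf s < 2 * sInf s)
  refine ⟨x, hx, fun y hy => hlt.le.trans ?_⟩
  have := csInf_le ⟨c, hb⟩ ⟨y, hy, rfl⟩
  linarith

/-- Hermite's argument. Put a nearly minimal basis vector, of value a, in first place and reduce the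
Schur complement. Requiring lower bounds only on members of integral bases suits the induction,
because such vectors lift to such vectors. -/
theorem HasReduction.unit_sum (h : HasReduction κ) : HasReduction (Unit ⊕ κ) := by
  intro c hc V
  -- The complement has values at least a/4 ≥ c/4 on basis vectors, and determinant at most V/c
  -- because det Q = a · det S with a ≥ c.
  obtain ⟨C, v, hv, H⟩ := h (c / 4) (by positivity) (V / c)
  refine ⟨V / v + |C|, c * v, by positivity, fun Q hQ hmin => ?_⟩
  obtain ⟨_, ⟨γ₀, γ₀', hγ₀, j₀, rfl⟩, hx⟩ := exists_intVal_le_two_mul hc hmin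
  -- move the nearly minimal vector to the first place
  obtain ⟨γ, γ', hγ, hcol⟩ : ∃ γ γ' : Matrix (Unit ⊕ κ) (Unit ⊕ κ) ℤ, γ * γ' = 1 ∧
      γ.col (Sum.inl ()) = γ₀.col j₀ := by
    let e := Equiv.swap (Sum.inl ()) j₀
    refine ⟨γ₀.submatrix id e, γ₀'.submatrix e id, ?_, ?_⟩
    · rw [Matrix.submatrix_mul_equiv, hγ₀, Matrix.submatrix_id_id]
    · funext i; simp [Matrix.col, e]
  set R : Matrix (Unit ⊕ κ) (Unit ⊕ κ) ℝ :=
    (γ.map (Int.cast : ℤ → ℝ))ᵀ * Q * γ.map (Int.cast : ℤ → ℝ) with hR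
  have hval : ∀ x, intVal R x = intVal Q (γ *ᵥ x) := intVal_transpose_mul_mul Q γ
  have hdet : R.det = Q.det := by
    rw [hR, Matrix.det_mul, Matrix.det_mul, Matrix.det_transpose]
    linear_combination Q.det * det_map_intCast_sq hγ
  have hRpos : R.PosDef := by
    have := hQ.conjTranspose_mul_mul_same (B := γ.map (Int.cast : ℤ → ℝ))
      (Matrix.mulVec_injective_of_isUnit (IsUnit.of_mul_eq_one _ (map_intCast_mul_eq_one hγ)))
    rwa [Matrix.conjTranspose_eq_transpose_of_trivial] at this
  obtain ⟨a, b, Q', hRb, ha, hS⟩ := exists_eq_bordered hRpos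
  have hfirst : intVal Q (γ₀.col j₀) = a := by
    have h1 : γ *ᵥ Sum.elim (fun _ => 1) 0 = γ₀.col j₀ := by
      rw [← hcol]
      funext i
      simp [Matrix.mulVec, dotProduct, Fintype.sum_sum_type, Matrix.col]
    rw [← h1, ← hval, hRb, intVal_bordered ha.ne']
    simp [intVal]
  rw [hfirst] at hx
  have hca : c ≤ a := hfirst ▸ hmin _ ⟨γ₀, γ₀', hγ₀, j₀, rfl⟩
  -- Some lift of y has value at most a/4 + S(y), and near minimality makes this at least a/2.
  have hSmin : ∀ y : κ → ℤ, IsBasisVec y → c / 4 ≤ intVal (schurCompl a b Q') y := by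
    intro y hy
    obtain ⟨t, ht⟩ := exists_intVal_bordered_le ha b Q' y
    have := hx _ ((hy.elim t).mulVec hγ)
    rw [← hval, hRb] at this
    linarith
  obtain ⟨h1, h2⟩ := H _ hS hSmin
  have hdet' : Q.det = a * (schurCompl a b Q').det := by rw [← hdet, hRb, det_bordered ha.ne']
  have hSdet : 0 < (schurCompl a b Q').det := hv.trans_le h1
  refine ⟨by rw [hdet']; gcongr, fun hV => ?_⟩
  rw [hdet'] at hV
  have hVS : (schurCompl a b Q').det ≤ V / c := by
    rw [le_div_iff₀ hc]
    nlinarith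
  -- The lower bound of the smaller determinant turns the upper bound V into one for a.
  have haV : a ≤ V / v := by
    rw [le_div_iff₀ hv]
    nlinarith
  obtain ⟨δ, δ', hδ, hC⟩ := h2 hVS
  -- Each reduced basis vector of the complement is lifted at a cost of at most a/4.
  choose t ht using fun j => exists_intVal_bordered_le ha b Q' (δ.col j)
  have hε := fromBlocks_row_mul hδ (Matrix.of fun _ j => t j)
  set ε := Matrix.fromBlocks (1 : Matrix Unit Unit ℤ) (Matrix.of fun _ j => t j) 0 δ
  refine ⟨γ * ε, _ * γ', (by
    rw [Matrix.mul_assoc, ← Matrix.mul_assoc ε, hε, Matrix.one_mul, hγ]), fun j => ?_⟩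
  · have h3 : (γ * ε).col j = γ *ᵥ ε.col j := by
      funext i; simp [Matrix.col, Matrix.mul_apply, Matrix.mulVec, dotProduct]
    rw [h3]
    rcases j with j | j
    · have h4 : ε.col (Sum.inl ()) = Sum.elim (fun _ => 1) 0 := by
        funext i; rcases i with i | i <;> rfl
      rw [h4, ← hval, hRb, intVal_bordered ha.ne']
      simp [intVal]
      linarith [abs_nonneg C]
    · rw [← hval, col_fromBlocks_row, hRb]
      refine (ht j).trans ?_
      linarith [hC j, le_abs_self C]

theorem hasReduction (ι : Type*) [Fintype ι] [DecidableEq ι] : HasReduction ι := by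
  suffices ∀ N, HasReduction (Fin N) from (this _).of_equiv (Fintype.equivFin ι).symm
  intro N
  induction N with
  | zero =>
    intro c _ V
    refine ⟨0, 1, one_pos, fun Q _ _ => ⟨by simp, fun _ => ⟨1, 1, one_mul 1, fun j => j.elim0⟩⟩⟩
  | succ N ih =>
    refine HasReduction.of_equiv ?_ ih.unit_sum
    exact ((Equiv.sumComm _ _).trans
      (Equiv.sumCongr (Equiv.refl _) finOneEquiv.symm)).trans finSumFinEquiv

/-- A lattice without short vectors, given by a basis, has covolume bounded below; when its
covolume is bounded above, it has a bounded basis. -/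
theorem exists_reduced_basis (ι : Type*) [Fintype ι] [DecidableEq ι] {c : ℝ} (hc : 0 < c) (V : ℝ) :
    ∃ C v : ℝ, 0 < v ∧ ∀ W : Matrix ι ι ℝ, IsUnit W.det →
      (∀ x : ι → ℤ, x ≠ 0 → c ≤ eLen (W *ᵥ fun i => (x i : ℝ))) →
      v ≤ |W.det| ∧ (|W.det| ≤ V → ∃ γ γ' : Matrix ι ι ℤ, γ * γ' = 1 ∧
        ∀ i j, |(W * γ.map (Int.cast : ℤ → ℝ)) i j| ≤ C) := by
  -- The reduction is applied to the Gram matrix WᵀW, whose values are squared lengths and whose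
  -- determinant is the squared covolume.
  obtain ⟨C, v, hv, H⟩ := hasReduction ι (c ^ 2) (by positivity) (V ^ 2)
  refine ⟨√C, √v, Real.sqrt_pos.2 hv, fun W hW hmin => ?_⟩
  have hval : ∀ x : ι → ℤ, intVal (Wᵀ * W) x = eLen (W *ᵥ fun i => (x i : ℝ)) ^ 2 := by
    intro x
    rw [intVal, ← Matrix.mulVec_mulVec, dotProduct_comm, dotProduct_mulVec_transpose,
      eLen_sq_dotProduct]
  have hdet : (Wᵀ * W).det = |W.det| ^ 2 := by
    rw [Matrix.det_mul, Matrix.det_transpose, sq_abs, sq]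
  have hpos : (Wᵀ * W).PosDef := by
    have := Matrix.PosDef.conjTranspose_mul_self W
      (Matrix.mulVec_injective_of_isUnit ((Matrix.isUnit_iff_isUnit_det W).2 hW))
    rwa [Matrix.conjTranspose_eq_transpose_of_trivial] at this
  obtain ⟨h1, h2⟩ := H _ hpos fun x hx => by
    obtain ⟨γ, γ', hγ, j, rfl⟩ := hx
    rw [hval]
    refine pow_le_pow_left₀ hc.le (hmin _ fun h0 => ?_) 2
    have : γ.det = 0 := Matrix.det_eq_zero_of_column_eq_zero j fun i => congrFun h0 i
    have h3 := congrArg Matrix.det hγ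
    rw [Matrix.det_mul, this, zero_mul, Matrix.det_one] at h3
    exact zero_ne_one h3
  rw [hdet] at h1 h2
  refine ⟨Real.sqrt_le_iff.2 ⟨abs_nonneg _, h1⟩, fun hV => ?_⟩
  obtain ⟨γ, γ', hγ, hC⟩ := h2 (pow_le_pow_left₀ (abs_nonneg _) hV 2)
  refine ⟨γ, γ', hγ, fun i j => (abs_le_eLen (fun k => (W * γ.map (Int.cast : ℤ → ℝ)) k j) i).trans
    (Real.le_sqrt_of_sq_le ?_)⟩
  have := hC j
  rw [hval] at this
  convert this using 3
  funext i
  simp [Matrix.mul_apply, Matrix.mulVec, dotProduct, Matrix.col]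

end Reduction

/-! ### The largest eigenvalue of `j_A` -/

section Eigenvalues

variable {n : ℕ} {A : Matrix (Idx n) (Idx n) ℝ}

theorem map_ofReal_mulVec {ι : Type*} [Fintype ι] (M : Matrix ι ι ℝ) (u v : ι → ℝ) :
    (M.map (fun x : ℝ => (x : ℂ))) *ᵥ (fun i => (u i : ℂ) + Complex.I * v i)
      = fun i => ((M *ᵥ u) i : ℂ) + Complex.I * (M *ᵥ v) i := by
  funext i
  simp only [Matrix.mulVec, dotProduct, Matrix.map_apply, Complex.ofReal_sum, Complex.ofReal_mul,
    Finset.mul_sum, ← Finset.sum_add_distrib]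
  exact Finset.sum_congr rfl fun j _ => by ring

/-- For an eigenvector x + iy one has j y = d x and j x = -d y. Pairing gives d(|x|² + |y|²) = 2
symp(y, x) in the norm of A, and the right side is at most 2C|x||y|. -/
theorem le_of_hasEigenvalue_jMatrix (hA : IsUnit (tildeBlock A).det) {C : ℝ}
    (hC : ∀ u v, |symp (tildeBlock A *ᵥ u) (tildeBlock A *ᵥ v)| ≤ C * (eLen u * eLen v)) {d : ℝ}
    (hd : Module.End.HasEigenvalue (Matrix.toLin' ((jMatrix A).map (fun x : ℝ => (x : ℂ))))
      (Complex.I * (d : ℂ))) (h0 : 0 ≤ C) : d ≤ C := by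
  obtain ⟨z, hz⟩ := hd.exists_hasEigenvector
  have h1 := hz.apply_eq_smul
  rw [Matrix.toLin'_apply] at h1
  set x : HIdx n → ℝ := fun i => (z i).re
  set y : HIdx n → ℝ := fun i => (z i).im
  have hzxy : z = fun i => (x i : ℂ) + Complex.I * y i := by
    funext i; rw [mul_comm]; exact (Complex.re_add_im _).symm
  rw [hzxy, map_ofReal_mulVec] at h1
  have hy : jMatrix A *ᵥ y = d • x := by
    funext i
    simpa using congrArg Complex.im (congrFun h1 i)
  have hx : jMatrix A *ᵥ x = -(d • y) := by
    funext i
    simpa using congrArg Complex.re (congrFun h1 i)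
  let N := (tildeBlock A)⁻¹
  have hN : ∀ u, tildeBlock A *ᵥ (N *ᵥ u) = u := fun u => by
    rw [Matrix.mulVec_mulVec, Matrix.mul_nonsing_inv _ hA, Matrix.one_mulVec]
  have e1 : symp y x = d * eLen (N *ᵥ x) ^ 2 := by
    rw [← horInner_jMatrix A hA, hy, horInner, Matrix.mulVec_smul, smul_dotProduct,
      eLen_sq_dotProduct, smul_eq_mul]
  have e2 : symp x y = -(d * eLen (N *ᵥ y) ^ 2) := by
    rw [← horInner_jMatrix A hA, hx, horInner, Matrix.mulVec_neg, Matrix.mulVec_smul,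
      neg_dotProduct, smul_dotProduct, eLen_sq_dotProduct, smul_eq_mul]
  have e3 : |symp y x| ≤ C * (eLen (N *ᵥ y) * eLen (N *ᵥ x)) := by
    have := hC (N *ᵥ y) (N *ᵥ x)
    rwa [hN, hN] at this
  have e4 : 0 < eLen (N *ᵥ x) ^ 2 + eLen (N *ᵥ y) ^ 2 := by
    by_contra hle
    have hx0 : eLen (N *ᵥ x) = 0 := by nlinarith [sq_nonneg (eLen (N *ᵥ x)), sq_nonneg (eLen (N *ᵥ y))]
    have hy0 : eLen (N *ᵥ y) = 0 := by nlinarith [sq_nonneg (eLen (N *ᵥ x)), sq_nonneg (eLen (N *ᵥ y))]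
    have hz' : ∀ u, eLen (N *ᵥ u) = 0 → u = 0 := fun u hu => by
      by_contra hne
      refine (eLen_pos (U := N *ᵥ u) fun h => hne ?_).ne' hu
      rw [← hN u, h, Matrix.mulVec_zero]
    refine hz.2 ?_
    rw [hzxy, hz' x hx0, hz' y hy0]
    funext i; simp
  have e5 := (abs_le.1 e3).2
  rw [symp_swap y x] at e1 e5
  by_contra! hlt
  have e6 := mul_nonneg h0 (sq_nonneg (eLen (N *ᵥ x) - eLen (N *ᵥ y)))
  have e7 := mul_pos (sub_pos.2 hlt) e4
  nlinarith

theorem dMax_le (hA : IsUnit (tildeBlock A).det) {C : ℝ} (h0 : 0 ≤ C)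
    (hC : ∀ u v, |symp (tildeBlock A *ᵥ u) (tildeBlock A *ᵥ v)| ≤ C * (eLen u * eLen v)) :
    dMax A ≤ C :=
  Real.sSup_le (fun _ hd => le_of_hasEigenvalue_jMatrix hA hC hd h0) h0

/-- A crude constant, which shows that the eigenvalue set is bounded above, so that `dMax` is a
genuine supremum. -/
theorem exists_abs_symp_mulVec_le (T : Matrix (HIdx n) (HIdx n) ℝ) :
    ∃ C, 0 ≤ C ∧ ∀ u v, |symp (T *ᵥ u) (T *ᵥ v)| ≤ C * (eLen u * eLen v) := by
  refine ⟨2 * n * (matSum T * matSum T), by have := matSum_nonneg T; positivity, fun u v => ?_⟩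
  have h1 := (norm_mulVec_le T u).trans
    (mul_le_mul_of_nonneg_left (norm_le_eLen u) (matSum_nonneg T))
  have h2 := (norm_mulVec_le T v).trans
    (mul_le_mul_of_nonneg_left (norm_le_eLen v) (matSum_nonneg T))
  calc |symp (T *ᵥ u) (T *ᵥ v)| ≤ 2 * n * ‖T *ᵥ u‖ * ‖T *ᵥ v‖ := abs_symp_le _ _
    _ ≤ 2 * n * (matSum T * eLen u) * (matSum T * eLen v) := by
      have := matSum_nonneg T
      have := eLen_nonneg u
      gcongr
    _ = _ := by ring

-- The pulled back form S = TᵀJT is skew, so iS is Hermitian. The relation j T = -T S turns each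
-- eigenvalue λ of iS into the eigenvalue iλ of j, so λ is at most `dMax` and `dMax` - iS is
-- positive semidefinite.
open scoped ComplexOrder in
theorem two_mul_symp_le (hA : IsUnit (tildeBlock A).det) (u v : HIdx n → ℝ) :
    2 * symp (tildeBlock A *ᵥ u) (tildeBlock A *ᵥ v) ≤ dMax A * (eLen u ^ 2 + eLen v ^ 2) := by
  set T := tildeBlock A with hT
  let S : Matrix (HIdx n) (HIdx n) ℝ := Tᵀ * sympMatrix n * T
  have hS : ∀ u v, u ⬝ᵥ (S *ᵥ v) = symp (T *ᵥ u) (T *ᵥ v) := fun u v => by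
    rw [← dotProduct_sympMatrix, ← Matrix.mulVec_mulVec, ← Matrix.mulVec_mulVec, dotProduct_comm,
      dotProduct_mulVec_transpose, dotProduct_comm]
  have hSt : Sᵀ = -S := by
    apply Matrix.ext_of_mulVec_single
    intro i
    refine dotProduct_eq _ _ fun w => ?_
    rw [dotProduct_mulVec_transpose, hS, Matrix.neg_mulVec, neg_dotProduct, dotProduct_comm, hS,
      symp_swap]
  let Sc : Matrix (HIdx n) (HIdx n) ℂ := S.map (fun x : ℝ => (x : ℂ))
  let M : Matrix (HIdx n) (HIdx n) ℂ := (dMax A : ℂ) • 1 - Complex.I • Sc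
  have hM : M.IsHermitian := by
    have h2 : Scᴴ = -Sc := by
      ext i j
      have := congrFun (congrFun hSt i) j
      simp only [Matrix.transpose_apply, Matrix.neg_apply] at this
      simp [Sc, Matrix.conjTranspose_apply, this]
    rw [Matrix.IsHermitian, Matrix.conjTranspose_sub, Matrix.conjTranspose_smul,
      Matrix.conjTranspose_smul, h2, Matrix.conjTranspose_one,
      Complex.star_def, Complex.conj_ofReal, Complex.conj_I, neg_smul_neg]
  obtain ⟨C', h0, hC'⟩ := exists_abs_symp_mulVec_le T
  have hbdd : BddAbove {d : ℝ | Module.End.HasEigenvalue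
      (Matrix.toLin' ((jMatrix A).map (fun x : ℝ => (x : ℂ)))) (Complex.I * (d : ℂ))} :=
    ⟨C', fun d hd => le_of_hasEigenvalue_jMatrix hA hC' hd h0⟩
  have hpos : M.PosSemidef := by
    rw [hM.posSemidef_iff_eigenvalues_nonneg]
    intro i
    change 0 ≤ hM.eigenvalues i
    set μ := hM.eigenvalues i
    have hz := hM.mulVec_eigenvectorBasis i
    set z : HIdx n → ℂ := ⇑(hM.eigenvectorBasis i)
    have hz0 : z ≠ 0 := fun h => by
      have := hM.eigenvectorBasis.orthonormal.ne_zero i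
      exact this (by ext j; exact congrFun h j)
    have hSz : Sc *ᵥ z = -((Complex.I * ((dMax A - μ : ℝ) : ℂ)) • z) := by
      have h3 : M *ᵥ z = (dMax A : ℂ) • z - Complex.I • (Sc *ᵥ z) := by
        simp only [M, Matrix.sub_mulVec, Matrix.smul_mulVec, Matrix.one_mulVec]
      have h4 := h3.symm.trans hz
      funext j
      have h5 := congrFun h4 j
      simp only [Pi.sub_apply, Pi.neg_apply, Pi.smul_apply, smul_eq_mul, Complex.real_smul,
        Complex.ofReal_sub] at h5 ⊢
      linear_combination Complex.I * h5 + (Sc *ᵥ z) j * Complex.I_mul_I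
    let Tc : Matrix (HIdx n) (HIdx n) ℂ := T.map (fun x : ℝ => (x : ℂ))
    have hJT : (jMatrix A).map (fun x : ℝ => (x : ℂ)) * Tc = -(Tc * Sc) := by
      have h6 : jMatrix A * T = -(T * S) := by
        rw [← mul_neg, ← hSt]
        simp only [S, jMatrix, Matrix.transpose_mul, Matrix.transpose_transpose, Matrix.mul_assoc,
          hT]
      have := congrArg (fun N : Matrix (HIdx n) (HIdx n) ℝ => N.map Complex.ofRealHom) h6
      simp only [Matrix.map_mul] at this
      refine this.trans ?_
      ext i j
      simp [Tc, Sc, Matrix.mul_apply]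
    have hTz : Tc *ᵥ z ≠ 0 := fun h => hz0 <| by
      have h7 := congrArg (fun N : Matrix (HIdx n) (HIdx n) ℝ => N.map Complex.ofRealHom)
        (Matrix.nonsing_inv_mul T hA)
      simp only [Matrix.map_mul] at h7
      rw [Matrix.map_one _ (map_zero _) (map_one _)] at h7
      rw [← Matrix.one_mulVec z, ← h7, ← Matrix.mulVec_mulVec]
      change _ *ᵥ (Tc *ᵥ z) = 0
      rw [h, Matrix.mulVec_zero]
    have heig : Module.End.HasEigenvalue (Matrix.toLin' ((jMatrix A).map (fun x : ℝ => (x : ℂ))))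
        (Complex.I * ((dMax A - μ : ℝ) : ℂ)) := by
      refine Module.End.hasEigenvalue_of_hasEigenvector
        ⟨Module.End.mem_eigenspace_iff.2 (?_ : _ = _ • (Tc *ᵥ z)), hTz⟩
      rw [Matrix.toLin'_apply, Matrix.mulVec_mulVec, hJT, Matrix.neg_mulVec,
        ← Matrix.mulVec_mulVec, hSz, Matrix.mulVec_neg, neg_neg, Matrix.mulVec_smul]
    have := le_csSup hbdd heig
    change dMax A - μ ≤ dMax A at this
    linarith
  -- The Hermitian form at v + iu has real part `dMax`(|u|² + |v|²) - 2 symp(Tu, Tv).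
  have h := hpos.dotProduct_mulVec_nonneg (fun i => (v i : ℂ) + Complex.I * u i)
  have hre := (Complex.le_def.1 h).1
  have h7 : M *ᵥ (fun i => (v i : ℂ) + Complex.I * u i)
      = fun i => dMax A * ((v i : ℂ) + Complex.I * u i)
        - Complex.I * (((S *ᵥ v) i : ℂ) + Complex.I * (S *ᵥ u) i) := by
    simp only [M, Matrix.sub_mulVec, Matrix.smul_mulVec, Matrix.one_mulVec, Sc, map_ofReal_mulVec]
    rfl
  have h8 : (star (fun i => (v i : ℂ) + Complex.I * u i) ⬝ᵥ
      (M *ᵥ fun i => (v i : ℂ) + Complex.I * u i)).re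
      = dMax A * (u ⬝ᵥ u + v ⬝ᵥ v) + v ⬝ᵥ (S *ᵥ u) + -1 * (u ⬝ᵥ (S *ᵥ v)) := by
    rw [h7]
    simp only [dotProduct, Complex.re_sum, ← Finset.sum_add_distrib, Finset.mul_sum]
    refine Finset.sum_congr rfl fun i _ => ?_
    simp
    ring
  rw [h8, hS, hS, symp_swap (T *ᵥ v), ← eLen_sq_dotProduct, ← eLen_sq_dotProduct] at hre
  simp only [Complex.zero_re] at hre
  linarith

end Eigenvalues

/-! ### Bounded structures form a precompact set -/

section Precompact

variable {n : ℕ} {r : Fin n → ℕ}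

/-- The matrix with columns the standard basis of the horizontal lattice. -/
noncomputable def scaleMat (r : Fin n → ℕ) : Matrix (HIdx n) (HIdx n) ℝ :=
  Matrix.diagonal (latScale r)

theorem isUnit_det_scaleMat (hr : ∀ i, 0 < r i) : IsUnit (scaleMat r).det := by
  rw [scaleMat, Matrix.det_diagonal]
  exact (Finset.prod_pos fun i _ => latScale_pos hr i).ne'.isUnit

theorem mem_horLattice_iff_scaleMat {v : HIdx n → ℝ} :
    v ∈ horLattice r ↔ ∃ x : HIdx n → ℤ, v = scaleMat r *ᵥ fun i => (x i : ℝ) := by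
  rw [mem_horLattice_iff_exists]
  refine exists_congr fun x => ?_
  have : (scaleMat r *ᵥ fun i => (x i : ℝ)) = fun i => latScale r i * (x i : ℝ) := by
    funext i; exact Matrix.mulVec_diagonal _ _ _
  rw [this]

/-- The matrix of the symplectic form in the standard basis of the horizontal lattice. -/
def latSymp (r : Fin n → ℕ) : Matrix (HIdx n) (HIdx n) ℤ :=
  Matrix.fromBlocks 0 (Matrix.diagonal fun i => (r i : ℤ)) (-Matrix.diagonal fun i => (r i : ℤ)) 0

theorem map_latSymp (r : Fin n → ℕ) :
    (latSymp r).map (Int.cast : ℤ → ℝ) = (scaleMat r)ᵀ * sympMatrix n * scaleMat r := by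
  rw [scaleMat, Matrix.diagonal_transpose]
  ext i j
  rw [Matrix.mul_diagonal, Matrix.diagonal_mul]
  rcases i with i | i <;> rcases j with j | j <;> by_cases hij : i = j <;>
    simp [latSymp, sympMatrix, latScale, hij]

theorem intCast_mulVec (γ : Matrix (HIdx n) (HIdx n) ℤ) (x : HIdx n → ℤ) :
    γ.map (Int.cast : ℤ → ℝ) *ᵥ (fun i => (x i : ℝ)) = fun i => ((γ *ᵥ x) i : ℝ) := by
  funext i
  simp [Matrix.mulVec, dotProduct]

theorem map_intCast_mul (γ δ : Matrix (HIdx n) (HIdx n) ℤ) :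
    (γ * δ).map (Int.cast : ℤ → ℝ) = γ.map (Int.cast : ℤ → ℝ) * δ.map (Int.cast : ℤ → ℝ) :=
  Matrix.map_mul (f := Int.castRingHom ℝ)

/-- The action on the horizontal space of an integral matrix in lattice coordinates. -/
noncomputable def latConj (r : Fin n → ℕ) (ε : Matrix (HIdx n) (HIdx n) ℤ) :
    Matrix (HIdx n) (HIdx n) ℝ :=
  scaleMat r * ε.map (Int.cast : ℤ → ℝ) * (scaleMat r)⁻¹

theorem latConj_mul (hr : ∀ i, 0 < r i) (ε ε' : Matrix (HIdx n) (HIdx n) ℤ) :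
    latConj r ε * latConj r ε' = latConj r (ε * ε') := by
  rw [latConj, latConj, latConj, map_intCast_mul]
  simp only [Matrix.mul_assoc]
  rw [Matrix.nonsing_inv_mul_cancel_left _ _ (isUnit_det_scaleMat hr)]

theorem latConj_one (hr : ∀ i, 0 < r i) : latConj r (1 : Matrix (HIdx n) (HIdx n) ℤ) = 1 := by
  rw [latConj, Matrix.map_one _ Int.cast_zero Int.cast_one, Matrix.mul_one,
    Matrix.mul_nonsing_inv _ (isUnit_det_scaleMat hr)]

theorem latConj_mem_horLattice (hr : ∀ i, 0 < r i) (ε : Matrix (HIdx n) (HIdx n) ℤ)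
    {v : HIdx n → ℝ} (hv : v ∈ horLattice r) : latConj r ε *ᵥ v ∈ horLattice r := by
  obtain ⟨x, rfl⟩ := mem_horLattice_iff_scaleMat.1 hv
  refine mem_horLattice_iff_scaleMat.2 ⟨ε *ᵥ x, ?_⟩
  rw [latConj, Matrix.mulVec_mulVec, Matrix.mul_assoc,
    Matrix.nonsing_inv_mul _ (isUnit_det_scaleMat hr), Matrix.mul_one, ← Matrix.mulVec_mulVec,
    intCast_mulVec]

theorem symp_eq_of_transpose_mul_mul {S : Matrix (HIdx n) (HIdx n) ℝ}
    (h : Sᵀ * sympMatrix n * S = sympMatrix n) (u v : HIdx n → ℝ) :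
    symp (S *ᵥ u) (S *ᵥ v) = symp u v := by
  rw [← dotProduct_sympMatrix, ← dotProduct_sympMatrix, dotProduct_comm, dotProduct_comm u]
  nth_rewrite 2 [← h]
  rw [← Matrix.mulVec_mulVec, ← Matrix.mulVec_mulVec, dotProduct_mulVec_transpose]

theorem symp_latConj (hr : ∀ i, 0 < r i) {ε : Matrix (HIdx n) (HIdx n) ℤ}
    (hε : εᵀ * latSymp r * ε = latSymp r) (u v : HIdx n → ℝ) :
    symp (latConj r ε *ᵥ u) (latConj r ε *ᵥ v) = symp u v := by
  refine symp_eq_of_transpose_mul_mul ?_ u v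
  have hu := isUnit_det_scaleMat hr
  have hD : sympMatrix n
      = ((scaleMat r)⁻¹)ᵀ * (latSymp r).map (Int.cast : ℤ → ℝ) * (scaleMat r)⁻¹ := by
    rw [map_latSymp, Matrix.transpose_nonsing_inv]
    simp only [Matrix.mul_assoc]
    rw [Matrix.mul_nonsing_inv _ hu, Matrix.mul_one, Matrix.nonsing_inv_mul_cancel_left]
    rwa [Matrix.det_transpose]
  have h1 : (ε.map (Int.cast : ℤ → ℝ))ᵀ * (latSymp r).map (Int.cast : ℤ → ℝ)
      * ε.map (Int.cast : ℤ → ℝ) = (latSymp r).map (Int.cast : ℤ → ℝ) := by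
    rw [← Matrix.transpose_map, ← map_intCast_mul, ← map_intCast_mul, hε]
  calc (latConj r ε)ᵀ * sympMatrix n * latConj r ε
      = ((scaleMat r)⁻¹)ᵀ * ((ε.map (Int.cast : ℤ → ℝ))ᵀ *
        ((scaleMat r)ᵀ * sympMatrix n * scaleMat r) * ε.map (Int.cast : ℤ → ℝ))
        * (scaleMat r)⁻¹ := by
        simp only [latConj, Matrix.transpose_mul, Matrix.mul_assoc]
    _ = sympMatrix n := by rw [← map_latSymp, h1, ← hD]

theorem eq_blockFrame {A : Matrix (Idx n) (Idx n) ℝ} (h : IsWeakCanonical A) :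
    A = blockFrame (tildeBlock A) (rhoEntry A) := by
  conv_lhs => rw [← Matrix.fromBlocks_toBlocks A, h.1, h.2]
  rfl

/-- Frames whose inverse horizontal block and vertical entry are bounded and nondegenerate form a
compact set. -/
theorem exists_isCompact_frames (hn : 1 ≤ n) (C : ℝ) {c : ℝ} (hc : 0 < c) (ρ₀ : ℝ) :
    ∃ K : Set (frames n), IsCompact K ∧ ∀ (A : frames n) (M : Matrix (HIdx n) (HIdx n) ℝ) (ρ : ℝ),
      A.1 = blockFrame M⁻¹ ρ → (∀ i j, |M i j| ≤ C) → c ≤ |M.det| → |ρ| ≤ ρ₀ → A ∈ K := by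
  -- The parameter is the inverse M of the horizontal block, because M is what a reduced lattice
  -- basis bounds; inversion is continuous where the determinant stays away from 0.
  let K₀ : Set (Matrix (HIdx n) (HIdx n) ℝ × ℝ) :=
    ((Set.univ.pi fun _ => Set.univ.pi fun _ => Set.Icc (-C) C) ×ˢ Set.Icc (-ρ₀) ρ₀) ∩
      {p | c ≤ |p.1.det|}
  have hK₀ : IsCompact K₀ := by
    refine IsCompact.inter_right ?_ (isClosed_le continuous_const ?_)
    · exact (isCompact_univ_pi fun _ => isCompact_univ_pi fun _ => isCompact_Icc).prod isCompact_Icc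
    · exact (continuous_fst.matrix_det).abs
  have hdet : ∀ p : K₀, p.1.1.det ≠ 0 := fun p h0 => by
    have := p.2.2
    simp only [Set.mem_ofPred_eq, h0, abs_zero] at this
    linarith
  have hmem : ∀ p : K₀, blockFrame p.1.1⁻¹ p.1.2 ∈ frames n := fun p =>
    mem_frames_of_isUnit_det hn (isWeakCanonical_blockFrame _ _) (by
      rw [tildeBlock_blockFrame]
      exact Matrix.isUnit_nonsing_inv_det _ (hdet p).isUnit)
  have hcont : Continuous fun p : K₀ => (⟨blockFrame p.1.1⁻¹ p.1.2, hmem p⟩ : frames n) := by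
    refine Continuous.subtype_mk ?_ _
    have h1 : Continuous fun p : K₀ => p.1.1 := continuous_fst.comp continuous_subtype_val
    have h2 : Continuous fun p : K₀ => (p.1.1)⁻¹ := by
      simp only [Matrix.inv_def, Ring.inverse_eq_inv']
      exact (h1.matrix_det.inv₀ hdet).smul h1.matrix_adjugate
    refine h2.matrix_fromBlocks continuous_const continuous_const ?_
    refine continuous_matrix fun _ _ => continuous_snd.comp continuous_subtype_val
  have : CompactSpace K₀ := isCompact_iff_compactSpace.1 hK₀
  refine ⟨_, isCompact_range hcont, fun A M ρ hA hM hd hρ => ?_⟩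
  exact ⟨⟨(M, ρ), ⟨⟨fun i _ j _ => abs_le.1 (hM i j), abs_le.1 hρ⟩, hd⟩⟩, Subtype.ext hA.symm⟩

theorem abs_apply_le_matSum {ι κ : Type*} [Fintype ι] [Fintype κ] (M : Matrix ι κ ℝ) (i : ι)
    (j : κ) : |M i j| ≤ matSum M :=
  (Finset.single_le_sum (f := fun j => |M i j|) (fun _ _ => abs_nonneg _)
    (Finset.mem_univ j)).trans
    (Finset.single_le_sum (f := fun i => ∑ j, |M i j|)
      (fun _ _ => Finset.sum_nonneg fun _ _ => abs_nonneg _) (Finset.mem_univ i))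

/-- In orthonormal coordinates the lattice basis is W = T⁻¹ `scaleMat`. Reduction makes it bounded
after an integral change of basis, and its symplectic matrix then lies in a finite set. Comparison
with a basis stored for that matrix gives a symplectic lattice automorphism moving the frame into a
fixed compact set; ρ is unchanged. -/
theorem isCompact_closure_of_bounds (hn : 1 ≤ n) (hr : ∀ i, 0 < r i) {𝒳 : Set (Moduli r)}
    {C₁ C₂ C₃ C₄ : ℝ} (h₁ : 0 < C₁) (h₂ : 0 < C₂) (h₃ : 0 < C₃)
    (h : ∀ A : frames n, IsWeakCanonical A.1 → moduliClass r A ∈ 𝒳 →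
      (∀ X ∈ projLattice r, X ≠ 0 → C₁ ≤ horNorm A.1 X) ∧ C₂ ≤ |(tildeBlock A.1).det| ∧
      dMax A.1 ≤ C₃ ∧ |rhoEntry A.1| ≤ C₄) : IsCompact (closure 𝒳) := by
  have hu := isUnit_det_scaleMat (n := n) hr
  have hD : 0 < |(scaleMat r).det| := abs_pos.2 hu.ne_zero
  obtain ⟨C, v, hv, hred⟩ := exists_reduced_basis (HIdx n) h₁ (|(scaleMat r).det| / C₂)
  -- representatives of the finitely many bounded symplectic forms
  let B : ℝ := C₃ * (Fintype.card (HIdx n) * C) ^ 2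
  let 𝒥 : Set (Matrix (HIdx n) (HIdx n) ℤ) := {J | (∀ i j, |(J i j : ℝ)| ≤ B) ∧
    ∃ δ δ' : Matrix (HIdx n) (HIdx n) ℤ, δ * δ' = 1 ∧ δᵀ * latSymp r * δ = J}
  have hfin : 𝒥.Finite := by
    have : {J : Matrix (HIdx n) (HIdx n) ℤ | ∀ i, J i ∈ {x : HIdx n → ℤ |
        ∀ j, x j ∈ Set.Icc (-⌊B⌋) ⌊B⌋}}.Finite := Set.Finite.pi' fun _ => Set.Finite.pi' fun _ =>
          Set.finite_Icc _ _
    refine this.subset fun J hJ i j => abs_le.1 (Int.le_floor.2 ?_)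
    push_cast
    exact hJ.1 i j
  choose! δ δ' hδ hδJ using fun J (hJ : J ∈ 𝒥) => hJ.2
  obtain ⟨E, hE⟩ := (hfin.image fun J =>
    matSum ((δ' J).map (Int.cast : ℤ → ℝ) * (scaleMat r)⁻¹)).bddAbove
  obtain ⟨K, hK, hKmem⟩ := exists_isCompact_frames hn (Fintype.card (HIdx n) * (C * E))
    (div_pos hv hD) C₄
  -- In a Hausdorff space a subset of a compact set has compact closure.
  suffices hsub : 𝒳 ⊆ moduliClass r '' K by
    have := t2Space_moduli hn hr
    exact (hK.image continuous_quotient_mk').closure_of_subset hsub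
  intro x hx
  induction x using Quotient.inductionOn with | h A₀ => ?_
  obtain ⟨A, hA, hcl⟩ := exists_weakCanonical hn r A₀
  change moduliClass r A₀ ∈ 𝒳 at hx
  change moduliClass r A₀ ∈ _
  rw [hcl] at hx ⊢
  obtain ⟨hA₁, hA₂, hA₃, hA₄⟩ := h A hA hx
  set T := tildeBlock A.1 with hT
  have hTu : IsUnit T.det := isUnit_det_of_frames hA A.2
  have hTpos : 0 < |T.det| := abs_pos.2 hTu.ne_zero
  let W := T⁻¹ * scaleMat r
  have hTW : T * W = scaleMat r := Matrix.mul_nonsing_inv_cancel_left _ _ hTu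
  have hWdet : |W.det| = |(scaleMat r).det| / |T.det| := by
    rw [eq_div_iff hTpos.ne', ← abs_mul, mul_comm, ← Matrix.det_mul, hTW]
  have hWu : IsUnit W.det := by
    rw [Matrix.det_mul]
    exact (Matrix.isUnit_nonsing_inv_det _ hTu).mul hu
  obtain ⟨hvW, hb⟩ := hred W hWu fun x hx => by
    rw [← Matrix.mulVec_mulVec, ← horNorm_eq hA hTu]
    refine hA₁ _ (mem_projLattice.2 (mem_horLattice_iff_scaleMat.2 ⟨x, rfl⟩)) fun h0 => hx ?_
    have h3 := congrArg ((scaleMat r)⁻¹ *ᵥ ·) h0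
    simp only [Matrix.mulVec_mulVec, Matrix.nonsing_inv_mul _ hu, Matrix.one_mulVec,
      Matrix.mulVec_zero] at h3
    funext i
    simpa using congrFun h3 i
  obtain ⟨γ, γ', hγ, hC⟩ := hb (by rw [hWdet]; gcongr)
  let Γ := γ.map (Int.cast : ℤ → ℝ)
  -- the symplectic form in the reduced basis
  have hJmem : γᵀ * latSymp r * γ ∈ 𝒥 := by
    refine ⟨fun i j => ?_, γ, γ', hγ, rfl⟩
    let w : HIdx n → HIdx n → ℝ := fun j k => (W * Γ) k j
    have hw : ∀ j, eLen (w j) ≤ Fintype.card (HIdx n) * C := fun j => by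
      refine (eLen_le_card_mul_norm _).trans ?_
      have hC0 : 0 ≤ C := (abs_nonneg _).trans (hC i j)
      gcongr
      exact (pi_norm_le_iff_of_nonneg hC0).2 fun k => hC k j
    have hval : ((γᵀ * latSymp r * γ) i j : ℝ) = symp (T *ᵥ w i) (T *ᵥ w j) := by
      have h3 : (γᵀ * latSymp r * γ).map (Int.cast : ℤ → ℝ)
          = (T * (W * Γ))ᵀ * sympMatrix n * (T * (W * Γ)) := by
        rw [map_intCast_mul, map_intCast_mul, map_latSymp, ← Matrix.mul_assoc T, hTW,
          Matrix.transpose_mul, Matrix.transpose_map]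
        simp only [Matrix.mul_assoc, Γ]
      have h4 := congrFun (congrFun h3 i) j
      rw [Matrix.map_apply] at h4
      rw [h4, ← dotProduct_sympMatrix, Matrix.mul_assoc, Matrix.mul_apply]
      refine Finset.sum_congr rfl fun k _ => ?_
      congr 1
    have h5 := two_mul_symp_le hTu (w i) (w j)
    -- The inequality is one-sided; swapping the arguments bounds the absolute value.
    have h6 := two_mul_symp_le hTu (w j) (w i)
    rw [symp_swap] at h6
    have h7 : dMax A.1 * (eLen (w i) ^ 2 + eLen (w j) ^ 2) ≤ 2 * B := by
      have h8 : ∀ j, eLen (w j) ^ 2 ≤ (Fintype.card (HIdx n) * C) ^ 2 := fun j =>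
        pow_le_pow_left₀ (eLen_nonneg _) (hw j) 2
      calc dMax A.1 * (eLen (w i) ^ 2 + eLen (w j) ^ 2)
          ≤ C₃ * (eLen (w i) ^ 2 + eLen (w j) ^ 2) := by gcongr
        _ ≤ C₃ * ((Fintype.card (HIdx n) * C) ^ 2 + (Fintype.card (HIdx n) * C) ^ 2) := by
          exact mul_le_mul_of_nonneg_left (add_le_add (h8 i) (h8 j)) h₃.le
        _ = 2 * B := by ring
    rw [hval, abs_le]
    constructor <;> linarith
  set J := γᵀ * latSymp r * γ with hJ
  have hJδ := hδJ J hJmem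
  have hδ1 := hδ J hJmem
  -- Two bases in which the form has the same matrix differ by an isometry of the form.
  have key : ∀ {α α' β : Matrix (HIdx n) (HIdx n) ℤ}, α * α' = 1 →
      βᵀ * latSymp r * β = αᵀ * latSymp r * α →
      (β * α')ᵀ * latSymp r * (β * α') = latSymp r := by
    intro α α' β hα hβ
    calc (β * α')ᵀ * latSymp r * (β * α') = α'ᵀ * (βᵀ * latSymp r * β) * α' := by
          simp only [Matrix.transpose_mul, Matrix.mul_assoc]
      _ = (α * α')ᵀ * latSymp r * (α * α') := by
          rw [hβ]; simp only [Matrix.transpose_mul, Matrix.mul_assoc]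
      _ = latSymp r := by rw [hα]; simp
  have hSS' : latConj r (δ J * γ') * latConj r (γ * δ' J) = 1 := by
    rw [latConj_mul hr, Matrix.mul_assoc, ← Matrix.mul_assoc γ', mul_eq_one_comm.1 hγ,
      Matrix.one_mul, hδ1, latConj_one hr]
  -- The inverse of the transformed horizontal block: a bounded reduced basis times one of finitely
  -- many matrices.
  let M := W * Γ * ((δ' J).map (Int.cast : ℤ → ℝ) * (scaleMat r)⁻¹)
  have hM : M = T⁻¹ * latConj r (γ * δ' J) := by
    simp only [M, W, Γ, latConj, map_intCast_mul, Matrix.mul_assoc]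
  have hMinv : M⁻¹ = latConj r (δ J * γ') * T := by
    refine Matrix.inv_eq_left_inv ?_
    rw [hM, Matrix.mul_assoc, Matrix.mul_nonsing_inv_cancel_left _ _ hTu, hSS']
  have hMdet : |M.det| = |W.det| / |(scaleMat r).det| := by
    have h3 : ∀ {α α' : Matrix (HIdx n) (HIdx n) ℤ}, α * α' = 1 →
        |(α.map (Int.cast : ℤ → ℝ)).det| = 1 := fun hα =>
      (pow_eq_one_iff_of_nonneg (abs_nonneg _) two_ne_zero).1 (by
        rw [sq_abs, det_map_intCast_sq hα])
    change |(W * Γ * ((δ' J).map (Int.cast : ℤ → ℝ) * (scaleMat r)⁻¹)).det| = _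
    rw [Matrix.det_mul (W * Γ), Matrix.det_mul W, Matrix.det_mul (Matrix.map _ _), abs_mul, abs_mul, abs_mul, h3 hγ,
      h3 (mul_eq_one_comm.1 hδ1), Matrix.det_nonsing_inv, Ring.inverse_eq_inv', abs_inv]
    ring
  have hMdet0 : IsUnit M.det := by
    refine (abs_pos.1 ?_).isUnit
    rw [hMdet]
    exact div_pos (hv.trans_le hvW) hD
  have hBmem : blockFrame M⁻¹ (rhoEntry A.1) ∈ frames n :=
    mem_frames_of_isUnit_det hn (isWeakCanonical_blockFrame _ _) (by
      rw [tildeBlock_blockFrame]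
      exact Matrix.isUnit_nonsing_inv_det _ hMdet0)
  refine ⟨⟨_, hBmem⟩, hKmem _ M _ rfl (fun i j => ?_) ?_ hA₄, ?_⟩
  · have h3 : ∀ k, |((δ' J).map (Int.cast : ℤ → ℝ) * (scaleMat r)⁻¹) k j| ≤ E := fun k =>
      (abs_apply_le_matSum _ k j).trans (hE ⟨J, hJmem, rfl⟩)
    have hC0 : 0 ≤ C := (abs_nonneg _).trans (hC i j)
    change |(W * Γ * ((δ' J).map (Int.cast : ℤ → ℝ) * (scaleMat r)⁻¹)) i j| ≤ _
    rw [Matrix.mul_apply, ← nsmul_eq_mul]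
    refine (Finset.abs_sum_le_sum_abs _ _).trans (Finset.sum_le_card_nsmul _ _ _ fun k _ => ?_)
    rw [abs_mul]
    exact mul_le_mul (hC i k) (h3 k) (abs_nonneg _) hC0
  · rw [hMdet]; gcongr
  · refine (moduliClass_sympAut hSS' (symp_latConj hr (key hγ hJδ))
      (fun v hv => latConj_mem_horLattice hr _ hv) (fun v hv => latConj_mem_horLattice hr _ hv) hr
      (eq_blockFrame hA) ?_).symm
    exact congrArg (blockFrame · _) hMinv

end Precompact

/-! ### Structures of bounded diameter -/

section Diameter

variable {n : ℕ} {r : Fin n → ℕ} {B : Matrix (Idx n) (Idx n) ℝ}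

theorem eLen_horVec (v : HIdx n → ℝ) : eLen (horVec v) = eLen v := by
  simp [eLen, horVec, Fintype.sum_sum_type]

theorem heisDist_one_horVec_le (hB : B ∈ frames n) (hw : IsWeakCanonical B) (v : HIdx n → ℝ) :
    heisDist B 1 ⟨horVec v⟩ ≤ ENNReal.ofReal (eLen ((tildeBlock B)⁻¹ *ᵥ v)) := by
  have h := heisDist_one_mulVec_le B (horVec ((tildeBlock B)⁻¹ *ᵥ v))
  have h1 : B *ᵥ horVec ((tildeBlock B)⁻¹ *ᵥ v) = horVec v := by
    apply lie_ext
    · rw [hor_mulVec_of_isWeakCanonical hw, hor_horVec, hor_horVec, Matrix.mulVec_mulVec,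
        Matrix.mul_nonsing_inv _ (isUnit_det_of_frames hw hB), Matrix.one_mulVec]
    · rw [ver_mulVec_of_isWeakCanonical hw, ver_horVec, ver_horVec, mul_zero]
  rwa [h1, eLen_horVec] at h

theorem heisDist_one_zVec_le_of_rhoEntry (hw : IsWeakCanonical B) (h0 : rhoEntry B ≠ 0) (s : ℝ) :
    heisDist B 1 ⟨zVec s⟩ ≤ ENNReal.ofReal (|s| / |rhoEntry B|) := by
  have h := heisDist_one_mulVec_le B (zVec (s / rhoEntry B))
  have h1 : B *ᵥ zVec (s / rhoEntry B) = zVec s := by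
    apply lie_ext
    · rw [hor_mulVec_of_isWeakCanonical hw, hor_zVec, hor_zVec, Matrix.mulVec_zero]
    · rw [ver_mulVec_of_isWeakCanonical hw, ver_zVec, ver_zVec, mul_div_cancel₀ _ h0]
  have h2 : eLen (zVec (s / rhoEntry B) : HeisLie n) = |s| / |rhoEntry B| := by
    rw [zVec, eLen_single, abs_div]
  rwa [h1, h2] at h

/-- A pair whose bracket is large compared with its lengths makes central motion cheap: unit central
displacements are commutators of arcs of length at most √(1/C). -/
theorem heisDist_one_zVec_le_of_symp (hw : IsWeakCanonical B) {C : ℝ} (hC : 0 < C)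
    {u v : HIdx n → ℝ}
    (huv : C * (eLen u * eLen v) < |symp (tildeBlock B *ᵥ u) (tildeBlock B *ᵥ v)|)
    {s : ℝ} (hs : |s| ≤ 1) : heisDist B 1 ⟨zVec s⟩ ≤ ENNReal.ofReal (4 * √(1 / C)) := by
  set σ := symp (tildeBlock B *ᵥ u) (tildeBlock B *ᵥ v) with hσ
  have hu : 0 < eLen u := eLen_pos fun h => by
    simp [hσ, h, symp_zero_left, eLen_zero] at huv
  have hv : 0 < eLen v := eLen_pos fun h => by
    simp [hσ, h, symp_zero_right, eLen_zero] at huv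
  have hσpos : 0 < |σ| := lt_of_le_of_lt (by positivity) huv
  -- The product of signed lengths along u and v whose commutator is exactly s.
  set τ := s * (eLen u * eLen v) / σ with hτ
  have hτle : |τ| ≤ 1 / C := by
    rw [hτ, abs_div, abs_mul, abs_of_pos (mul_pos hu hv), div_le_div_iff₀ hσpos hC]
    have := mul_le_mul_of_nonneg_right hs (mul_pos hC (mul_pos hu hv)).le
    linarith
  set l := √|τ|
  -- Equal in size to l = √|τ|, with the sign of τ; this also holds for τ = 0, since division by 0
  -- gives 0.
  set m := τ / l
  have hlm : l * m = τ := by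
    by_cases h0 : l = 0
    · have : τ = 0 := abs_eq_zero.1 ((Real.sqrt_eq_zero (abs_nonneg _)).1 h0)
      rw [h0, this, zero_mul]
    · exact mul_div_cancel₀ _ h0
  have hm : |m| = l := by
    rw [abs_div, abs_of_nonneg (Real.sqrt_nonneg _ : 0 ≤ l)]
    exact Real.div_sqrt
  have h := heisDist_one_zVec_symp_le B (horVec ((l / eLen u) • u)) (horVec ((m / eLen v) • v))
  rw [hor_mulVec_of_isWeakCanonical hw, hor_mulVec_of_isWeakCanonical hw, hor_horVec, hor_horVec,
    Matrix.mulVec_smul, Matrix.mulVec_smul, symp_smul_left, symp_smul_right, ← hσ, eLen_horVec,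
    eLen_horVec, eLen_smul, eLen_smul, abs_div, abs_div, abs_of_pos hu, abs_of_pos hv,
    div_mul_cancel₀ _ hu.ne', div_mul_cancel₀ _ hv.ne', hm, abs_of_nonneg (Real.sqrt_nonneg _)] at h
  have hs' : l / eLen u * (m / eLen v * σ) = s := by
    have : l / eLen u * (m / eLen v * σ) = (l * m) * σ / (eLen u * eLen v) := by
      field_simp
    rw [this, hlm, hτ]
    have := abs_pos.1 hσpos
    field_simp
  rw [hs'] at h
  refine h.trans (ENNReal.ofReal_le_ofReal ?_)
  have : l ≤ √(1 / C) := Real.sqrt_le_sqrt hτle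
  linarith

theorem exists_rep_norm_le (hB : B ∈ frames n) (hw : IsWeakCanonical B) {D : ℝ}
    (hdiam : ∀ a b : HeisManifold r, manifoldDist r B a b < ENNReal.ofReal D) (p : Heis n) :
    ∃ g ∈ heisLattice r, ‖(tildeBlock B)⁻¹ *ᵥ hor (g * p).log‖ ≤ D := by
  obtain ⟨g, hg, hlt⟩ := manifoldDist_lt_iff.1 (hdiam (Quotient.mk _ 1) (Quotient.mk _ p))
  exact ⟨g, hg, norm_inv_mulVec_hor_le hB hw hlt⟩

/-- The projection is 1-Lipschitz, so the diameter bounds the covering radius of the horizontal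
lattice. -/
theorem exists_horLattice_norm_le (hB : B ∈ frames n) (hw : IsWeakCanonical B) {D : ℝ}
    (hdiam : ∀ a b : HeisManifold r, manifoldDist r B a b < ENNReal.ofReal D) (v : HIdx n → ℝ) :
    ∃ x ∈ horLattice r, ‖(tildeBlock B)⁻¹ *ᵥ (x + v)‖ ≤ D := by
  obtain ⟨g, hg, hle⟩ := exists_rep_norm_le hB hw hdiam ⟨horVec v⟩
  exact ⟨hor g.log, (mem_heisLattice.1 hg).1, by rwa [hor_mul, hor_horVec] at hle⟩

/-- An upper bound of the diameter bounds the determinant from below. -/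
theorem exists_le_abs_det (n : ℕ) {D : ℝ} (hD : 0 < D) : ∃ c : ℝ, 0 < c ∧
    ∀ (r : Fin n → ℕ) (B : Matrix (Idx n) (Idx n) ℝ), B ∈ frames n → IsWeakCanonical B →
      (∀ a b : HeisManifold r, manifoldDist r B a b < ENNReal.ofReal D) →
        c ≤ |(tildeBlock B).det| := by
  set N := Fintype.card (HIdx n) with hN
  -- Lattice vectors within D of R times each unit vector form a diagonally dominant matrix:
  -- diagonal entries are at least (N + 1)D, the others at most D.
  set R : ℝ := (N + 2) * D with hR
  set F : ℝ := N.factorial • (R + D) ^ N with hF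
  have hFpos : 0 < F := by
    rw [hF, nsmul_eq_mul]; positivity
  refine ⟨1 / F, by positivity, fun r B hB hw hdiam => ?_⟩
  set T := tildeBlock B
  have hT : IsUnit T.det := isUnit_det_of_frames hw hB
  choose x hx hxle using fun i : HIdx n =>
    exists_horLattice_norm_le hB hw hdiam (-(T *ᵥ Pi.single i R))
  let Λ : Matrix (HIdx n) (HIdx n) ℝ := Matrix.of fun i j => x j i
  have hent : ∀ i j, |(T⁻¹ * Λ) i j - (Pi.single j R : HIdx n → ℝ) i| ≤ D := fun i j => by
    have h1 : T⁻¹ *ᵥ (x j + -(T *ᵥ Pi.single j R)) = T⁻¹ *ᵥ x j - Pi.single j R := by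
      rw [← sub_eq_add_neg, Matrix.mulVec_sub, Matrix.mulVec_mulVec, Matrix.nonsing_inv_mul _ hT,
        Matrix.one_mulVec]
    have h2 := hxle j
    rw [h1] at h2
    exact (norm_le_pi_norm _ i).trans h2
  have hdiag : ∀ k, D * N < ‖(T⁻¹ * Λ) k k‖ := fun k => by
    have h1 := hent k k
    rw [Pi.single_eq_same] at h1
    have := (abs_le.1 h1).1
    refine lt_of_lt_of_le ?_ (le_abs_self _)
    linarith
  have hdet0 : (T⁻¹ * Λ).det ≠ 0 := by
    refine det_ne_zero_of_sum_row_lt_diag fun k => lt_of_le_of_lt ?_ (hdiag k)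
    refine (Finset.sum_le_card_nsmul _ _ D fun j hj => ?_).trans ?_
    · have h1 := hent k j
      rwa [Pi.single_eq_of_ne (Finset.ne_of_mem_erase hj).symm, sub_zero] at h1
    · rw [nsmul_eq_mul, mul_comm]
      have : (Finset.univ.erase k).card ≤ N := Finset.card_le_univ _
      gcongr
  have hΛint : Λ.det ∈ intReal := by
    choose z hz using fun i j => mem_intReal_iff.1 (coord_mem_intReal (hx j) i)
    refine mem_intReal_iff.2 ⟨(Matrix.of z).det, ?_⟩
    rw [Int.cast_det]
    congr 1
    ext i j
    exact hz i j
  -- A nonsingular integral matrix; as its entries in orthonormal coordinates are bounded, det T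
  -- cannot be small.
  have hΛ1 : 1 ≤ |Λ.det| := by
    rw [Matrix.det_mul] at hdet0
    by_contra! hlt
    exact right_ne_zero_of_mul hdet0 (eq_zero_of_mem_intReal hΛint hlt)
  have hbound : |(T⁻¹ * Λ).det| ≤ F := by
    refine Matrix.det_le (abv := AbsoluteValue.abs) fun i j => ?_
    have h1 := abs_add_le ((T⁻¹ * Λ) i j - (Pi.single j R : HIdx n → ℝ) i)
      ((Pi.single j R : HIdx n → ℝ) i)
    rw [sub_add_cancel] at h1
    have h2 : |(Pi.single j R : HIdx n → ℝ) i| ≤ R := by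
      by_cases h : i = j
      · subst h; rw [Pi.single_eq_same, abs_of_nonneg (by positivity)]
      · rw [Pi.single_eq_of_ne h, abs_zero]; positivity
    change |(T⁻¹ * Λ) i j| ≤ _
    linarith [hent i j]
  have hprod : |Λ.det| = |T.det| * |(T⁻¹ * Λ).det| := by
    rw [← abs_mul, ← Matrix.det_mul, Matrix.mul_nonsing_inv_cancel_left _ _ hT]
  rw [div_le_iff₀ hFpos]
  calc 1 ≤ |T.det| * |(T⁻¹ * Λ).det| := hprod ▸ hΛ1
    _ ≤ |T.det| * F := by gcongr

/-- A short lattice vector yields short paths between nearby points of the same fibre. -/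
theorem manifoldDist_mul_zVec_le (hB : B ∈ frames n) (hw : IsWeakCanonical B) {D : ℝ}
    (hdiam : ∀ a b : HeisManifold r, manifoldDist r B a b < ENNReal.ofReal D) {X : HIdx n → ℝ}
    (hX : X ∈ horLattice r) (hX0 : X ≠ 0) (p : Heis n) (s : ℝ) :
    manifoldDist r B (Quotient.mk _ p) (Quotient.mk _ (p * ⟨zVec s⟩))
      ≤ ENNReal.ofReal (2 * eLen ((tildeBlock B)⁻¹ *ᵥ X) + 8 * n * D * |s|) := by
  set N := (tildeBlock B)⁻¹
  set η := eLen (N *ᵥ X)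
  have hη : 0 ≤ η := eLen_nonneg _
  -- a short vector which does not commute with `X`
  obtain ⟨Y, hY, hXY⟩ : ∃ Y : HIdx n → ℝ, eLen (N *ᵥ Y) ≤ 2 * n * D ∧ 1 / 2 ≤ |symp X Y| := by
    obtain ⟨V, hV⟩ : ∃ V, symp X V = 1 / 2 := by
      obtain ⟨w, hw⟩ := exists_symp_eq_dotProduct X
      refine ⟨(1 / 2 / (X ⬝ᵥ X)) • w, ?_⟩
      rw [symp_smul_right, hw, div_mul_cancel₀]
      exact fun h => hX0 (dotProduct_self_eq_zero.1 h)
    obtain ⟨x, hx, hle⟩ := exists_horLattice_norm_le hB hw hdiam V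
    refine ⟨x + V, (eLen_le_card_mul_norm _).trans ?_, ?_⟩
    · rw [card_HIdx]
      have : (0 : ℝ) ≤ 2 * n := by positivity
      gcongr
    · rw [symp_add_right', hV]
      obtain ⟨k, hk⟩ := mem_intReal_iff.1 (symp_mem_intReal hX hx)
      rw [← hk, le_abs]
      rcases le_or_gt 0 k with h | h
      · left
        have : (0 : ℝ) ≤ k := by exact_mod_cast h
        linarith
      · right
        have : (k : ℝ) ≤ -1 := by exact_mod_cast Int.le_sub_one_of_lt h
        linarith
  obtain ⟨g, hg, hgX⟩ := exists_mem_heisLattice hX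
  let ζ : Heis n → ℝ := fun q => ver g.log + symp X (hor q.log)
  -- Hence in the quotient the point q is within η of its central translate by ζ(q), and ζ varies
  -- with the horizontal part of q.
  have hgq : ∀ q : Heis n, g * q = q * ⟨zVec (ζ q)⟩ * ⟨horVec X⟩ := fun q => by
    apply heis_ext
    · simp [hgX, add_comm]
    · simp [hgX, ζ, symp_swap (hor q.log) X]; ring
  have htrans : ∀ (p q : Heis n) (s : ℝ), heisDist B (p * ⟨zVec s⟩) (q * ⟨zVec s⟩)
      = heisDist B p q := fun p q s => by
    rw [← zVec_comm, ← zVec_comm, heisDist_mul_left]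
  have hfib : ∀ q : Heis n, manifoldDist r B (Quotient.mk _ q) (Quotient.mk _ (q * ⟨zVec (ζ q)⟩))
      ≤ ENNReal.ofReal η := fun q => by
    have h1 : (Quotient.mk (QuotientGroup.rightRel (heisLattice r)) q) = Quotient.mk _ (g * q) :=
      mk_eq_mk_iff.2 ⟨g, hg, rfl⟩
    rw [h1, manifoldDist_comm, hgq]
    refine (manifoldDist_le _ _ _).trans ?_
    rw [heisDist_eq_one_left, inv_mul_cancel_left]
    exact heisDist_one_horVec_le hB hw X
  set c := symp X Y with hc
  have hc0 : c ≠ 0 := fun h => by rw [h, abs_zero] at hXY; linarith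
  -- Moving along tY changes ζ by exactly s. Jumping by -ζ, moving along tY, jumping back and
  -- returning gives the central displacement s.
  set t := s / c with ht
  have htc : t * c = s := div_mul_cancel₀ _ hc0
  have hY' : ∀ p : Heis n, heisDist B p (p * ⟨horVec (t • Y)⟩) ≤ ENNReal.ofReal (4 * n * D * |s|) := by
    intro p
    rw [heisDist_eq_one_left, inv_mul_cancel_left]
    refine (heisDist_one_horVec_le hB hw _).trans (ENNReal.ofReal_le_ofReal ?_)
    rw [Matrix.mulVec_smul, eLen_smul]
    have h1 : |t| ≤ 2 * |s| := by
      rw [ht, abs_div, div_le_iff₀ (abs_pos.2 hc0)]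
      nlinarith [abs_nonneg s]
    calc |t| * eLen (N *ᵥ Y) ≤ (2 * |s|) * (2 * n * D) :=
          mul_le_mul h1 hY (eLen_nonneg _) (by positivity)
      _ = 4 * n * D * |s| := by ring
  have hD0 : 0 ≤ 4 * n * D * |s| := by
    have : 0 ≤ 2 * n * D := (eLen_nonneg _).trans hY
    nlinarith [abs_nonneg s]
  set p' : Heis n := p * ⟨zVec (-ζ p)⟩ with hp'
  set q : Heis n := p' * ⟨horVec (t • Y)⟩ with hq
  have hζp : ζ p' = ζ p := by simp [ζ, hp']
  have hζq : ζ q = ζ p + s := by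
    simp only [ζ, hq, hp', hor_mul, hor_horVec, hor_zVec, symp_add_right', symp_smul_right, ← hc,
      htc, symp_zero_right]
    ring
  have e1 : p' * ⟨zVec (ζ p')⟩ = p := by
    rw [hζp, hp', mul_assoc, zVec_mul, neg_add_cancel]
    apply heis_ext <;> simp
  have e2 : p' * ⟨zVec (ζ q)⟩ = p * ⟨zVec s⟩ := by
    rw [hζq, hp', mul_assoc, zVec_mul, neg_add_cancel_left]
  let m : Heis n → HeisManifold r := Quotient.mk _
  calc manifoldDist r B (m p) (m (p * ⟨zVec s⟩))
      ≤ manifoldDist r B (m p) (m p') + (manifoldDist r B (m p') (m q) +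
        (manifoldDist r B (m q) (m (q * ⟨zVec (ζ q)⟩)) +
          manifoldDist r B (m (q * ⟨zVec (ζ q)⟩)) (m (p * ⟨zVec s⟩)))) :=
        (manifoldDist_triangle _ _ _ _).trans (add_le_add_right
          ((manifoldDist_triangle _ _ _ _).trans (add_le_add_right
            (manifoldDist_triangle _ _ _ _) _)) _)
    _ ≤ ENNReal.ofReal η + (ENNReal.ofReal (4 * n * D * |s|) + (ENNReal.ofReal η +
          ENNReal.ofReal (4 * n * D * |s|))) := by
        gcongr
        · have := hfib p'
          rw [e1, manifoldDist_comm] at this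
          exact this
        · exact (manifoldDist_le _ _ _).trans (hY' p')
        · exact hfib q
        · rw [← e2]
          refine (manifoldDist_le _ _ _).trans ?_
          rw [htrans, heisDist_comm]
          exact hY' p'
    _ = ENNReal.ofReal (2 * η + 8 * n * D * |s|) := by
        rw [← ENNReal.ofReal_add hη hD0, ← ENNReal.ofReal_add hD0 (by positivity),
          ← ENNReal.ofReal_add hη (by positivity)]
        congr 1; ring

end Diameter

/-! ### Covering a degenerate structure by few small sets -/

section Covering

variable {n : ℕ} {r : Fin n → ℕ} {B : Matrix (Idx n) (Idx n) ℝ}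

theorem eLen_le_of_abs_le {x : HIdx n → ℝ} {b : ℝ} (h : ∀ i, |x i| ≤ b) (hb : 0 ≤ b) :
    eLen x ≤ 2 * n * b := by
  refine (eLen_le_card_mul_norm x).trans ?_
  rw [card_HIdx]
  have : (0 : ℝ) ≤ 2 * n := by positivity
  gcongr
  exact (pi_norm_le_iff_of_nonneg hb).2 h

/-- The lattice points of the grid of size `h` below `x`, with one coordinate left out. -/
noncomputable def gridPoint (i₀ : Idx n) (h : ℝ) (x : HIdx n → ℝ) (j : HIdx n) : ℝ :=
  if Sum.inl j = i₀ then 0 else h * ⌊x j / h⌋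

theorem abs_sub_gridPoint_le {i₀ : Idx n} {h : ℝ} (hh : 0 < h) {x : HIdx n → ℝ}
    (hx : ∀ j, Sum.inl j = i₀ → |x j| ≤ h) (j : HIdx n) : |x j - gridPoint i₀ h x j| ≤ h := by
  unfold gridPoint
  split_ifs with hj
  · rw [sub_zero]; exact hx j hj
  · have h1 := Int.floor_le (x j / h)
    have h2 := Int.lt_floor_add_one (x j / h)
    rw [le_div_iff₀ hh] at h1
    rw [div_lt_iff₀ hh] at h2
    rw [abs_le]
    constructor <;> nlinarith

/-- If all fibres are short and the points have representatives in a small box, then the number of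
separated points is small. -/
theorem pow_le_pow_of_separated (hB : B ∈ frames n) (hw : IsWeakCanonical B) {i₀ : Idx n}
    {h D L ε : ℝ} (hh : 0 < h) (hL : 0 ≤ L) (hD : 0 ≤ D) {m k : ℕ} (hm : (D + 1) / h + 1 ≤ m)
    (hfib : ∀ (p : Heis n) (s : ℝ), |s| ≤ 1 →
      manifoldDist r B (Quotient.mk _ p) (Quotient.mk _ (p * ⟨zVec s⟩))
        ≤ ENNReal.ofReal (h + L * |s|))
    (hL0 : i₀ = Sum.inr () → L = 0)
    (hrep : ∀ p : Heis n, ∃ g ∈ heisLattice r, ‖(tildeBlock B)⁻¹ *ᵥ hor (g * p).log‖ ≤ D ∧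
      ∀ j, Sum.inl j = i₀ → |((tildeBlock B)⁻¹ *ᵥ hor (g * p).log) j| ≤ h)
    (hε : 4 * n * h + h + L * h < ε) {f : (Idx n → Fin k) → HeisManifold r}
    (hf : ∀ i j, i ≠ j → ENNReal.ofReal ε ≤ manifoldDist r B (f i) (f j)) :
    k ^ (2 * n + 1) ≤ (2 * m + 1) ^ (2 * n) := by
  set T := tildeBlock B
  have hT : IsUnit T.det := isUnit_det_of_frames hw hB
  have hTT : ∀ x, T *ᵥ (T⁻¹ *ᵥ x) = x := fun x => by
    rw [Matrix.mulVec_mulVec, Matrix.mul_nonsing_inv _ hT, Matrix.one_mulVec]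
  let x : Heis n → HIdx n → ℝ := fun p => T⁻¹ *ᵥ hor p.log
  let c : Heis n → HIdx n → ℝ := fun p => T *ᵥ gridPoint i₀ h (x p)
  -- Chosen so that p = exp(c) exp(zZ) exp(hor p - c): grid corner, fibre, small remainder.
  let z : Heis n → ℝ := fun p => ver p.log - 1 / 2 * symp (c p) (hor p.log)
  -- normalised representatives
  have hP : ∀ a : HeisManifold r, ∃ p : Heis n, Quotient.mk _ p = a ∧ ‖x p‖ ≤ D ∧
      (∀ j, Sum.inl j = i₀ → |x p j| ≤ h) ∧ z p ∈ Set.Ico (0 : ℝ) 1 := by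
    intro a
    induction a using Quotient.inductionOn with | h p => ?_
    obtain ⟨g, hg, h1, h2⟩ := hrep p
    obtain ⟨s, hs, hmem⟩ := exists_intReal_add_mem_Ico (z (g * p))
    have hh : hor ((⟨zVec s⟩ : Heis n) * (g * p)).log = hor (g * p).log := by simp
    have hv : ver ((⟨zVec s⟩ : Heis n) * (g * p)).log = ver (g * p).log + s := by
      rw [ver_mul]; simp [add_comm, symp_zero_left]
    have hx : x (⟨zVec s⟩ * (g * p)) = x (g * p) := by simp only [x, hh]
    have hz : z (⟨zVec s⟩ * (g * p)) = z (g * p) + s := by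
      simp only [z, c, hx, hh, hv]; ring
    refine ⟨⟨zVec s⟩ * (g * p), ?_, ?_, ?_, ?_⟩
    · rw [eq_comm, mk_eq_mk_iff]
      exact ⟨⟨zVec s⟩ * g, mul_mem (zVec_mem_heisLattice r hs) hg, by rw [mul_assoc]⟩
    · rw [hx]; exact h1
    · rw [hx]; exact h2
    · rw [hz]; exact hmem
  choose P hPa hPx hPi hPz using hP
  have hnear : ∀ a, manifoldDist r B a (Quotient.mk _ (⟨horVec (c (P a))⟩ * ⟨zVec (z (P a))⟩))
      ≤ ENNReal.ofReal (2 * n * h) := by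
    intro a
    have h1 : P a = ⟨horVec (c (P a))⟩ * ⟨zVec (z (P a))⟩ *
        ⟨horVec (T *ᵥ (x (P a) - gridPoint i₀ h (x (P a))))⟩ := by
      have h2 : T *ᵥ (x (P a) - gridPoint i₀ h (x (P a))) = hor (P a).log - c (P a) := by
        rw [Matrix.mulVec_sub, hTT]
      rw [h2]
      apply heis_ext
      · simp
      · simp [z, symp_sub_right, symp_self]
    have h3 : manifoldDist r B a (Quotient.mk _ (⟨horVec (c (P a))⟩ * ⟨zVec (z (P a))⟩))
        ≤ heisDist B (P a) (⟨horVec (c (P a))⟩ * ⟨zVec (z (P a))⟩) := by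
      nth_rewrite 1 [← hPa a]
      exact manifoldDist_le _ _ _
    refine h3.trans ?_
    rw [heisDist_comm]
    nth_rewrite 3 [h1]
    rw [heisDist_eq_one_left, inv_mul_cancel_left]
    refine (heisDist_one_horVec_le hB hw _).trans (ENNReal.ofReal_le_ofReal ?_)
    rw [Matrix.mulVec_mulVec, Matrix.nonsing_inv_mul _ hT, Matrix.one_mulVec]
    exact eLen_le_of_abs_le (abs_sub_gridPoint_le hh (hPi a)) hh.le
  -- the codes of the cells
  let y : HeisManifold r → Idx n → ℝ := fun a => Sum.elim (x (P a)) fun _ => z (P a)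
  have hy : ∀ a i, i ≠ i₀ → ⌊y a i / h⌋ ∈ Finset.Icc (-m : ℤ) m := by
    intro a i _
    have h1 : |y a i| ≤ D + 1 := by
      rcases i with j | j
      · exact ((norm_le_pi_norm (x (P a)) j).trans (hPx a)).trans (by linarith)
      · have := hPz a
        change |z (P a)| ≤ _
        rw [abs_of_nonneg this.1]; linarith [this.2]
    have h2 : |y a i / h| ≤ (D + 1) / h := by
      rw [abs_div, abs_of_pos hh]; gcongr
    rw [Finset.mem_Icc]
    have h3 := abs_le.1 h2
    constructor
    · rw [Int.le_floor]; push_cast; linarith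
    · have : (⌊y a i / h⌋ : ℝ) ≤ m := (Int.floor_le _).trans (by linarith)
      exact_mod_cast this
  -- One coordinate is left out, so there are at most (2m+1)^(2n) codes; equal codes force distance
  -- less than ε.
  let code : (Idx n → Fin k) → ({i : Idx n // i ≠ i₀} → Finset.Icc (-m : ℤ) m) :=
    fun i l => ⟨⌊y (f i) l / h⌋, hy (f i) l l.2⟩
  have hinj : Function.Injective code := by
    intro i j hij
    by_contra hne
    refine absurd (hf i j hne) (not_le.2 ?_)
    have hcode : ∀ l, l ≠ i₀ → ⌊y (f i) l / h⌋ = ⌊y (f j) l / h⌋ := fun l hl =>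
      congrArg Subtype.val (congrFun hij ⟨l, hl⟩)
    have hc : c (P (f i)) = c (P (f j)) := by
      change T *ᵥ _ = T *ᵥ _
      congr 1
      funext l
      unfold gridPoint
      split_ifs with hl
      · rfl
      · rw [show ⌊x (P (f i)) l / h⌋ = ⌊x (P (f j)) l / h⌋ from hcode (Sum.inl l) hl]
    have hz1 : |z (P (f j)) - z (P (f i))| ≤ 1 := by
      rw [abs_le]
      constructor <;> linarith [(hPz (f i)).1, (hPz (f i)).2, (hPz (f j)).1, (hPz (f j)).2]
    -- When the fibre coordinate is the omitted one, z is controlled only by 1, but then L = 0.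
    have hz2 : L * |z (P (f j)) - z (P (f i))| ≤ L * h := by
      by_cases hi₀ : i₀ = Sum.inr ()
      · rw [hL0 hi₀, zero_mul, zero_mul]
      · have h1 := hcode (Sum.inr ()) (Ne.symm hi₀)
        have h2 := (Int.abs_sub_lt_one_of_floor_eq_floor h1).le
        rw [← sub_div, abs_div, abs_of_pos hh, div_le_one hh, abs_sub_comm] at h2
        exact mul_le_mul_of_nonneg_left h2 hL
    let C : Heis n := ⟨horVec (c (P (f j)))⟩
    let M : Heis n → HeisManifold r := Quotient.mk _
    have hmid : manifoldDist r B (M (C * ⟨zVec (z (P (f i)))⟩)) (M (C * ⟨zVec (z (P (f j)))⟩))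
        ≤ ENNReal.ofReal (h + L * h) := by
      have h1 := hfib (C * ⟨zVec (z (P (f i)))⟩) _ hz1
      rw [mul_assoc, zVec_mul, add_sub_cancel] at h1
      exact h1.trans (ENNReal.ofReal_le_ofReal (by linarith))
    have hi := hnear (f i)
    rw [hc] at hi
    have hj := hnear (f j)
    rw [manifoldDist_comm] at hj
    calc manifoldDist r B (f i) (f j) ≤ ENNReal.ofReal (2 * n * h) +
          (ENNReal.ofReal (h + L * h) + ENNReal.ofReal (2 * n * h)) :=
          ((manifoldDist_triangle _ _ _ _).trans (add_le_add_right
            (manifoldDist_triangle _ _ _ _) _)).trans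
            (add_le_add hi (add_le_add hmid hj))
      _ = ENNReal.ofReal (4 * n * h + h + L * h) := by
          rw [← ENNReal.ofReal_add (by positivity) (by positivity),
            ← ENNReal.ofReal_add (by positivity) (by positivity)]
          congr 1; ring
      _ < ENNReal.ofReal ε := by
          rw [ENNReal.ofReal_lt_ofReal_iff']
          exact ⟨hε, lt_of_le_of_lt (by positivity) hε⟩
  have hcard := Fintype.card_le_of_injective code hinj
  have h1 : Fintype.card {i : Idx n // i ≠ i₀} = 2 * n := by
    have h2 : Fintype.card (Idx n) = 2 * n + 1 := by
      simp only [Fintype.card_sum, Fintype.card_fin, Fintype.card_unit]; ring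
    rw [Fintype.card_subtype_compl, Fintype.card_subtype_eq, h2, Nat.add_sub_cancel]
  rw [Fintype.card_fun, Fintype.card_fun, h1, Fintype.card_coe, Int.card_Icc] at hcard
  have h2 : ((m : ℤ) + 1 - -m).toNat = 2 * m + 1 := by omega
  rw [h2] at hcard
  simpa only [Fintype.card_sum, Fintype.card_fin, Fintype.card_unit, ← two_mul] using hcard

/-- An upper bound of the diameter and a lower bound of the number of separated points bound all
the invariants of a structure of weak canonical form. -/
theorem exists_bounds_of_separated (r : Fin n → ℕ) {D c : ℝ} (hD : 0 < D) (hc : 0 < c) :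
    ∃ k : ℕ, 0 < k ∧ ∃ C₁ C₂ C₃ C₄ : ℝ, 0 < C₁ ∧ 0 < C₂ ∧ 0 < C₃ ∧ 0 < C₄ ∧
      ∀ B ∈ frames n, IsWeakCanonical B →
        (∀ a b : HeisManifold r, manifoldDist r B a b < ENNReal.ofReal D) →
        ∀ f : (Idx n → Fin k) → HeisManifold r,
          (∀ i j, i ≠ j → ENNReal.ofReal (c / k) ≤ manifoldDist r B (f i) (f j)) →
          (∀ X ∈ projLattice r, X ≠ 0 → C₁ ≤ horNorm B X) ∧ C₂ ≤ |(tildeBlock B).det| ∧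
            dMax B ≤ C₃ ∧ |rhoEntry B| ≤ C₄ := by
  obtain ⟨C₂, hC₂, hdet⟩ := exists_le_abs_det n hD
  -- Large enough that 4nh + h + 8nDh < bh = c/k; the summand c ensures h ≤ 1.
  set b : ℝ := 4 * n + 2 + 8 * n * D + c with hb
  have hbpos : 0 < b := by positivity
  obtain ⟨K, hK⟩ := exists_nat_ge (2 * ((2 * D + 2) * b / c + 2) + 1)
  -- With 2m + 1 ≤ Kk, this choice gives k^(2n+1) > (Kk)^(2n), so a covering by 2n coordinates
  -- cannot separate all the points.
  set k : ℕ := K ^ (2 * n) + 1 with hk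
  have hk1 : (1 : ℝ) ≤ k := by rw [hk]; push_cast; linarith [show (0 : ℝ) ≤ (K : ℝ) ^ (2 * n) by positivity]
  have hkpos : (0 : ℝ) < k := by linarith
  set h : ℝ := c / (b * k) with hh
  have hhpos : 0 < h := by positivity
  have hh1 : h ≤ 1 := by
    rw [hh, div_le_one (by positivity)]
    have : 0 ≤ 4 * n + 2 + 8 * n * D := by positivity
    nlinarith
  have hbh : b * h = c / k := by rw [hh]; field_simp
  obtain ⟨m, hm1, hm2⟩ : ∃ m : ℕ, (2 * D + 1 + 1) / h + 1 ≤ m ∧ 2 * m + 1 ≤ K * k := by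
    refine ⟨⌈(2 * D + 1 + 1) / h + 1⌉₊, Nat.le_ceil _, ?_⟩
    have h1 := (Nat.ceil_lt_add_one (by positivity : 0 ≤ (2 * D + 1 + 1) / h + 1)).le
    have h2 : (2 * D + 1 + 1) / h = (2 * D + 2) * b / c * k := by rw [hh]; field_simp; ring
    rw [h2] at h1 ⊢
    have h3 : (2 * ((2 * D + 2) * b / c + 2) + 1) * k ≤ K * k := by gcongr
    have : (2 * (⌈(2 * D + 2) * b / c * k + 1⌉₊ : ℝ) + 1) ≤ K * k := by nlinarith
    exact_mod_cast this
  have hcount : ¬ k ^ (2 * n + 1) ≤ (2 * m + 1) ^ (2 * n) := by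
    rw [not_le]
    calc (2 * m + 1) ^ (2 * n) ≤ (K * k) ^ (2 * n) := Nat.pow_le_pow_left hm2 _
      _ = K ^ (2 * n) * k ^ (2 * n) := mul_pow _ _ _
      _ < k * k ^ (2 * n) := by
        have : 0 < k := by omega
        exact Nat.mul_lt_mul_of_pos_right (by omega) (by positivity)
      _ = k ^ (2 * n + 1) := by ring
  -- The constants are the thresholds of the three collapses: 2η < h for a lattice vector of length
  -- η < h/2, 4√(1/C) = h for C = 16/h², and |s|/|ρ| < h for |ρ| > 1/h.
  refine ⟨k, by omega, h / 2, C₂, 16 / h ^ 2, 1 / h, by positivity, hC₂, by positivity,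
    by positivity, fun B hB hw hdiam f hf => ?_⟩
  set T := tildeBlock B
  have hT : IsUnit T.det := isUnit_det_of_frames hw hB
  -- If all central fibres were short, the vertical coordinate could be omitted from the count.
  have hshort : ¬ ∀ s : ℝ, |s| ≤ 1 → heisDist B 1 ⟨zVec s⟩ ≤ ENNReal.ofReal h := by
    intro hz
    refine hcount (pow_le_pow_of_separated hB hw (i₀ := Sum.inr ()) hhpos le_rfl
      (by positivity : 0 ≤ 2 * D + 1) hm1 (fun p s hs => ?_) (fun _ => rfl) (fun p => ?_)
      (?_ : _ < c / k) hf)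
    · refine (manifoldDist_le _ _ _).trans ?_
      rw [heisDist_eq_one_left, inv_mul_cancel_left, zero_mul, add_zero]
      exact hz s hs
    · obtain ⟨g, hg, hle⟩ := exists_rep_norm_le hB hw hdiam p
      exact ⟨g, hg, hle.trans (by linarith), fun j hj => absurd hj Sum.inl_ne_inr⟩
    · rw [← hbh, hb]
      have : 0 ≤ n * D := by positivity
      nlinarith
  refine ⟨fun X hX hX0 => ?_, hdet r B hB hw hdiam, ?_, ?_⟩
  · by_contra! hlt
    rw [horNorm_eq hw hT] at hlt
    have hX' := mem_projLattice.1 hX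
    set u := T⁻¹ *ᵥ X with hu
    have hu0 : u ≠ 0 := fun h0 => hX0 <| by
      rw [← Matrix.one_mulVec X, ← Matrix.mul_nonsing_inv _ hT, ← Matrix.mulVec_mulVec, ← hu, h0,
        Matrix.mulVec_zero]
    -- Multiples of the short lattice vector reduce its largest coordinate to size at most h. The
    -- other coordinates then change by at most D + h/2, so representatives stay in a box of size 2D
    -- + 1.
    obtain ⟨j₀, hj₀⟩ : ∃ j₀, ∀ j, |u j| ≤ |u j₀| := by
      obtain ⟨i, -⟩ := Function.ne_iff.1 hu0
      have : Nonempty (HIdx n) := ⟨i⟩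
      exact Finite.exists_max fun j => |u j|
    have hj₀pos : 0 < |u j₀| := by
      obtain ⟨i, hi⟩ := Function.ne_iff.1 hu0
      exact (abs_pos.2 hi).trans_le (hj₀ i)
    have huh : |u j₀| ≤ h / 2 := (abs_le_eLen u j₀).trans hlt.le
    refine hcount (pow_le_pow_of_separated hB hw (i₀ := Sum.inl j₀) (L := 8 * n * D) hhpos
      (by positivity) (by positivity : 0 ≤ 2 * D + 1) hm1 (fun p s _ => ?_)
      (fun h0 => absurd h0 Sum.inl_ne_inr) (fun p => ?_) (?_ : _ < c / k) hf)
    · refine (manifoldDist_mul_zVec_le hB hw hdiam hX' hX0 p s).trans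
        (ENNReal.ofReal_le_ofReal ?_)
      linarith
    · obtain ⟨g, hg, hle⟩ := exists_rep_norm_le hB hw hdiam p
      set x := T⁻¹ *ᵥ hor (g * p).log with hx
      let l : ℤ := -round (x j₀ / u j₀)
      obtain ⟨g', hg', hgX⟩ := exists_mem_heisLattice ((horLattice r).zsmul_mem hX' l)
      have hval : T⁻¹ *ᵥ hor (g' * g * p).log = (l : ℝ) • u + x := by
        rw [mul_assoc, hor_mul, hgX, Matrix.mulVec_add, ← Int.cast_smul_eq_zsmul ℝ,
          Matrix.mulVec_smul]
      have hj₀u : u j₀ ≠ 0 := abs_pos.1 hj₀pos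
      have hres : |l * u j₀ + x j₀| ≤ |u j₀| := by
        have h1 := abs_sub_round (x j₀ / u j₀)
        have h2 : l * u j₀ + x j₀ = (x j₀ / u j₀ - round (x j₀ / u j₀)) * u j₀ := by
          simp only [l]; push_cast; field_simp; ring
        rw [h2, abs_mul]
        nlinarith
      refine ⟨g' * g, mul_mem hg' hg, ?_, fun j hj => ?_⟩
      · rw [hval]
        refine (pi_norm_le_iff_of_nonneg (by positivity)).2 fun j => ?_
        have hxj : ∀ j, |x j| ≤ D := fun j => (norm_le_pi_norm x j).trans hle
        have h1 : |l * u j| ≤ |l * u j₀| := by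
          rw [abs_mul, abs_mul]
          exact mul_le_mul_of_nonneg_left (hj₀ j) (abs_nonneg _)
        have h2 := abs_sub (l * u j₀ + x j₀) (x j₀)
        rw [add_sub_cancel_right] at h2
        have h3 := abs_add_le (l * u j) (x j)
        change |l * u j + x j| ≤ _
        linarith [hxj j, hxj j₀]
      · obtain rfl := Sum.inl_injective hj
        rw [hval]
        change |l * u j + x j| ≤ _
        linarith
    · rw [← hbh, hb]
      nlinarith
  · refine dMax_le hT (by positivity) fun u v => ?_
    by_contra! hlt
    refine hshort fun s hs => (heisDist_one_zVec_le_of_symp hw (by positivity) hlt hs).trans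
      (ENNReal.ofReal_le_ofReal ?_)
    have h1 : 1 / (16 / h ^ 2) = (h / 4) ^ 2 := by field_simp; norm_num
    rw [h1, Real.sqrt_sq (by positivity)]
    linarith
  · by_contra! hlt
    have h0 : rhoEntry B ≠ 0 := abs_pos.1 (lt_trans (by positivity) hlt)
    refine hshort fun s hs => (heisDist_one_zVec_le_of_rhoEntry hw h0 s).trans
      (ENNReal.ofReal_le_ofReal ?_)
    rw [div_lt_iff₀ hhpos] at hlt
    rw [div_le_iff₀ (abs_pos.2 h0)]
    linarith

end Covering

/-! ### Compact sets of structures are bounded -/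

section Bounded

open Topology

variable {n : ℕ} {r : Fin n → ℕ}

/-- The lattice acts on a neighbourhood of the identity in a uniformly discrete way. -/
theorem eq_one_of_norm_log_lt {s : ℝ} (hs : 0 ≤ s) (hns : 4 * (n + 1) * s ≤ 1) {p q : Heis n}
    (hp : ‖p.log‖ ≤ s) (hq : ‖q.log‖ ≤ s) {g : Heis n} (hg : g ∈ heisLattice r)
    (hlt : ‖(p⁻¹ * (g * q)).log‖ < 1 / 4) : g = 1 := by
  have hs4 : s ≤ 1 / 4 := by nlinarith [show (0 : ℝ) ≤ n * s by positivity]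
  have hns4 : n * s ≤ 1 / 4 := by nlinarith
  obtain ⟨h1, h2⟩ := mem_heisLattice.1 hg
  have hhp := (norm_hor_le p.log).trans hp
  have hhq := (norm_hor_le q.log).trans hq
  have hor0 : hor g.log = 0 := by
    have h3 : hor g.log = hor (p⁻¹ * (g * q)).log + (hor p.log - hor q.log) := by
      rw [hor_mul, hor_mul, hor_inv]
      abel
    refine eq_zero_of_mem_horLattice h1 ?_
    rw [h3]
    have h4 := (norm_hor_le (p⁻¹ * (g * q)).log).trans_lt hlt
    have h5 := norm_sub_le (hor p.log) (hor q.log)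
    refine (norm_add_le _ _).trans_lt ?_
    linarith
  rw [hor0, halfForm_zero, sub_zero] at h2
  apply heis_ext
  · rw [hor0]; rfl
  · refine eq_zero_of_mem_intReal h2 ?_
    have h3 : ver g.log = ver (p⁻¹ * (g * q)).log
        + (ver p.log - ver q.log + 1 / 2 * symp (hor p.log) (hor q.log)) := by
      simp [hor0, symp_zero_left, symp_neg_left]
      ring
    have h4 := (abs_ver_le (p⁻¹ * (g * q)).log).trans_lt hlt
    have h5 := abs_symp_le (hor p.log) (hor q.log)
    have h6 : 2 * n * ‖hor p.log‖ * ‖hor q.log‖ ≤ 2 * n * s * s := by gcongr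
    have h7 := (abs_ver_le p.log).trans hp
    have h8 := (abs_ver_le q.log).trans hq
    have h9 : n * s * s ≤ 1 / 16 := by nlinarith
    rw [h3]
    rw [abs_lt] at h4 ⊢
    rw [abs_le] at h5 h7 h8
    constructor <;> linarith

/-- The growth of the number of separated points is that of the topological dimension. -/
theorem exists_separated {A : Matrix (Idx n) (Idx n) ℝ} (hA : A ∈ frames n) (r : Fin n → ℕ) :
    ∃ c : ℝ, 0 < c ∧ ∀ k : ℕ, 0 < k → ∃ f : (Idx n → Fin k) → HeisManifold r,
      ∀ i j, i ≠ j → ENNReal.ofReal (2 * (c / k)) ≤ manifoldDist r A (f i) (f j) := by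
  set M := matSum A
  have hM : 0 ≤ M := matSum_nonneg A
  -- Small enough that no nontrivial lattice element brings points of this box near each other.
  set s : ℝ := 1 / (4 * (n + 1)) with hs
  have hspos : 0 < s := by positivity
  have hs1 : 4 * (n + 1) * s = 1 := by rw [hs]; field_simp
  have hs4 : s ≤ 1 / 4 := by nlinarith [show (0 : ℝ) ≤ n * s by positivity]
  set K := M + n * M * M
  have hK : 0 ≤ K := by positivity
  -- A path shorter than 2c/k then moves coordinates by less than the grid step s/k.
  set c : ℝ := s / (2 * (K + 1)) with hc
  have hcpos : 0 < c := by positivity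
  have hcK : 2 * c * (K + 1) = s := by rw [hc]; field_simp
  refine ⟨c, hcpos, fun k hk => ?_⟩
  have hk1 : (1 : ℝ) ≤ k := by exact_mod_cast hk
  have hkpos : (0 : ℝ) < k := by linarith
  let P : (Idx n → Fin k) → Heis n := fun i => ⟨fun l => s / k * (i l : ℕ)⟩
  have hP : ∀ i, ‖(P i).log‖ ≤ s := fun i => by
    refine (pi_norm_le_iff_of_nonneg hspos.le).2 fun l => ?_
    have h1 : ((i l : ℕ) : ℝ) ≤ k := by exact_mod_cast (i l).2.le
    change |s / k * ((i l : ℕ) : ℝ)| ≤ s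
    rw [abs_of_nonneg (by positivity), div_mul_eq_mul_div, div_le_iff₀ hkpos]
    gcongr
  have hcoord : ∀ {i j : Idx n → Fin k} {l : Idx n}, i l ≠ j l →
      s / k ≤ |s / k * ((j l : ℕ) : ℝ) - s / k * ((i l : ℕ) : ℝ)| := by
    intro i j l hl
    have h1 : (1 : ℝ) ≤ |((j l : ℕ) : ℝ) - ((i l : ℕ) : ℝ)| := by
      have h2 : ((j l : ℕ) : ℤ) - (i l : ℕ) ≠ 0 := fun h => hl (Fin.ext (by omega))
      have h3 := Int.one_le_abs h2
      exact_mod_cast h3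
    rw [← mul_sub, abs_mul, abs_of_pos (by positivity : 0 < s / k)]
    have : 0 < s / k := by positivity
    nlinarith
  refine ⟨fun i => Quotient.mk _ (P i), fun i j hij => ?_⟩
  by_contra! hlt
  obtain ⟨g, hg, hlt⟩ := manifoldDist_lt_iff.1 hlt
  rw [heisDist_eq_one_left] at hlt
  have hδ : 2 * (c / k) ≤ 1 := by
    have h1 : c / k ≤ c := div_le_self hcpos.le hk1
    nlinarith
  have hlog := norm_log_le_of_heisDist_lt hA hM (norm_mulVec_le A) hδ hlt
  have hlog' : ‖((P i)⁻¹ * (g * P j)).log‖ < s / k := by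
    refine hlog.trans_lt ?_
    have : K * (2 * (c / k)) = K * (2 * c) / k := by ring
    rw [this]
    gcongr
    nlinarith
  have hsk : s / k ≤ 1 / 4 := (div_le_self hspos.le hk1).trans hs4
  obtain rfl := eq_one_of_norm_log_lt hspos.le hs1.le (hP i) (hP j) hg (hlog'.trans_le hsk)
  rw [one_mul] at hlog'
  have hhor : hor (P i).log = hor (P j).log := by
    funext l
    by_contra hne
    have h1 : i (Sum.inl l) ≠ j (Sum.inl l) := fun h => hne (by simp [P, hor, h])
    refine absurd ((hcoord h1).trans ?_) (not_le.2 hlog')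
    have h2 : hor ((P i)⁻¹ * P j).log l
        = s / k * ((j (Sum.inl l) : ℕ) : ℝ) - s / k * ((i (Sum.inl l) : ℕ) : ℝ) := by
      rw [hor_mul, hor_inv]
      simp only [Pi.add_apply, Pi.neg_apply]
      rw [neg_add_eq_sub]; rfl
    rw [← h2]
    exact (norm_le_pi_norm _ l).trans (norm_hor_le _)
  -- Once the horizontal parts agree, the bracket term of the group law vanishes.
  have hver : i (Sum.inr ()) = j (Sum.inr ()) := by
    by_contra hne
    refine absurd ((hcoord hne).trans ?_) (not_le.2 hlog')
    have h2 : ver ((P i)⁻¹ * P j).log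
        = s / k * ((j (Sum.inr ()) : ℕ) : ℝ) - s / k * ((i (Sum.inr ()) : ℕ) : ℝ) := by
      rw [ver_mul, hor_inv, ver_inv, hhor, symp_neg_left, symp_self, neg_zero, mul_zero, add_zero,
        neg_add_eq_sub]
      rfl
    rw [← h2]
    exact abs_ver_le _
  refine hij (funext fun l => ?_)
  rcases l with l | l
  · by_contra hne
    have h1 := hcoord (i := i) (j := j) hne
    have h2 := congrFun hhor l
    change s / k * _ = s / k * _ at h2
    rw [h2, sub_self, abs_zero] at h1
    exact absurd h1 (not_le.2 (by positivity))
  · exact hver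

/-- Upper bounds of the diameter and lower bounds of the number of separated points persist in a
neighbourhood of an isometry class. -/
theorem exists_nhds_separated (hn : 1 ≤ n) (hr : ∀ i, 0 < r i) (A₀ : frames n) {D s₀ s : ℝ}
    (hD : 0 ≤ D) (hs : s₀ < s) {k : ℕ}
    (hdiam : ∀ a b : HeisManifold r, manifoldDist r A₀.1 a b ≤ ENNReal.ofReal D)
    {f : (Idx n → Fin k) → HeisManifold r}
    (hf : ∀ i j, i ≠ j → ENNReal.ofReal s ≤ manifoldDist r A₀.1 (f i) (f j)) :
    ∃ U ∈ 𝓝 (moduliClass r A₀), ∀ A : frames n, moduliClass r A ∈ U →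
      (∀ a b : HeisManifold r, manifoldDist r A.1 a b < ENNReal.ofReal (D + 1)) ∧
      ∃ f : (Idx n → Fin k) → HeisManifold r,
        ∀ i j, i ≠ j → ENNReal.ofReal s₀ ≤ manifoldDist r A.1 (f i) (f j) := by
  -- The slack in D' and s' makes the set open. Both conditions are invariant under isometries, so
  -- it is saturated and its image is open.
  let G : Set (frames n) := {A | ∃ D' s' : ℝ, 0 ≤ D' ∧ D' < D + 1 ∧ s₀ < s' ∧
    (∀ a b : HeisManifold r, manifoldDist r A.1 a b ≤ ENNReal.ofReal D') ∧
      ∃ f : (Idx n → Fin k) → HeisManifold r,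
        ∀ i j, i ≠ j → ENNReal.ofReal s' ≤ manifoldDist r A.1 (f i) (f j)}
  have hGopen : IsOpen G := by
    rw [isOpen_iff_mem_nhds]
    rintro A ⟨D', s', hD0, hD', hs', hd, f, hf⟩
    set ε := min ((D + 1 - D') / 2) ((s' - s₀) / 2)
    have hε : 0 < ε := lt_min (by linarith) (by linarith)
    have hε1 : ε ≤ (D + 1 - D') / 2 := min_le_left _ _
    have hε2 : ε ≤ (s' - s₀) / 2 := min_le_right _ _
    have hev := eventually_manifoldDist_le_add (r := r) hn hr A.2 hε
    rw [nhdsWithin_eq_map_subtype_coe A.2, Filter.eventually_map] at hev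
    filter_upwards [hev] with B hB
    refine ⟨D' + ε, s' - ε, by linarith, by linarith, by linarith, fun a b => ?_, f,
      fun i j hij => ?_⟩
    · rw [ENNReal.ofReal_add hD0 hε.le]
      exact (hB a b).1.trans (add_le_add_left (hd a b) _)
    · rcases le_or_gt (s' - ε) 0 with h0 | h0
      · rw [ENNReal.ofReal_of_nonpos h0]; exact zero_le
      · have h1 := (hf i j hij).trans (hB (f i) (f j)).2
        rw [← sub_add_cancel s' ε, ENNReal.ofReal_add h0.le hε.le] at h1
        exact (ENNReal.add_le_add_iff_right ENNReal.ofReal_ne_top).1 h1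
  have hGsat : ∀ A B : frames n, moduliClass r A = moduliClass r B → A ∈ G → B ∈ G := by
    rintro A B hAB ⟨D', s', hD0, hD', hs', hd, f, hf⟩
    obtain ⟨F, hF⟩ := Quotient.exact hAB
    refine ⟨D', s', hD0, hD', hs', fun a b => ?_, F ∘ f, fun i j hij => ?_⟩
    · have := hF (F.symm a) (F.symm b)
      rw [F.apply_symm_apply, F.apply_symm_apply] at this
      rw [this]; exact hd _ _
    · rw [Function.comp_apply, Function.comp_apply, hF]; exact hf i j hij
  refine ⟨moduliClass r '' G, ?_, ?_⟩
  · refine IsOpen.mem_nhds ?_ ⟨A₀, ⟨D, s, hD, by linarith, hs, hdiam, f, hf⟩, rfl⟩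
    rw [← isQuotientMap_quotient_mk'.isOpen_preimage]
    convert hGopen using 1
    ext A
    exact ⟨fun ⟨B, hB, h⟩ => hGsat B A h hB, fun hA => ⟨A, hA, rfl⟩⟩
  · rintro A ⟨B, hB, h⟩
    obtain ⟨D', s', hD0, hD', hs', hd, f, hf⟩ := hGsat B A h hB
    refine ⟨fun a b => (hd a b).trans_lt ?_, f, fun i j hij =>
      (ENNReal.ofReal_le_ofReal hs'.le).trans (hf i j hij)⟩
    rw [ENNReal.ofReal_lt_ofReal_iff (by linarith)]
    exact hD'

/-- Uniform bounds survive finite unions, so it suffices to find them in a neighbourhood of each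
class. -/
theorem exists_bounds_of_isCompact (hn : 1 ≤ n) (hr : ∀ i, 0 < r i) {𝒦 : Set (Moduli r)}
    (h𝒦 : IsCompact 𝒦) : ∃ C₁ C₂ C₃ C₄ : ℝ, 0 < C₁ ∧ 0 < C₂ ∧ 0 < C₃ ∧ 0 < C₄ ∧
      ∀ A : frames n, IsWeakCanonical A.1 → moduliClass r A ∈ 𝒦 →
        (∀ X ∈ projLattice r, X ≠ 0 → C₁ ≤ horNorm A.1 X) ∧ C₂ ≤ |(tildeBlock A.1).det| ∧
          dMax A.1 ≤ C₃ ∧ |rhoEntry A.1| ≤ C₄ := by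
  refine h𝒦.induction_on (p := fun s => ∃ C₁ C₂ C₃ C₄ : ℝ, 0 < C₁ ∧ 0 < C₂ ∧ 0 < C₃ ∧ 0 < C₄ ∧
    ∀ A : frames n, IsWeakCanonical A.1 → moduliClass r A ∈ s →
      (∀ X ∈ projLattice r, X ≠ 0 → C₁ ≤ horNorm A.1 X) ∧ C₂ ≤ |(tildeBlock A.1).det| ∧
        dMax A.1 ≤ C₃ ∧ |rhoEntry A.1| ≤ C₄) ?_ ?_ ?_ ?_
  · exact ⟨1, 1, 1, 1, one_pos, one_pos, one_pos, one_pos, fun _ _ h => h.elim⟩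
  · intro s t hst h
    obtain ⟨C₁, C₂, C₃, C₄, h₁, h₂, h₃, h₄, H⟩ := h
    exact ⟨C₁, C₂, C₃, C₄, h₁, h₂, h₃, h₄, fun A hA hs => H A hA (hst hs)⟩
  · intro s t h h'
    obtain ⟨C₁, C₂, C₃, C₄, h₁, h₂, h₃, h₄, H⟩ := h
    obtain ⟨C₁', C₂', C₃', C₄', h₁', h₂', h₃', h₄', H'⟩ := h'
    refine ⟨min C₁ C₁', min C₂ C₂', max C₃ C₃', max C₄ C₄', lt_min h₁ h₁', lt_min h₂ h₂',
      lt_max_of_lt_left h₃, lt_max_of_lt_left h₄, fun A hA hst => ?_⟩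
    rcases hst with hs | ht
    · obtain ⟨a, b, c, d⟩ := H A hA hs
      exact ⟨fun X hX hX0 => (min_le_left _ _).trans (a X hX hX0), (min_le_left _ _).trans b,
        c.trans (le_max_left _ _), d.trans (le_max_left _ _)⟩
    · obtain ⟨a, b, c, d⟩ := H' A hA ht
      exact ⟨fun X hX hX0 => (min_le_right _ _).trans (a X hX hX0), (min_le_right _ _).trans b,
        c.trans (le_max_right _ _), d.trans (le_max_right _ _)⟩
  · intro x _
    induction x using Quotient.inductionOn with | h A₀ => ?_
    obtain ⟨D, hD, hdiam⟩ := exists_diam_bound (r := r) hn hr A₀.2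
    obtain ⟨c, hc, hsep⟩ := exists_separated A₀.2 r
    -- The scale k depends only on the diameter bound and the separation constant at `A₀`.
    -- Separation 2c/k there leaves c/k for nearby classes.
    obtain ⟨k, hk, C₁, C₂, C₃, C₄, h₁, h₂, h₃, h₄, H⟩ :=
      exists_bounds_of_separated r (by linarith : 0 < D + 1) hc
    obtain ⟨f, hf⟩ := hsep k hk
    have hck : 0 < c / k := div_pos hc (Nat.cast_pos.2 hk)
    obtain ⟨U, hU, hUH⟩ := exists_nhds_separated hn hr A₀ hD.le
      (by linarith : c / k < 2 * (c / k)) (fun a b => (hdiam a b).le) hf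
    refine ⟨U, mem_nhdsWithin_of_mem_nhds hU, C₁, C₂, C₃, C₄, h₁, h₂, h₃, h₄, fun A hA hAU => ?_⟩
    obtain ⟨hd, f, hf⟩ := hUH A hAU
    exact H A.1 A.2 hA hd f hf

end Bounded

/-! ### The characterization of precompact sets -/

theorem theorem1p5 (n : ℕ) (hn : 1 ≤ n) (r : Fin n → ℕ) (hr : ∀ i, 0 < r i)
    (hdvd : ∀ i j : Fin n, i ≤ j → r i ∣ r j) (𝒳 : Set (Moduli r)) :
    IsCompact (closure 𝒳) ↔
      ∃ C₁ C₂ C₃ C₄ : ℝ, 0 < C₁ ∧ 0 < C₂ ∧ 0 < C₃ ∧ 0 < C₄ ∧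
        ∀ A : frames n, IsWeakCanonical A.1 → moduliClass r A ∈ 𝒳 →
          (∀ X ∈ projLattice r, X ≠ 0 → C₁ ≤ horNorm A.1 X) ∧
          C₂ ≤ |(tildeBlock A.1).det| ∧
          dMax A.1 ≤ C₃ ∧
          |rhoEntry A.1| ≤ C₄ := by
  constructor
  · intro h
    obtain ⟨C₁, C₂, C₃, C₄, h₁, h₂, h₃, h₄, H⟩ := exists_bounds_of_isCompact hn hr h
    exact ⟨C₁, C₂, C₃, C₄, h₁, h₂, h₃, h₄, fun A hA hX => H A hA (subset_closure hX)⟩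
  · rintro ⟨C₁, C₂, C₃, C₄, h₁, h₂, h₃, -, H⟩
    exact isCompact_closure_of_bounds hn hr h₁ h₂ h₃ H
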